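/- Let $\Theta\subseteq\mathbb R$ and let $\{p(\theta)=(p_k(\theta))_{k\ge 0}:\theta\in\Theta\}$ be a family of probability distributions on the nonnegative integers with common support (for each $k$, either $p_k(\theta)>0$ for all $\theta\in\Theta$ or $p_k(\theta)=0$ for all $\theta\in\Theta$), each $p_k(\cdot)$ being twice continuously differentiable on $\mathrm{int}(\Theta)$. Fix $\theta_0\in\mathrm{int}(\Theta)$ and put $s_k(\theta)=p_k(\theta)^{1/2}$, $u(\theta,k)=p_k'(\theta)/p_k(\theta)$, $I(\theta)=\sum_k u(\theta,k)^2p_k(\theta)$ (terms with $p_k\equiv 0$ are read as $0$). **Process.** Let $Z_0=N\in\mathbb{N}_0$ and $Z_{n+1}=\sum_{j=1}^{\phi_n(Z_n)}X_{nj}$, where $\{X_{nj}\}$ and $\{\phi_n(k)\}$ are two independent families of nonnegative integer valued random variables, the $X_{nj}$ are i.i.d. with law $p(\theta_0)$, of mean $m$ and finite variance, and the processes $\{\phi_n(k)\}_{k\ge0}$, $n\ge 0$, are independent with the same one-dimensional distributions; $\varepsilon(k)=E[\phi_0(k)]$ and $\sigma^2(k)=\mathrm{Var}[\phi_0(k)]$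 are finite. Assume (A3): $\tau=\lim_k\varepsilon(k)/k$ exists and is finite; $\{\sigma^2(k)/k\}_{k\ge1}$ is bounded; $\tau_m:=\tau m>1$; $P[Z_n\to\infty]>0$; $Z_n\tau_m^{-n}$ converges a.s. to a finite random variable $W$ with $P[W>0]>0$; and $\{W>0\}=\{Z_n\to\infty\}$ a.s. Let $\Delta_{n-1}=\sum_{l=0}^{n-1}\phi_l(Z_l)$ and let $\hat p_{n,k}$ be the proportion, among the $\Delta_{n-1}$ progenitors of generations $0,\dots,n-1$, of those with exactly $k$ offspring ($\hat p_n$ is the maximum likelihood estimator of the offspring law based on the whole family tree). **Disparities.** Let $G:[-1,\infty)\to\mathbb R$ be continuous and strictly convex, three times differentiable on $(-1,\infty)$, with $G(0)=0$; let $A(\delta)=(\delta+1)G'(\delta)-G(\delta)$ be its residual adjustment function (RAF) and assume $A'(0)\neq0$ (so that $A$ can be standardised to $A(0)=0$, $A'(0)=1$). Put $\rho(q,\theta)=\sum_k G\big(q_k/p_k(\theta)-1\big)p_k(\theta)$ (terms with $p_k\equiv 0$ are read as $0$). A disparity functional $T^\rho$ assigns to each probability distribution $q$ for which $\rho(q,\cdot)$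 has a minimiser over $\Theta$ one such minimiser (any choice); the minimum disparity estimator is $\tilde\theta_n^\rho=T^\rho(\hat p_n)$. The squared Hellinger distance $HD$ is the case $G(\delta)=(\sqrt{\delta+1}-1)^2$. Assume that there is a compact set $C_\rho\subseteq\Theta$ with (A2): each $p_k(\cdot)$ is continuous on $C_\rho$; and $p(\theta_0)\in\hat\Gamma_\rho$, that is, $\inf_{\theta\in\Theta\setminus C_\rho}\rho(p(\theta_0),\theta)>\rho(p(\theta_0),\theta^*)$ for some $\theta^*\in C_\rho$ (with $\inf\emptyset=+\infty$), and $\rho(p(\theta_0),\cdot)$ has a unique minimiser over $\Theta$. Convergence in probability and in distribution below is with respect to $P[\,\cdot\mid Z_n\to\infty]$. **(i)** Suppose that * (A1) $G$ and $G'$ are bounded; * (A4) for each $\theta\in\mathrm{int}(\Theta)$ there are $\epsilon>0$ with $(\theta-\epsilon,\theta+\epsilon)\subseteq\Theta$ and summable sequences $J_k,L_k,M_k$ with $|p_k'(t)|<J_k$, $|p_k''(t)|<L_k$, $|u(t,k)^2p_k(t)|<M_k$ for all $k$ and all $t\in(\theta-\epsilon,\theta+\epsilon)$; * (A5) $A(\delta)$,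 $A'(\delta)$, $A'(\delta)(1+\delta)$, $A''(\delta)(1+\delta)$ are bounded on $(-1,\infty)$; * $\sum_k|s_k'(\theta_0)|<\infty$ and $I(\theta_0)>0$; * every sequence $\{\varphi_n\}$ of $\Theta$-valued estimators ($\varphi_n$ a function of the offspring counts of generations $0,\dots,n-1$) that converges to $\theta_0$ in probability satisfies $\sum_k|p_k''(\varphi_n)-p_k''(\theta_0)|\to0$ and $\sum_k|u(\varphi_n,k)^2p_k(\varphi_n)-u(\theta_0,k)^2p_k(\theta_0)|\to0$ in probability. Then $$\Delta_{n-1}^{1/2}\big(\tilde\theta_n^\rho-\theta_0\big)\xrightarrow{d}N\big(0,I(\theta_0)^{-1}\big).\qquad(*)$$ **(ii)** For $\rho=HD$, $(*)$ also holds if instead (A6): at each $\theta\in\mathrm{int}(\Theta)$, $s(\theta)$ is twice differentiable in $\ell^2$, that is, there are $s'(\theta),s''(\theta)\in\ell^2$ with $s_k(\theta+\beta)=s_k(\theta)+\beta s_k'(\theta)+\beta v_k(\beta)$ and $s_k'(\theta+\beta)=s_k'(\theta)+\beta s_k''(\theta)+\beta w_k(\beta)$, where $\sum_kv_k(\beta)^2\to0$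 and $\sum_kw_k(\beta)^2\to0$ as $\beta\to0$; and $\sum_k s_k''(\theta_0)p_k(\theta_0)^{1/2}<0$. -/

import Mathlib

open MeasureTheory ProbabilityTheory Filter Topology Set

noncomputable section

namespace CBP

/-! ### Probability distributions on the nonnegative integers and parametric families -/

/-- `q` is a probability distribution on the nonnegative integers. -/
def IsProb (q : ℕ → ℝ) : Prop := (∀ k, 0 ≤ q k) ∧ HasSum q 1

/-- `{p θ : θ ∈ Θ}` is a parametric family of probability distributions on `ℕ`. All members have the
same support, so that the Pearson residuals `p θ' k / p θ k - 1` are finite; `p k > 0` for all `k`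
is a special case, and where all `p θ k` vanish both `0 / 0 = 0` below and the factor `p θ k = 0`
make the index `k` irrelevant. The coordinates are twice continuously differentiable in the interior
of the parameter set. -/
structure IsFamily (p : ℝ → ℕ → ℝ) (Θ : Set ℝ) : Prop where
  isProb : ∀ θ ∈ Θ, IsProb (p θ)
  common_support : ∀ θ ∈ Θ, ∀ θ' ∈ Θ, ∀ k, p θ k = 0 → p θ' k = 0
  contDiffOn : ∀ k, ContDiffOn ℝ 2 (fun θ => p θ k) (interior Θ)

/-- Coordinatewise derivative with respect to the parameter. -/
def dθ (p : ℝ → ℕ → ℝ) (θ : ℝ) (k : ℕ) : ℝ := deriv (fun t => p t k) θ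

/-- `s(θ) = p(θ)^{1/2}`. -/
def sqrtFamily (p : ℝ → ℕ → ℝ) (θ : ℝ) (k : ℕ) : ℝ := √(p θ k)

/-- The score `u(θ, k) = p'_k(θ) / p_k(θ)`. -/
def score (p : ℝ → ℕ → ℝ) (θ : ℝ) (k : ℕ) : ℝ := dθ p θ k / p θ k

/-- The Fisher information `I(θ) = ∑ u(θ, k)² p_k(θ)`. -/
def fisherInfo (p : ℝ → ℕ → ℝ) (θ : ℝ) : ℝ := ∑' k, score p θ k ^ 2 * p θ k

/-- Local domination of the derivatives of the family and of the terms of the Fisher information. -/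
def LocallyDominated (p : ℝ → ℕ → ℝ) (Θ : Set ℝ) : Prop :=
  ∀ θ ∈ interior Θ, ∃ ε > 0, Ioo (θ - ε) (θ + ε) ⊆ Θ ∧
    ∃ J L M : ℕ → ℝ, Summable J ∧ Summable L ∧ Summable M ∧
      ∀ t ∈ Ioo (θ - ε) (θ + ε), ∀ k,
        |dθ p t k| < J k ∧ |dθ (dθ p) t k| < L k ∧ |score p t k ^ 2 * p t k| < M k

/-- `f' ∈ ℓ²` is the derivative at `θ` of the family of sequences `f`, in the sense that
`f_k(θ + β) = f_k(θ) + β f'_k + β v_k(β)` with `∑ v_k(β)² → 0` as `β → 0`. -/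
def HasL2DerivAt (f : ℝ → ℕ → ℝ) (f' : ℕ → ℝ) (θ : ℝ) : Prop :=
  Summable (fun k => f' k ^ 2) ∧
  (∀ᶠ β in 𝓝[≠] (0 : ℝ), Summable fun k => ((f (θ + β) k - f θ k) / β - f' k) ^ 2) ∧
  Tendsto (fun β => ∑' k, ((f (θ + β) k - f θ k) / β - f' k) ^ 2) (𝓝[≠] (0 : ℝ)) (𝓝 0)

/-- In the interior of `Θ`, `s(θ) = p(θ)^{1/2}` is twice differentiable in `ℓ²`, with first and
second derivatives `s'` and `s''`. -/
def TwiceL2Diff (p : ℝ → ℕ → ℝ) (Θ : Set ℝ) (s' s'' : ℝ → ℕ → ℝ) : Prop :=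
  ∀ θ ∈ interior Θ, HasL2DerivAt (sqrtFamily p) (s' θ) θ ∧ HasL2DerivAt s' (s'' θ) θ

/-! ### Disparities -/

/-- The residual adjustment function `A(δ) = (δ + 1) G'(δ) - G(δ)`. -/
def raf (G : ℝ → ℝ) (δ : ℝ) : ℝ := (δ + 1) * deriv G δ - G δ

/-- `G` generates a disparity: it is strictly convex and continuous on `[-1, ∞)`, three times
differentiable on `(-1, ∞)`, and `G 0 = 0`. The last field says that the residual adjustment function
can be standardised, by an affine change, to `A 0 = 0` and `A' 0 = 1`. -/
structure IsDisparity (G : ℝ → ℝ) : Prop where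
  strictConvexOn : StrictConvexOn ℝ (Ici (-1)) G
  continuousOn : ContinuousOn G (Ici (-1))
  diff1 : ∀ δ > -1, DifferentiableAt ℝ G δ
  diff2 : ∀ δ > -1, DifferentiableAt ℝ (deriv G) δ
  diff3 : ∀ δ > -1, DifferentiableAt ℝ (deriv (deriv G)) δ
  map_zero : G 0 = 0
  deriv_raf_zero : deriv (raf G) 0 ≠ 0

/-- `G` and `G'` are bounded. -/
def BoundedGenerator (G : ℝ → ℝ) : Prop :=
  ∃ B : ℝ, (∀ δ ≥ -1, |G δ| ≤ B) ∧ ∀ δ > -1, |deriv G δ| ≤ B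

/-- `A(δ)`, `A'(δ)`, `A'(δ)(1 + δ)` and `A''(δ)(1 + δ)` are bounded. -/
def BoundedRAF (G : ℝ → ℝ) : Prop :=
  ∃ B : ℝ, ∀ δ > -1, |raf G δ| ≤ B ∧ |deriv (raf G) δ| ≤ B ∧
    |deriv (raf G) δ * (1 + δ)| ≤ B ∧ |deriv (deriv (raf G)) δ * (1 + δ)| ≤ B

/-- The generator of the squared Hellinger distance. -/
def hellinger (δ : ℝ) : ℝ := (√(δ + 1) - 1) ^ 2

/-- The disparity `ρ(q, θ) = ∑ G(q_k / p_k(θ) - 1) p_k(θ)`. -/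
def disparity (G : ℝ → ℝ) (p : ℝ → ℕ → ℝ) (q : ℕ → ℝ) (θ : ℝ) : ℝ :=
  ∑' k, G (q k / p θ k - 1) * p θ k

/-- `θ` minimises `ρ(q, ·)` over `Θ`. -/
def IsArgmin (G : ℝ → ℝ) (p : ℝ → ℕ → ℝ) (Θ : Set ℝ) (q : ℕ → ℝ) (θ : ℝ) : Prop :=
  θ ∈ Θ ∧ IsMinOn (disparity G p q) Θ θ

/-- `T` is a disparity functional: `T q` is a (that is, any) minimiser of `ρ(q, ·)` over `Θ` for every
probability distribution `q` for which a minimiser exists. -/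
def IsDisparityFunctional (G : ℝ → ℝ) (p : ℝ → ℕ → ℝ) (Θ : Set ℝ) (T : (ℕ → ℝ) → ℝ) : Prop :=
  ∀ q, IsProb q → (∃ θ, IsArgmin G p Θ q θ) → IsArgmin G p Θ q (T q)

/-- The class of the `q` with `inf_{θ ∈ Θ \ C} ρ(q, θ) > ρ(q, θ')` for some `θ' ∈ C`
(an infimum over the empty set is `+∞`). -/
def GammaTilde (G : ℝ → ℝ) (p : ℝ → ℕ → ℝ) (Θ C : Set ℝ) : Set (ℕ → ℝ) :=
  {q | IsProb q ∧ ∃ θ' ∈ C, (disparity G p q θ' : EReal) < ⨅ θ ∈ Θ \ C, (disparity G p q θ : EReal)}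

/-- The `q` in the class above for which the minimiser is unique. -/
def GammaHat (G : ℝ → ℝ) (p : ℝ → ℕ → ℝ) (Θ C : Set ℝ) : Set (ℕ → ℝ) :=
  {q | q ∈ GammaTilde G p Θ C ∧ ∃! θ, IsArgmin G p Θ q θ}

/-! ### Controlled branching processes

`X n j` (`j = 0, 1, …`) is the number of offspring of the `(j + 1)`-st progenitor of generation `n`. -/

variable {Ω : Type*}

/-- The generation sizes: `Z 0 = N` and `Z (n + 1)` is the sum of the first `φ n (Z n)` of the `X n j`. -/
def Z (N : ℕ) (X φ : ℕ → ℕ → Ω → ℕ) : ℕ → Ω → ℕ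
  | 0, _ => N
  | n + 1, ω => ∑ j ∈ Finset.range (φ n (Z N X φ n ω) ω), X n j ω

/-- The number of progenitors of generation `l` with exactly `k` offspring. -/
def offspringCount (N : ℕ) (X φ : ℕ → ℕ → Ω → ℕ) (l k : ℕ) (ω : Ω) : ℕ :=
  ((Finset.range (φ l (Z N X φ l ω) ω)).filter fun j => X l j ω = k).card

/-- The total number of progenitors of the generations `0, …, n - 1` (this is `Δ_{n-1}`). -/
def totalProgenitors (N : ℕ) (X φ : ℕ → ℕ → Ω → ℕ) (n : ℕ) (ω : Ω) : ℕ :=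
  ∑ l ∈ Finset.range n, φ l (Z N X φ l ω) ω

/-- The maximum likelihood estimator of the offspring law based on the entire family tree up to
generation `n`. -/
def mle (N : ℕ) (X φ : ℕ → ℕ → Ω → ℕ) (n : ℕ) (ω : Ω) (k : ℕ) : ℝ :=
  ((∑ l ∈ Finset.range n, offspringCount N X φ l k ω : ℕ) : ℝ) / (totalProgenitors N X φ n ω : ℝ)

/-- The event `{Z_n → ∞}`. -/
def survival (N : ℕ) (X φ : ℕ → ℕ → Ω → ℕ) : Set Ω :=
  {ω | Tendsto (fun n => Z N X φ n ω) atTop atTop}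

/-- The σ-algebra generated by the sample: the offspring counts of the generations `0, …, n - 1`. -/
@[reducible] def sampleSigma (N : ℕ) (X φ : ℕ → ℕ → Ω → ℕ) (n : ℕ) : MeasurableSpace Ω :=
  ⨆ l ∈ Finset.range n, ⨆ k, MeasurableSpace.comap (offspringCount N X φ l k) ⊤

variable [MeasurableSpace Ω]

/-- `X`, `φ` are the offspring and control variables of a controlled branching process with offspring
law `q` of finite variance: the `X n j` are i.i.d. with law `q`, the processes `(φ n k)_k`,
`n = 0, 1, …`, are independent with the same one-dimensional distributions, of finite variance,
and the two families are independent of each other. -/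
structure IsCBP (P : Measure Ω) (q : ℕ → ℝ) (X φ : ℕ → ℕ → Ω → ℕ) : Prop where
  measurable_offspring : ∀ n j, Measurable (X n j)
  measurable_control : ∀ n k, Measurable (φ n k)
  offspring_law : ∀ n j k, P.real {ω | X n j ω = k} = q k
  offspring_indep : iIndepFun (fun (i : ℕ × ℕ) ω => X i.1 i.2 ω) P
  control_indep : iIndepFun (fun (n : ℕ) ω (k : ℕ) => φ n k ω) P
  control_law : ∀ n k, IdentDistrib (φ n k) (φ 0 k) P P
  indep : IndepFun (fun ω (i : ℕ × ℕ) => X i.1 i.2 ω) (fun ω (i : ℕ × ℕ) => φ i.1 i.2 ω) P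
  offspring_variance : Summable fun k : ℕ => (k : ℝ) ^ 2 * q k
  control_variance : ∀ k, MemLp (fun ω => (φ 0 k ω : ℝ)) 2 P

/-- The supercritical growth conditions on a controlled branching process with offspring law `q`,
with `m` the offspring mean; `τ` is the limit of `E[φ_0(k)] / k` and `W` that of `Z_n / (τ m) ^ n`. -/
def Supercritical (P : Measure Ω) (q : ℕ → ℝ) (N : ℕ) (X φ : ℕ → ℕ → Ω → ℕ) : Prop :=
  ∃ (τ m : ℝ) (W : Ω → ℝ),
    m = ∑' k : ℕ, (k : ℝ) * q k ∧
    Tendsto (fun k : ℕ => (∫ ω, (φ 0 k ω : ℝ) ∂P) / k) atTop (𝓝 τ) ∧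
    (∃ B : ℝ, ∀ k : ℕ, 1 ≤ k → variance (fun ω => (φ 0 k ω : ℝ)) P / k ≤ B) ∧
    1 < τ * m ∧
    0 < P (survival N X φ) ∧
    (∀ᵐ ω ∂P, Tendsto (fun n => (Z N X φ n ω : ℝ) / (τ * m) ^ n) atTop (𝓝 (W ω))) ∧
    0 < P {ω | 0 < W ω} ∧
    {ω | 0 < W ω} =ᵐ[P] survival N X φ

/-- With respect to `P[· | Z_n → ∞]`, every sequence of estimators `ψ n` (`Θ`-valued functions of the
sample up to generation `n`) that converges to `θ₀` in probability satisfies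
`∑ |p''_k(ψ n) - p''_k(θ₀)| → 0` and `∑ |u(ψ n, k)² p_k(ψ n) - u(θ₀, k)² p_k(θ₀)| → 0`
in probability. -/
def EstimatorContinuity (P : Measure Ω) (N : ℕ) (X φ : ℕ → ℕ → Ω → ℕ)
    (p : ℝ → ℕ → ℝ) (Θ : Set ℝ) (θ₀ : ℝ) : Prop :=
  ∀ ψ : ℕ → Ω → ℝ, (∀ n, Measurable[sampleSigma N X φ n] (ψ n)) → (∀ n ω, ψ n ω ∈ Θ) →
    TendstoInMeasure (P[|survival N X φ]) ψ atTop (fun _ => θ₀) →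
    TendstoInMeasure (P[|survival N X φ])
      (fun n ω => ∑' k, |dθ (dθ p) (ψ n ω) k - dθ (dθ p) θ₀ k|) atTop (fun _ => (0 : ℝ)) ∧
    TendstoInMeasure (P[|survival N X φ])
      (fun n ω => ∑' k, |score p (ψ n ω) k ^ 2 * p (ψ n ω) k - score p θ₀ k ^ 2 * p θ₀ k|)
      atTop (fun _ => (0 : ℝ))

/-- With respect to `P[· | Z_n → ∞]`, `Δ_{n-1}^{1/2} (T(p̂_n) - θ₀)` converges in distribution to
the normal law with mean `0` and variance `I(θ₀)⁻¹`. -/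
def EfficientLimit (P : Measure Ω) (N : ℕ) (X φ : ℕ → ℕ → Ω → ℕ)
    (p : ℝ → ℕ → ℝ) (θ₀ : ℝ) (T : (ℕ → ℝ) → ℝ) : Prop :=
  ∃ _ : IsProbabilityMeasure (P[|survival N X φ]),
  TendstoInDistribution
    (fun n ω => √(totalProgenitors N X φ n ω : ℝ) * (T (mle N X φ n ω) - θ₀)) atTop
    (id : ℝ → ℝ) (fun _ => P[|survival N X φ])
    (gaussianReal 0 (fisherInfo p θ₀)⁻¹.toNNReal)

end CBP

end

/-! The estimator is a functional `T` of the empirical offspring law, so the argument has a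
deterministic half, about `T` near `p θ₀`, and a probabilistic half, about the empirical law.

Deterministic half. Let `q → p θ₀` coordinatewise through finitely supported laws. By Scheffé's
lemma `ρ(q, ·)` converges uniformly on `Θ`, and `θ₀` is a well separated minimiser of the limit, so
`T q → θ₀`. Now expand the estimating equation about `θ₀`. Its value at `θ₀` is `A'(0) ∑ q_k u_k` up
to a multiple of `∑ |u_k| min(|q_k - p_k|, (q_k - p_k)² / p_k)`, and its slope tends to `-A'(0)
I(θ₀)`. The factor `A'(0)` cancels, which is why every disparity inherits the influence function `u
/ I(θ₀)` of maximum likelihood. The outcome is `ApproxLinear`, proved in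
`approxLinear_disparityFunctional` for bounded generators and in `approxLinear_hellinger` for the
Hellinger distance. The latter expands in `ℓ²`, using `⟨s, s'⟩ = 0` and `⟨s, s''⟩ = -‖s'‖² = -I/4`.

Remainder. The centred number of progenitors with `k` offspring has first absolute moment and second
moment both of order `Δ p_k`. Hence `√Δ` times the remainder has mean of order `∑ |u_k| min(x p_k,
1/x)` with `x` of order `√Δ`. This vanishes by domination by `|s'_k|` in (i). In (ii) it vanishes
because `s ≥ 0` forces `s'` to be small where `s` is small, and because the offspring variance is
finite (`TwiceL2Diff.negligibleRemainder`).

Central limit theorem. The linear part `√Δ ∑ p̂_k u_k` is `normSum`, a sum over all progenitors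
divided by the root of their number. Generations grow geometrically with ratio `ρ = s²`, so the last
one keeps a positive share of the total. Given the past it is a sum of i.i.d. terms, and the
characteristic function on survival satisfies `g_{n+1}(t) ≈ exp(-t² (1 - s⁻²) / 2) g_n(t / s)`. The
Gaussian solves this recursion exactly, and iterating drives `t` to `0`, where tightness decides
(`tendsto_zero_of_contraction`). Survival does not belong to the past of any generation; Lévy's
upward theorem replaces its indicator by a conditional probability. Slutsky's theorem then combines
the linear part and the remainder. -/

namespace CBP

/-! ### Finitely supported distributions near a fixed one -/

/-- The finitely supported probability distributions whose support is contained in that of `p₀`. -/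
def finiteLaws (p₀ : ℕ → ℝ) : Set (ℕ → ℝ) :=
  {q | IsProb q ∧ q.support.Finite ∧ ∀ k, p₀ k = 0 → q k = 0}

lemma eventually_finiteLaws (p₀ : ℕ → ℝ) : ∀ᶠ q in 𝓝[finiteLaws p₀] p₀, q ∈ finiteLaws p₀ :=
  eventually_mem_nhdsWithin

lemma tendsto_apply_finiteLaws (p₀ : ℕ → ℝ) (k : ℕ) :
    Tendsto (fun q : ℕ → ℝ => q k) (𝓝[finiteLaws p₀] p₀) (𝓝 (p₀ k)) :=
  ((continuous_apply k).tendsto p₀).mono_left nhdsWithin_le_nhds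

lemma IsProb.summable_abs_sub {p q : ℕ → ℝ} (hp : IsProb p) (hq : IsProb q) :
    Summable fun k => |q k - p k| :=
  (hq.2.summable.sub hp.2.summable).abs

/-- Scheffé's lemma. -/
lemma tendsto_tsum_abs_sub {p₀ : ℕ → ℝ} (h₀ : IsProb p₀) :
    Tendsto (fun q : ℕ → ℝ => ∑' k, |q k - p₀ k|) (𝓝[finiteLaws p₀] p₀) (𝓝 0) := by
  -- Only the deficit `(p₀ - q)⁺` is dominated, by `p₀`. Since both total masses are `1`, the `ℓ¹`
  -- distance is twice the total deficit.
  have h1 : Tendsto (fun q : ℕ → ℝ => ∑' k, max (p₀ k - q k) 0) (𝓝[finiteLaws p₀] p₀)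
      (𝓝 (∑' _ : ℕ, 0)) := by
    refine tendsto_tsum_of_dominated_convergence h₀.2.summable (fun k => ?_) ?_
    · have := (tendsto_const_nhds (x := p₀ k)).sub (tendsto_apply_finiteLaws p₀ k)
      simpa using this.max (tendsto_const_nhds (x := (0 : ℝ)))
    · filter_upwards [eventually_finiteLaws p₀] with q hq k
      rw [Real.norm_of_nonneg (le_max_right _ _)]
      exact max_le (by linarith [hq.1.1 k]) (h₀.1 k)
  have h2 := h1.const_mul 2
  rw [tsum_zero, mul_zero] at h2
  refine h2.congr' ?_
  filter_upwards [eventually_finiteLaws p₀] with q hq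
  have hs : HasSum (fun k => q k - p₀ k) 0 := by simpa using hq.1.2.sub h₀.2
  have hm : Summable fun k => max (p₀ k - q k) 0 :=
    h₀.2.summable.of_nonneg_of_le (fun _ => le_max_right _ _)
      fun k => max_le (by linarith [hq.1.1 k]) (h₀.1 k)
  have := (hm.hasSum.mul_left 2).add hs
  rw [add_zero] at this
  rw [← this.tsum_eq]
  refine tsum_congr fun k => ?_
  rcases le_total (p₀ k) (q k) with h | h
  · rw [max_eq_right (by linarith), abs_of_nonneg (by linarith)]; ring
  · rw [max_eq_left (by linarith), abs_of_nonpos (by linarith)]; ring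

/-- Truncating `p₀` to the first `n` indices and renormalising approximates it. Without a nontrivial
filter, continuity could not be passed from `ρ(q, ·)` to the uniform limit `ρ(p₀, ·)`. -/
lemma neBot_finiteLaws {p₀ : ℕ → ℝ} (h₀ : IsProb p₀) : (𝓝[finiteLaws p₀] p₀).NeBot := by
  rw [← mem_closure_iff_nhdsWithin_neBot]
  have hs := h₀.2.tendsto_sum_nat
  refine mem_closure_of_tendsto (f := fun (n : ℕ) (k : ℕ) =>
    if k < n then p₀ k / ∑ i ∈ Finset.range n, p₀ i else 0) (b := atTop) ?_ ?_
  · refine tendsto_pi_nhds.2 fun k => ?_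
    have := (tendsto_const_nhds (x := p₀ k)).div hs one_ne_zero
    rw [div_one] at this
    refine this.congr' ?_
    filter_upwards [eventually_gt_atTop k] with n hn
    simp [hn]
  · filter_upwards [hs.eventually (lt_mem_nhds (zero_lt_one))] with n hn
    refine ⟨⟨fun k => ?_, ?_⟩, ?_, fun k hk => by simp [hk]⟩
    · beta_reduce
      split_ifs
      · exact div_nonneg (h₀.1 k) hn.le
      · exact le_rfl
    · have h1 : HasSum (fun k => if k < n then p₀ k / ∑ i ∈ Finset.range n, p₀ i else 0)
          (∑ k ∈ Finset.range n, if k < n then p₀ k / ∑ i ∈ Finset.range n, p₀ i else 0) :=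
        hasSum_sum_of_ne_finset_zero fun k hk => by
          simp only [Finset.mem_range] at hk; simp [hk]
      convert h1 using 1
      rw [Finset.sum_congr rfl fun k hk => if_pos (Finset.mem_range.1 hk), ← Finset.sum_div,
        div_self hn.ne']
    · refine (Finset.finite_toSet (Finset.range n)).subset fun k hk => ?_
      by_contra h
      simp only [Finset.coe_range, mem_Iio] at h
      simp [h] at hk

/-! ### Consistency of disparity functionals -/

/-- Off the support of `q` every residual equals `-1`. Splitting off the constant `G (-1)`, which
integrates to itself against `p θ`, leaves a finite sum, so neither convergence nor differentiation
under the sum is an issue for finitely supported `q`. -/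
lemma hasSum_disparity {G : ℝ → ℝ} {p : ℝ → ℕ → ℝ} {q : ℕ → ℝ} {θ : ℝ} (hp : IsProb (p θ))
    (F : Finset ℕ) (hF : ∀ k ∉ F, q k = 0) :
    HasSum (fun k => G (q k / p θ k - 1) * p θ k)
      (∑ k ∈ F, (G (q k / p θ k - 1) - G (-1)) * p θ k + G (-1)) := by
  have h1 : HasSum (fun k => (G (q k / p θ k - 1) - G (-1)) * p θ k)
      (∑ k ∈ F, (G (q k / p θ k - 1) - G (-1)) * p θ k) :=
    hasSum_sum_of_ne_finset_zero fun k hk => by simp [hF k hk]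
  have h2 := h1.add (hp.2.mul_left (G (-1)))
  rw [mul_one] at h2
  exact h2.congr_fun fun k => by ring

lemma continuousOn_disparity {G : ℝ → ℝ} (hG : ContinuousOn G (Ici (-1))) {p : ℝ → ℕ → ℝ}
    {Θ C : Set ℝ} (hp : IsFamily p Θ) (hCΘ : C ⊆ Θ)
    (hcont : ∀ k, ContinuousOn (fun θ => p θ k) C) {θ₀ : ℝ} (hθ₀ : θ₀ ∈ Θ) {q : ℕ → ℝ}
    (hq : q ∈ finiteLaws (p θ₀)) : ContinuousOn (disparity G p q) C := by
  have heq : ∀ θ ∈ C, disparity G p q θ =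
      ∑ k ∈ hq.2.1.toFinset, (G (q k / p θ k - 1) - G (-1)) * p θ k + G (-1) := fun θ hθ =>
    (hasSum_disparity (hp.isProb θ (hCΘ hθ)) _ fun k hk => by simpa using hk).tsum_eq
  refine ContinuousOn.congr ?_ heq
  refine (continuousOn_finsetSum _ fun k hk => ?_).add continuousOn_const
  have hpk : ∀ θ ∈ C, p θ k ≠ 0 := fun θ hθ h0 =>
    (by simpa using hk : q k ≠ 0) (hq.2.2 k (hp.common_support θ (hCΘ hθ) θ₀ hθ₀ k h0))
  refine ((hG.comp ((continuousOn_const.div (hcont k) hpk).sub continuousOn_const)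
    fun θ hθ => ?_).sub continuousOn_const).mul (hcont k)
  have : 0 ≤ q k / p θ k := div_nonneg (hq.1.1 k) ((hp.isProb θ (hCΘ hθ)).1 k)
  change -1 ≤ q k / p θ k - 1
  linarith

lemma disparity_self {G : ℝ → ℝ} (hG0 : G 0 = 0) (p : ℝ → ℕ → ℝ) (θ : ℝ) :
    disparity G p (p θ) θ = 0 := by
  unfold disparity
  refine (tsum_congr fun k => ?_).trans tsum_zero
  rcases eq_or_ne (p θ k) 0 with h | h
  · simp [h]
  · simp [div_self h, hG0]

/-- A disparity functional is consistent: if `ρ(q, ·)` is uniformly close to `ρ(p θ₀, ·)` for `q`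
close to `p θ₀`, then `ρ(q, ·)` has a minimiser, and the minimisers are close to `θ₀`. -/
theorem disparityFunctional_consistent {G : ℝ → ℝ} (hG : ContinuousOn G (Ici (-1)))
    (hG0 : G 0 = 0) {p : ℝ → ℕ → ℝ} {Θ C : Set ℝ} (hp : IsFamily p Θ) (hC : IsCompact C)
    (hCΘ : C ⊆ Θ) (hcont : ∀ k, ContinuousOn (fun θ => p θ k) C) {θ₀ : ℝ} (hθ₀ : θ₀ ∈ Θ)
    (hunif : TendstoUniformlyOn (disparity G p) (disparity G p (p θ₀))
      (𝓝[finiteLaws (p θ₀)] (p θ₀)) Θ)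
    (hnonneg : ∀ θ ∈ Θ, 0 ≤ disparity G p (p θ₀) θ) (hΓ : p θ₀ ∈ GammaHat G p Θ C)
    {T : (ℕ → ℝ) → ℝ} (hT : IsDisparityFunctional G p Θ T) :
    Tendsto T (𝓝[finiteLaws (p θ₀)] (p θ₀)) (𝓝 θ₀) ∧
      ∀ᶠ q in 𝓝[finiteLaws (p θ₀)] (p θ₀), IsArgmin G p Θ q (T q) := by
  have h00 := disparity_self hG0 p θ₀
  have hmin₀ : IsArgmin G p Θ (p θ₀) θ₀ := ⟨hθ₀, fun θ hθ => by
    simpa [h00] using hnonneg θ hθ⟩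
  have hpos : ∀ θ ∈ Θ, θ ≠ θ₀ → 0 < disparity G p (p θ₀) θ := fun θ hθ hne =>
    lt_of_le_of_ne (hnonneg θ hθ) fun h0 => hne <| hΓ.2.unique
      ⟨hθ, fun θ' hθ' => by simpa [← h0] using hnonneg θ' hθ'⟩ hmin₀
  obtain ⟨⟨-, θ', hθ', hlt⟩, -⟩ := hΓ
  obtain ⟨c, hc1, hc2⟩ := EReal.lt_iff_exists_real_btwn.1 hlt
  have hc0 : 0 < c := lt_of_le_of_lt (hnonneg θ' (hCΘ hθ')) (by exact_mod_cast hc1)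
  have hout : ∀ θ ∈ Θ, θ ∉ C → c ≤ disparity G p (p θ₀) θ := fun θ hθ hθC => by
    exact_mod_cast hc2.le.trans (iInf₂_le (f := fun θ (_ : θ ∈ Θ \ C) =>
      (disparity G p (p θ₀) θ : EReal)) θ ⟨hθ, hθC⟩)
  have hθC : θ₀ ∈ C := by
    by_contra h
    linarith [hout θ₀ hθ₀ h, h00]
  have := neBot_finiteLaws (hp.isProb θ₀ hθ₀)
  -- The sum `ρ(p θ₀, ·)` is infinite; its continuity on `C` comes from being a uniform limit of the
  -- continuous finite sums.
  have hcontC : ContinuousOn (disparity G p (p θ₀)) C :=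
    (hunif.mono hCΘ).continuousOn <| Eventually.frequently <|
      (eventually_finiteLaws (p θ₀)).mono fun q hq => continuousOn_disparity hG hp hCΘ hcont hθ₀ hq
  have key : ∀ ε > 0, ∀ᶠ q in 𝓝[finiteLaws (p θ₀)] (p θ₀),
      IsArgmin G p Θ q (T q) ∧ dist (T q) θ₀ < ε := by
    intro ε hε
    -- The gap `d`: off `C` it is the constant `c` separating the infimum there, and on the compact
    -- part of `C` at distance at least `ε` it is the attained minimum, positive by uniqueness of
    -- the minimiser.
    obtain ⟨d, hd0, hd⟩ : ∃ d > 0, ∀ θ ∈ Θ, (θ ∉ C ∨ ε ≤ dist θ θ₀) →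
        d ≤ disparity G p (p θ₀) θ := by
      have hK : IsCompact (C ∩ {θ | ε ≤ dist θ θ₀}) :=
        hC.inter_right (isClosed_le continuous_const (by fun_prop))
      rcases (C ∩ {θ | ε ≤ dist θ θ₀}).eq_empty_or_nonempty with hE | hne
      · refine ⟨c, hc0, fun θ hθ h => hout θ hθ ?_⟩
        rcases h with h | h
        · exact h
        · exact fun hθC => (Set.eq_empty_iff_forall_notMem.1 hE θ) ⟨hθC, h⟩
      · obtain ⟨θ₁, hθ₁, hm⟩ := hK.exists_isMinOn hne (hcontC.mono inter_subset_left)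
        have h1 : θ₁ ≠ θ₀ := by
          rintro rfl
          have := hθ₁.2
          simp only [mem_ofPred_eq, dist_self] at this
          linarith
        refine ⟨min c (disparity G p (p θ₀) θ₁), lt_min hc0 (hpos θ₁ (hCΘ hθ₁.1) h1),
          fun θ hθ h => ?_⟩
        by_cases hθC : θ ∈ C
        · exact (min_le_right _ _).trans (hm ⟨hθC, h.resolve_left (not_not.2 hθC)⟩)
        · exact (min_le_left _ _).trans (hout θ hθ hθC)
    -- Within `d / 2` of the limit, `ρ(q, ·)` is below `d / 2` at `θ₀` and above `d / 2` at all far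
    -- points.
    filter_upwards [Metric.tendstoUniformlyOn_iff.1 hunif (d / 2) (by positivity),
      eventually_finiteLaws (p θ₀)] with q hq hqE
    have hqθ₀ : disparity G p q θ₀ < d / 2 := by
      have := (abs_lt.1 (Real.dist_eq _ _ ▸ hq θ₀ hθ₀)).1
      rw [h00] at this; linarith
    have hfar : ∀ θ ∈ Θ, (θ ∉ C ∨ ε ≤ dist θ θ₀) → d / 2 < disparity G p q θ := fun θ hθ h => by
      have := (abs_lt.1 (Real.dist_eq _ _ ▸ hq θ hθ)).2
      linarith [hd θ hθ h]
    -- A minimiser over the compact `C` is global, since values off `C` exceed the value at `θ₀`.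
    -- Existence matters because `T q` is unconstrained when there is no minimiser.
    obtain ⟨θ₂, hθ₂, hm⟩ := hC.exists_isMinOn ⟨θ₀, hθC⟩
      (continuousOn_disparity hG hp hCΘ hcont hθ₀ hqE)
    have hargmin : IsArgmin G p Θ q θ₂ := ⟨hCΘ hθ₂, fun θ hθ => by
      by_cases hθC' : θ ∈ C
      · exact hm hθC'
      · have h1 : disparity G p q θ₂ ≤ disparity G p q θ₀ := hm hθC
        have h2 := hfar θ hθ (Or.inl hθC')
        simp only [mem_ofPred_eq]
        linarith⟩
    have hTq := hT q hqE.1 ⟨θ₂, hargmin⟩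
    refine ⟨hTq, ?_⟩
    by_contra h
    have h1 : disparity G p q (T q) ≤ disparity G p q θ₀ := hTq.2 hθ₀
    linarith [hfar (T q) hTq.1 (Or.inr (not_lt.1 h))]
  exact ⟨Metric.tendsto_nhds.2 fun ε hε => (key ε hε).mono fun q h => h.2,
    (key 1 one_pos).mono fun q h => h.1⟩

/-! ### Approximate linearity -/

/-- The weighted distance which controls the nonlinear part of a disparity functional. -/
noncomputable def remainder (p₀ u q : ℕ → ℝ) : ℝ :=
  ∑' k, |u k| * min |q k - p₀ k| ((q k - p₀ k) ^ 2 / p₀ k)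

/-- At `p₀`, the functional `T` is approximately linear on the finitely supported distributions,
with influence function `u / v`. -/
def ApproxLinear (T : (ℕ → ℝ) → ℝ) (p₀ u : ℕ → ℝ) (v θ₀ : ℝ) : Prop :=
  ∃ c : ℝ, 0 ≤ c ∧ ∀ ε > 0, ∀ᶠ q in 𝓝[finiteLaws p₀] p₀,
    |T q - θ₀ - (∑' k, q k * u k) / v| ≤ ε * |∑' k, q k * u k| + c * remainder p₀ u q

lemma summable_remainder {p₀ u : ℕ → ℝ} (h₀ : IsProb p₀) (hu : Summable fun k => |u k| * p₀ k)
    {q : ℕ → ℝ} (hq : q ∈ finiteLaws p₀) :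
    Summable fun k => |u k| * min |q k - p₀ k| ((q k - p₀ k) ^ 2 / p₀ k) := by
  have h1 : Summable fun k => |u k| * q k :=
    summable_of_hasFiniteSupport (hq.2.1.subset fun k hk => by
      simp only [Function.mem_support] at hk ⊢
      exact right_ne_zero_of_mul hk)
  refine (h1.add hu).of_nonneg_of_le (fun k => mul_nonneg (abs_nonneg _)
    (le_min (abs_nonneg _) (div_nonneg (sq_nonneg _) (h₀.1 k)))) fun k => ?_
  rw [← mul_add]
  refine mul_le_mul_of_nonneg_left ((min_le_left _ _).trans ?_) (abs_nonneg _)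
  exact (abs_sub _ _).trans (by rw [abs_of_nonneg (hq.1.1 k), abs_of_nonneg (h₀.1 k)])

/-- Solving a perturbed linear equation. -/
lemma approx_solution {v : ℝ} (hv : 0 < v) {ε : ℝ} (hε : 0 < ε) :
    ∃ η > 0, ∀ d h x r : ℝ, |d - v| ≤ η → h * d = x + r →
      |h - x / v| ≤ ε * |x| + 2 / v * |r| := by
  -- The first bound keeps `d ≥ v / 2`; the second then gives `|1 / d - 1 / v| ≤ ε`.
  refine ⟨min (v / 2) (ε * v ^ 2 / 2), by positivity, fun d h x r hd he => ?_⟩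
  have h1 := hd.trans (min_le_left _ _)
  have h2 := hd.trans (min_le_right _ _)
  have hdpos : v / 2 ≤ d := by linarith [(abs_le.1 h1).1]
  have hd0 : 0 < d := by linarith
  have : h - x / v = x * ((v - d) / (d * v)) + r / d := by
    have : h = (x + r) / d := by rw [← he]; field_simp
    rw [this]; field_simp; ring
  rw [this]
  refine (abs_add_le _ _).trans (add_le_add ?_ ?_)
  · rw [abs_mul, mul_comm]
    refine mul_le_mul_of_nonneg_right ?_ (abs_nonneg _)
    rw [abs_div, abs_sub_comm, abs_of_pos (by positivity : 0 < d * v), div_le_iff₀ (by positivity)]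
    have : v / 2 * v ≤ d * v := by gcongr
    nlinarith
  · rw [abs_div, abs_of_pos hd0, div_le_iff₀ hd0]
    have : 1 ≤ 2 / v * d := by
      rw [div_mul_eq_mul_div, le_div_iff₀ hv]; linarith
    nlinarith [abs_nonneg r]

/-! ### Generators of disparities -/

/-- The derivative is controlled only on the open half-line; continuity carries the Lipschitz bound
to the endpoint `-1`, the residual of cells without observations. -/
lemma IsDisparity.abs_sub_le {G : ℝ → ℝ} (hG : IsDisparity G) {B : ℝ} (hB0 : 0 ≤ B)
    (hB : ∀ δ > -1, |deriv G δ| ≤ B) {x y : ℝ} (hx : -1 ≤ x) (hy : -1 ≤ y) :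
    |G x - G y| ≤ B * |x - y| := by
  have h1 : LipschitzOnWith ⟨B, hB0⟩ G (Ioi (-1)) :=
    (convex_Ioi (-1 : ℝ)).lipschitzOnWith_of_nnnorm_deriv_le (fun δ hδ => hG.diff1 δ hδ)
      fun δ hδ => hB δ hδ
  have h2 := LipschitzOnWith.closure (by rw [closure_Ioi]; exact hG.continuousOn) h1
  rw [closure_Ioi] at h2
  exact h2.dist_le_mul x hx y hy

/-- The tangent at `0` supports the convex function. Summed against `p θ`, where the residuals have
mean zero, this makes disparities nonnegative. -/
lemma IsDisparity.deriv_zero_mul_le {G : ℝ → ℝ} (hG : IsDisparity G) {δ : ℝ} (hδ : -1 ≤ δ) :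
    deriv G 0 * δ ≤ G δ := by
  have hc := hG.strictConvexOn.convexOn
  have hd := (hG.diff1 0 (by norm_num)).hasDerivAt
  have h0 : (0 : ℝ) ∈ Ici (-1 : ℝ) := by simp
  rcases lt_trichotomy δ 0 with h | h | h
  · have := hc.slope_le_of_hasDerivAt hδ h0 h hd
    rw [slope_def_field, hG.map_zero, div_le_iff₀ (by linarith)] at this
    linarith
  · simp [h, hG.map_zero]
  · have := hc.le_slope_of_hasDerivAt h0 hδ h hd
    rw [slope_def_field, hG.map_zero, le_div_iff₀ (by linarith)] at this
    linarith

/-- The two terms `G'` cancel, so `A'` involves only `G''`, and three derivatives of `G` give two of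
`A`. -/
lemma IsDisparity.hasDerivAt_raf {G : ℝ → ℝ} (hG : IsDisparity G) {δ : ℝ} (hδ : -1 < δ) :
    HasDerivAt (raf G) ((δ + 1) * deriv (deriv G) δ) δ := by
  have h := (((hasDerivAt_id δ).add_const (1 : ℝ)).mul (hG.diff2 δ hδ).hasDerivAt).sub
    (hG.diff1 δ hδ).hasDerivAt
  refine h.congr_deriv ?_
  simp

lemma IsDisparity.differentiableAt_raf {G : ℝ → ℝ} (hG : IsDisparity G) {δ : ℝ} (hδ : -1 < δ) :
    DifferentiableAt ℝ (raf G) δ :=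
  (hG.hasDerivAt_raf hδ).differentiableAt

lemma IsDisparity.differentiableAt_deriv_raf {G : ℝ → ℝ} (hG : IsDisparity G) {δ : ℝ}
    (hδ : -1 < δ) : DifferentiableAt ℝ (deriv (raf G)) δ := by
  have h : deriv (raf G) =ᶠ[𝓝 δ] fun x => (x + 1) * deriv (deriv G) x := by
    filter_upwards [Ioi_mem_nhds hδ] with x hx
    exact (hG.hasDerivAt_raf hx).deriv
  refine DifferentiableAt.congr_of_eventuallyEq ?_ h
  exact (differentiableAt_id.add_const 1).mul (hG.diff3 δ hδ)

/-- The linear bound follows from boundedness of `A'`. The quadratic one near `0` follows from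
boundedness of `A''(δ)(1 + δ)`, as `1 + δ ≥ 1/2` there. The minimum of the two is what `remainder`
can absorb. -/
lemma IsDisparity.raf_taylor {G : ℝ → ℝ} (hG : IsDisparity G) (hA : BoundedRAF G) :
    ∃ c : ℝ, 0 ≤ c ∧ ∀ δ > -1,
      |raf G δ - raf G 0 - deriv (raf G) 0 * δ| ≤ c * min |δ| (δ ^ 2) := by
  obtain ⟨B, hB⟩ := hA
  have hB0 : 0 ≤ B := (abs_nonneg _).trans (hB 0 (by norm_num)).1
  set h : ℝ → ℝ := fun x => raf G x - raf G 0 - deriv (raf G) 0 * x with hh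
  have hd : ∀ x > -1, HasDerivAt h (deriv (raf G) x - deriv (raf G) 0) x := fun x hx => by
    exact (((hG.differentiableAt_raf hx).hasDerivAt.sub_const (raf G 0)).sub
      ((hasDerivAt_id x).const_mul (deriv (raf G) 0))).congr_deriv (by simp)
  have hh0 : h 0 = 0 := by simp [hh]
  have hmem : (0 : ℝ) ∈ Ioi (-1 : ℝ) := mem_Ioi.2 (by norm_num)
  have h1 : ∀ δ > -1, |h δ| ≤ 2 * B * |δ| := fun δ hδ => by
    have := (convex_Ioi (-1 : ℝ)).norm_image_sub_le_of_norm_hasDerivWithin_le (x := 0) (y := δ)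
      (C := 2 * B) (fun x hx => (hd x hx).hasDerivWithinAt) (fun x hx => by
        refine (abs_sub _ _).trans ?_
        linarith [(hB x hx).2.1, (hB 0 (by norm_num)).2.1]) hmem hδ
    simpa [hh0] using this
  have h2 : ∀ x, |x| ≤ 1 / 2 → |deriv (raf G) x - deriv (raf G) 0| ≤ 2 * B * |x| := fun x hx => by
    have := (convex_Icc (-(1 / 2) : ℝ) (1 / 2)).norm_image_sub_le_of_norm_deriv_le
      (f := deriv (raf G)) (x := 0) (y := x) (C := 2 * B)
      (fun y hy => hG.differentiableAt_deriv_raf (by linarith [hy.1])) (fun y hy => by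
        have h3 := (hB y (by linarith [hy.1])).2.2.2
        rw [abs_mul, abs_of_pos (by linarith [hy.1] : 0 < 1 + y)] at h3
        rw [Real.norm_eq_abs]
        nlinarith [abs_nonneg (deriv (deriv (raf G)) y), hy.1]) (by constructor <;> norm_num)
      (abs_le.1 hx)
    simpa using this
  -- For `|δ| > 1/2` one has `|δ| ≤ 2 min(|δ|, δ²)`, which doubles the constant `2 * B` of the
  -- linear bound.
  refine ⟨4 * B, by positivity, fun δ hδ => ?_⟩
  change |h δ| ≤ _
  rcases le_or_gt |δ| (1 / 2) with hs | hs
  · have hmem' : (0 : ℝ) ∈ Icc (-|δ|) |δ| := mem_Icc.2 ⟨by linarith [abs_nonneg δ], abs_nonneg δ⟩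
    have h3 := (convex_Icc (-|δ|) |δ|).norm_image_sub_le_of_norm_hasDerivWithin_le
      (f := h) (x := 0) (y := δ) (C := 2 * B * |δ|)
      (fun x hx => (hd x (by linarith [hx.1])).hasDerivWithinAt) (fun x hx =>
        (h2 x ((abs_le.2 hx).trans hs)).trans
          (mul_le_mul_of_nonneg_left (abs_le.2 hx) (by positivity)))
      hmem' (abs_le.1 le_rfl)
    rw [hh0, sub_zero, sub_zero, Real.norm_eq_abs, Real.norm_eq_abs] at h3
    have h4 : |δ| * |δ| = δ ^ 2 := by rw [abs_mul_abs_self]; ring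
    have h5 : δ ^ 2 ≤ |δ| := by nlinarith [abs_nonneg δ]
    rw [min_eq_right h5]
    nlinarith [sq_nonneg δ]
  · have h4 : |δ| * |δ| = δ ^ 2 := by rw [abs_mul_abs_self]; ring
    have h5 : |δ| / 2 ≤ min |δ| (δ ^ 2) := le_min (by linarith [abs_nonneg δ]) (by nlinarith)
    nlinarith [h1 δ hδ]

/-! ### Disparities with bounded generators -/

lemma summable_disparity_of_bounded {G : ℝ → ℝ} {B : ℝ} (hB : ∀ δ ≥ -1, |G δ| ≤ B)
    {p : ℝ → ℕ → ℝ} {θ : ℝ} (hp : IsProb (p θ)) {q : ℕ → ℝ} (hq : ∀ k, 0 ≤ q k) :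
    Summable fun k => G (q k / p θ k - 1) * p θ k := by
  refine Summable.of_norm_bounded (hp.2.summable.mul_left B) fun k => ?_
  rw [norm_mul, Real.norm_of_nonneg (hp.1 k)]
  refine mul_le_mul_of_nonneg_right (hB _ ?_) (hp.1 k)
  have := div_nonneg (hq k) (hp.1 k)
  linarith

lemma abs_tsum_sub_tsum_le {f g h : ℕ → ℝ} (hf : Summable f) (hg : Summable g) (hh : Summable h)
    (hle : ∀ k, |f k - g k| ≤ h k) : |∑' k, f k - ∑' k, g k| ≤ ∑' k, h k := by
  have hs : Summable fun k => |f k - g k| := hh.of_nonneg_of_le (fun _ => abs_nonneg _) hle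
  have h1 : ‖∑' k, (f k - g k)‖ ≤ ∑' k, ‖f k - g k‖ := norm_tsum_le_tsum_norm hs
  rw [hf.tsum_sub hg, Real.norm_eq_abs] at h1
  exact h1.trans (Summable.tsum_le_tsum hle hs hh)

/-- The weight `r` cancels the denominator of the residual, so `ρ(·, θ)` is `B`-Lipschitz in `ℓ¹`
with a constant independent of `θ`. -/
lemma IsDisparity.abs_term_sub_le {G : ℝ → ℝ} (hG : IsDisparity G) {B : ℝ} (hB0 : 0 ≤ B)
    (hB : ∀ δ > -1, |deriv G δ| ≤ B) {a b r : ℝ} (ha : 0 ≤ a) (hb : 0 ≤ b) (hr : 0 ≤ r) :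
    |G (a / r - 1) * r - G (b / r - 1) * r| ≤ B * |a - b| := by
  rcases hr.eq_or_lt with rfl | hr
  · rw [mul_zero, mul_zero, sub_zero, abs_zero]
    exact mul_nonneg hB0 (abs_nonneg _)
  · rw [← sub_mul, abs_mul, abs_of_pos hr]
    have h1 := div_nonneg ha hr.le
    have h2 := div_nonneg hb hr.le
    refine (mul_le_mul_of_nonneg_right (hG.abs_sub_le hB0 hB (x := a / r - 1) (y := b / r - 1)
      (by linarith) (by linarith)) hr.le).trans_eq ?_
    rw [show a / r - 1 - (b / r - 1) = (a - b) / r by ring, abs_div, abs_of_pos hr]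
    field_simp

lemma tendstoUniformlyOn_disparity_of_bounded {G : ℝ → ℝ} (hG : IsDisparity G)
    (hb : BoundedGenerator G) {p : ℝ → ℕ → ℝ} {Θ : Set ℝ} (hp : IsFamily p Θ) {θ₀ : ℝ}
    (hθ₀ : θ₀ ∈ Θ) :
    TendstoUniformlyOn (disparity G p) (disparity G p (p θ₀))
      (𝓝[finiteLaws (p θ₀)] (p θ₀)) Θ := by
  obtain ⟨B, hB1, hB2⟩ := hb
  have hB0 : 0 ≤ B := (abs_nonneg _).trans (hB1 0 (by norm_num))
  have hp₀ := hp.isProb θ₀ hθ₀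
  have hbound : ∀ q ∈ finiteLaws (p θ₀), ∀ θ ∈ Θ,
      |disparity G p q θ - disparity G p (p θ₀) θ| ≤ B * ∑' k, |q k - p θ₀ k| := by
    intro q hq θ hθ
    have hpθ := hp.isProb θ hθ
    rw [← tsum_mul_left]
    exact abs_tsum_sub_tsum_le (summable_disparity_of_bounded hB1 hpθ hq.1.1)
      (summable_disparity_of_bounded hB1 hpθ hp₀.1) ((hp₀.summable_abs_sub hq.1).mul_left B)
      fun k => hG.abs_term_sub_le hB0 hB2 (hq.1.1 k) (hp₀.1 k) (hpθ.1 k)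
  have ht := (tendsto_tsum_abs_sub hp₀).const_mul B
  rw [mul_zero] at ht
  rw [Metric.tendstoUniformlyOn_iff]
  intro ε hε
  filter_upwards [ht.eventually_lt_const hε, eventually_finiteLaws (p θ₀)] with q hq hqE θ hθ
  rw [dist_comm, Real.dist_eq]
  exact (hbound q hqE θ hθ).trans_lt hq

lemma disparity_nonneg_of_bounded {G : ℝ → ℝ} (hG : IsDisparity G)
    (hb : BoundedGenerator G) {p : ℝ → ℕ → ℝ} {Θ : Set ℝ} (hp : IsFamily p Θ) {θ₀ : ℝ}
    (hθ₀ : θ₀ ∈ Θ) {θ : ℝ} (hθ : θ ∈ Θ) : 0 ≤ disparity G p (p θ₀) θ := by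
  obtain ⟨B, hB1, -⟩ := hb
  have hpθ := hp.isProb θ hθ
  have hp₀ := hp.isProb θ₀ hθ₀
  have hs := summable_disparity_of_bounded hB1 hpθ hp₀.1
  have h1 : HasSum (fun k => deriv G 0 * (p θ₀ k - p θ k)) 0 := by
    simpa using (hp₀.2.sub hpθ.2).mul_left (deriv G 0)
  refine hasSum_le (fun k => ?_) h1 hs.hasSum
  rcases eq_or_ne (p θ k) 0 with h | h
  · simp [h, hp.common_support θ hθ θ₀ hθ₀ k h]
  · have hpos : 0 < p θ k := lt_of_le_of_ne (hpθ.1 k) h.symm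
    have h2 := div_nonneg (hp₀.1 k) hpos.le
    have := mul_le_mul_of_nonneg_right
      (hG.deriv_zero_mul_le (δ := p θ₀ k / p θ k - 1) (by linarith)) hpos.le
    refine le_trans (le_of_eq ?_) this
    field_simp

/-! ### Calculus of parametric families -/

section Family
variable {p : ℝ → ℕ → ℝ} {Θ : Set ℝ}

lemma IsFamily.hasDerivAt (hp : IsFamily p Θ) {θ : ℝ} (hθ : θ ∈ interior Θ) (k : ℕ) :
    HasDerivAt (fun t => p t k) (dθ p θ k) θ :=
  (((hp.contDiffOn k).differentiableOn (by norm_num)).differentiableAt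
    (isOpen_interior.mem_nhds hθ)).hasDerivAt

lemma IsFamily.hasDerivAt_dθ (hp : IsFamily p Θ) {θ : ℝ} (hθ : θ ∈ interior Θ) (k : ℕ) :
    HasDerivAt (fun t => dθ p t k) (dθ (dθ p) θ k) θ :=
  ((((hp.contDiffOn k).deriv_of_isOpen isOpen_interior (m := 1)
    (by norm_num)).differentiableOn (by norm_num)).differentiableAt
    (isOpen_interior.mem_nhds hθ)).hasDerivAt

lemma IsFamily.continuousAt_dθ_dθ (hp : IsFamily p Θ) {θ : ℝ} (hθ : θ ∈ interior Θ) (k : ℕ) :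
    ContinuousAt (fun t => dθ (dθ p) t k) θ :=
  (((hp.contDiffOn k).deriv_of_isOpen isOpen_interior (m := 1)
    (by norm_num)).continuousOn_deriv_of_isOpen isOpen_interior le_rfl).continuousAt
    (isOpen_interior.mem_nhds hθ)

lemma IsFamily.pos (hp : IsFamily p Θ) {θ θ' : ℝ} (hθ : θ ∈ Θ) (hθ' : θ' ∈ Θ) {k : ℕ}
    (h : p θ k ≠ 0) : 0 < p θ' k :=
  lt_of_le_of_ne ((hp.isProb θ' hθ').1 k) fun h0 => h (hp.common_support θ' hθ' θ hθ k h0.symm)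

lemma IsFamily.dθ_eq_zero (hp : IsFamily p Θ) {θ : ℝ} (hθ : θ ∈ interior Θ) {k : ℕ}
    (h : p θ k = 0) : dθ p θ k = 0 := by
  have : (fun t => p t k) =ᶠ[𝓝 θ] fun _ => 0 := by
    filter_upwards [isOpen_interior.mem_nhds hθ] with t ht
    exact hp.common_support θ (interior_subset hθ) t (interior_subset ht) k h
  unfold dθ
  rw [this.deriv_eq, deriv_const]

lemma IsFamily.dθ_dθ_eq_zero (hp : IsFamily p Θ) {θ : ℝ} (hθ : θ ∈ interior Θ) {k : ℕ}
    (h : p θ k = 0) : dθ (dθ p) θ k = 0 := by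
  have : (fun t => dθ p t k) =ᶠ[𝓝 θ] fun _ => 0 := by
    filter_upwards [isOpen_interior.mem_nhds hθ] with t ht
    exact hp.dθ_eq_zero ht
      (hp.common_support θ (interior_subset hθ) t (interior_subset ht) k h)
  change deriv (fun t => dθ p t k) θ = 0
  rw [this.deriv_eq, deriv_const]

lemma IsFamily.score_mul (hp : IsFamily p Θ) {θ : ℝ} (hθ : θ ∈ interior Θ) (k : ℕ) :
    score p θ k * p θ k = dθ p θ k := by
  rcases eq_or_ne (p θ k) 0 with h | h
  · rw [h, hp.dθ_eq_zero hθ h, mul_zero]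
  · exact div_mul_cancel₀ _ h

/-- The identity `∑ p_k(t) = 1` is differentiated twice under the sum, which `J` and `L` permit. -/
lemma IsFamily.tsum_dθ_eq_zero (hp : IsFamily p Θ) (hd : LocallyDominated p Θ) {θ : ℝ}
    (hθ : θ ∈ interior Θ) : HasSum (dθ p θ) 0 ∧ HasSum (dθ (dθ p) θ) 0 := by
  obtain ⟨ε, hε, hsub, J, L, M, hJ, hL, -, hdom⟩ := hd θ hθ
  have hint : ∀ t ∈ Ioo (θ - ε) (θ + ε), t ∈ interior Θ := fun t ht =>
    interior_mono hsub (by rwa [interior_Ioo])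
  have hmem : θ ∈ Ioo (θ - ε) (θ + ε) := ⟨by linarith, by linarith⟩
  have hsum1 : ∀ t ∈ Ioo (θ - ε) (θ + ε), Summable (dθ p t) := fun t ht =>
    Summable.of_norm_bounded hJ fun k => (hdom t ht k).1.le
  have h1 : ∀ t ∈ Ioo (θ - ε) (θ + ε), ∑' k, dθ p t k = 0 := fun t ht => by
    have h := hasDerivAt_tsum_of_isPreconnected (g := fun k t => p t k) (g' := fun k t => dθ p t k)
      hJ isOpen_Ioo isPreconnected_Ioo (fun k t ht => hp.hasDerivAt (hint t ht) k)
      (fun k t ht => (hdom t ht k).1.le) hmem (hp.isProb θ (interior_subset hθ)).2.summable ht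
    have hc : (fun t => ∑' k, p t k) =ᶠ[𝓝 t] fun _ => 1 := by
      filter_upwards [Ioo_mem_nhds ht.1 ht.2] with x hx
      exact (hp.isProb x (hsub hx)).2.tsum_eq
    rw [← h.deriv, hc.deriv_eq, deriv_const]
  have h2 : ∑' k, dθ (dθ p) θ k = 0 := by
    have h := hasDerivAt_tsum_of_isPreconnected (g := fun k t => dθ p t k)
      (g' := fun k t => dθ (dθ p) t k)
      hL isOpen_Ioo isPreconnected_Ioo (fun k t ht => hp.hasDerivAt_dθ (hint t ht) k)
      (fun k t ht => (hdom t ht k).2.1.le) hmem (hsum1 θ hmem) hmem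
    have hc : (fun t => ∑' k, dθ p t k) =ᶠ[𝓝 θ] fun _ => 0 := by
      filter_upwards [Ioo_mem_nhds hmem.1 hmem.2] with x hx
      exact h1 x hx
    rw [← h.deriv, hc.deriv_eq, deriv_const]
  exact ⟨h1 θ hmem ▸ (hsum1 θ hmem).hasSum,
    h2 ▸ (Summable.of_norm_bounded hL fun k => (hdom θ hmem k).2.1.le).hasSum⟩

end Family

/-! ### The estimating equation of a minimum disparity estimator -/

/-- The terms of the estimating function of the disparity with generator `G`. -/
noncomputable def estTerm (G : ℝ → ℝ) (p : ℝ → ℕ → ℝ) (q : ℕ → ℝ) (θ : ℝ) (k : ℕ) : ℝ :=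
  if q k = 0 then 0 else (raf G (q k / p θ k - 1) + G (-1)) * dθ p θ k

/-- The derivatives of the terms of the estimating function. -/
noncomputable def estTermDeriv (G : ℝ → ℝ) (p : ℝ → ℕ → ℝ) (q : ℕ → ℝ) (θ : ℝ) (k : ℕ) : ℝ :=
  if q k = 0 then 0 else (raf G (q k / p θ k - 1) + G (-1)) * dθ (dθ p) θ k -
    deriv (raf G) (q k / p θ k - 1) * (q k / p θ k) * (score p θ k ^ 2 * p θ k)

section
variable {G : ℝ → ℝ} {p : ℝ → ℕ → ℝ} {Θ : Set ℝ} {θ₀ : ℝ}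

/-- With `δ = q / p - 1`, the derivative of `(G(δ) - G(-1)) p` is `-(A(δ) + G(-1)) p'`. The extra
constant and the cutoff off the support of `q` in `estTerm` both stem from the finite-sum form of
the disparity. -/
lemma hasDerivAt_disparity (hG : IsDisparity G) (hp : IsFamily p Θ) (hθ₀ : θ₀ ∈ Θ) {q : ℕ → ℝ}
    (hq : q ∈ finiteLaws (p θ₀)) {θ : ℝ} (hθ : θ ∈ interior Θ) :
    HasDerivAt (disparity G p q) (-∑' k, estTerm G p q θ k) θ := by
  have hF : ∀ k ∉ hq.2.1.toFinset, q k = 0 := fun k hk => by simpa using hk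
  have heq : disparity G p q =ᶠ[𝓝 θ] fun t =>
      ∑ k ∈ hq.2.1.toFinset, (G (q k / p t k - 1) - G (-1)) * p t k + G (-1) := by
    filter_upwards [isOpen_interior.mem_nhds hθ] with t ht
    exact (hasSum_disparity (hp.isProb t (interior_subset ht)) _ hF).tsum_eq
  refine HasDerivAt.congr_of_eventuallyEq ?_ heq
  have hz : ∀ k ∉ hq.2.1.toFinset, estTerm G p q θ k = 0 := fun k hk => if_pos (hF k hk)
  rw [tsum_eq_sum hz, ← Finset.sum_neg_distrib]
  refine (HasDerivAt.fun_sum fun k hk => ?_).add_const _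
  have hqk : q k ≠ 0 := by simpa using hk
  have hqpos : 0 < q k := lt_of_le_of_ne (hq.1.1 k) hqk.symm
  have hpos : 0 < p θ k := hp.pos hθ₀ (interior_subset hθ) fun h0 => hqk (hq.2.2 k h0)
  have hδ : -1 < q k / p θ k - 1 := by have := div_pos hqpos hpos; linarith
  have hd := hp.hasDerivAt hθ k
  have h1 : HasDerivAt (fun t => q k / p t k - 1) (-(q k * dθ p θ k) / p θ k ^ 2) θ :=
    (((hasDerivAt_const θ (q k)).div hd hpos.ne').sub_const 1).congr_deriv (by simp)
  have h2 := (((hG.diff1 _ hδ).hasDerivAt.comp θ h1).sub_const (G (-1))).mul hd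
  refine h2.congr_deriv ?_
  simp only [estTerm, if_neg hqk, raf, Function.comp_apply]
  field_simp
  ring

lemma hasDerivAt_tsum_estTerm (hG : IsDisparity G) (hp : IsFamily p Θ) (hθ₀ : θ₀ ∈ Θ) {q : ℕ → ℝ}
    (hq : q ∈ finiteLaws (p θ₀)) {θ : ℝ} (hθ : θ ∈ interior Θ) :
    HasDerivAt (fun t => ∑' k, estTerm G p q t k) (∑' k, estTermDeriv G p q θ k) θ := by
  have hF : ∀ k ∉ hq.2.1.toFinset, q k = 0 := fun k hk => by simpa using hk
  have heq : (fun t => ∑' k, estTerm G p q t k) = fun t =>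
      ∑ k ∈ hq.2.1.toFinset, estTerm G p q t k := funext fun t =>
    tsum_eq_sum (s := hq.2.1.toFinset) fun k hk => if_pos (hF k hk)
  have hz : ∀ k ∉ hq.2.1.toFinset, estTermDeriv G p q θ k = 0 := fun k hk => if_pos (hF k hk)
  rw [heq, tsum_eq_sum hz]
  refine HasDerivAt.fun_sum fun k hk => ?_
  have hqk : q k ≠ 0 := by simpa using hk
  have hqpos : 0 < q k := lt_of_le_of_ne (hq.1.1 k) hqk.symm
  have hpos : 0 < p θ k := hp.pos hθ₀ (interior_subset hθ) fun h0 => hqk (hq.2.2 k h0)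
  have hδ : -1 < q k / p θ k - 1 := by have := div_pos hqpos hpos; linarith
  have h1 : HasDerivAt (fun t => q k / p t k - 1) (-(q k * dθ p θ k) / p θ k ^ 2) θ :=
    (((hasDerivAt_const θ (q k)).div (hp.hasDerivAt hθ k) hpos.ne').sub_const 1).congr_deriv
      (by simp)
  have h2 := (((hG.differentiableAt_raf hδ).hasDerivAt.comp θ h1).add_const (G (-1))).mul
    (hp.hasDerivAt_dθ hθ k)
  simp only [estTerm, estTermDeriv, if_neg hqk, score]
  refine h2.congr_deriv ?_
  simp only [Function.comp_apply]
  field_simp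
  ring

/-- The limit is taken jointly in `(q, θ)` because the slope is needed at an intermediate point that
depends on `q`. Boundedness of `A` and of `A'(δ)(1 + δ)` gives the dominating series `L` and `M`. In
the limit the `p''` terms sum to zero and only the information survives. -/
lemma tendsto_tsum_estTermDeriv (hG : IsDisparity G) (hp : IsFamily p Θ)
    (hθ₀ : θ₀ ∈ interior Θ) (hd : LocallyDominated p Θ) (hA : BoundedRAF G) :
    Tendsto (fun z : (ℕ → ℝ) × ℝ => ∑' k, estTermDeriv G p z.1 z.2 k)
      (𝓝[finiteLaws (p θ₀)] (p θ₀) ×ˢ 𝓝 θ₀) (𝓝 (-(deriv (raf G) 0 * fisherInfo p θ₀))) := by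
  have hsum := (hp.tsum_dθ_eq_zero hd hθ₀).2
  obtain ⟨ε, hε, hsub, J, L, M, -, hL, hM, hdom⟩ := hd θ₀ hθ₀
  obtain ⟨B, hB⟩ := hA
  have hB0 : 0 ≤ B := (abs_nonneg _).trans (hB 0 (by norm_num)).1
  have hmem : θ₀ ∈ Ioo (θ₀ - ε) (θ₀ + ε) := ⟨by linarith, by linarith⟩
  have hI : Summable fun k => score p θ₀ k ^ 2 * p θ₀ k :=
    Summable.of_norm_bounded hM fun k => (hdom θ₀ hmem k).2.2.le
  have hlim : ∑' k, ((raf G 0 + G (-1)) * dθ (dθ p) θ₀ k -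
      deriv (raf G) 0 * (score p θ₀ k ^ 2 * p θ₀ k)) = -(deriv (raf G) 0 * fisherInfo p θ₀) := by
    have := (hsum.mul_left (raf G 0 + G (-1))).sub (hI.hasSum.mul_left (deriv (raf G) 0))
    rw [this.tsum_eq, fisherInfo]
    ring
  rw [← hlim]
  refine tendsto_tsum_of_dominated_convergence
    (bound := fun k => (B + |G (-1)|) * L k + B * M k)
    ((hL.mul_left _).add (hM.mul_left _)) (fun k => ?_) ?_
  · have hfst : Tendsto (fun z : (ℕ → ℝ) × ℝ => z.1 k)
        (𝓝[finiteLaws (p θ₀)] (p θ₀) ×ˢ 𝓝 θ₀) (𝓝 (p θ₀ k)) :=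
      (tendsto_apply_finiteLaws _ k).comp tendsto_fst
    have hsnd : Tendsto (fun z : (ℕ → ℝ) × ℝ => z.2)
        (𝓝[finiteLaws (p θ₀)] (p θ₀) ×ˢ 𝓝 θ₀) (𝓝 θ₀) := tendsto_snd
    rcases eq_or_ne (p θ₀ k) 0 with h0 | h0
    · rw [hp.dθ_dθ_eq_zero hθ₀ h0, h0, mul_zero, mul_zero, mul_zero, sub_zero]
      refine tendsto_const_nhds.congr' ?_
      filter_upwards [tendsto_fst.eventually (eventually_finiteLaws (p θ₀))] with z hz
      exact (if_pos (hz.2.2 k h0)).symm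
    · have hpk : Tendsto (fun z : (ℕ → ℝ) × ℝ => p z.2 k)
          (𝓝[finiteLaws (p θ₀)] (p θ₀) ×ˢ 𝓝 θ₀) (𝓝 (p θ₀ k)) :=
        (hp.hasDerivAt hθ₀ k).continuousAt.tendsto.comp hsnd
      have hq1 : Tendsto (fun z : (ℕ → ℝ) × ℝ => z.1 k / p z.2 k)
          (𝓝[finiteLaws (p θ₀)] (p θ₀) ×ˢ 𝓝 θ₀) (𝓝 1) := by
        have := hfst.div hpk h0
        rwa [div_self h0] at this
      have hδ : Tendsto (fun z : (ℕ → ℝ) × ℝ => z.1 k / p z.2 k - 1)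
          (𝓝[finiteLaws (p θ₀)] (p θ₀) ×ˢ 𝓝 θ₀) (𝓝 0) := by
        simpa using hq1.sub_const 1
      have h1 := ((hG.differentiableAt_raf (δ := 0) (by norm_num)).continuousAt.tendsto.comp
        hδ).add_const (G (-1))
      have h2 := (hG.differentiableAt_deriv_raf (δ := 0) (by norm_num)).continuousAt.tendsto.comp hδ
      have h3 := (hp.continuousAt_dθ_dθ hθ₀ k).tendsto.comp hsnd
      have h4 := (((hp.hasDerivAt_dθ hθ₀ k).continuousAt.tendsto.comp hsnd).div hpk h0).pow 2
      have h5 := (h1.mul h3).sub ((h2.mul hq1).mul (h4.mul hpk))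
      rw [mul_one] at h5
      refine h5.congr' ?_
      filter_upwards [hfst.eventually_ne h0] with z hz
      simp only [estTermDeriv, if_neg hz, score, Function.comp_apply]
      rfl
  · filter_upwards [tendsto_fst.eventually (eventually_finiteLaws (p θ₀)),
      tendsto_snd.eventually (Ioo_mem_nhds hmem.1 hmem.2)] with z hz hzθ k
    have hL0 : 0 ≤ L k := (abs_nonneg _).trans (hdom θ₀ hmem k).2.1.le
    have hM0 : 0 ≤ M k := (abs_nonneg _).trans (hdom θ₀ hmem k).2.2.le
    rcases eq_or_ne (z.1 k) 0 with h0 | h0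
    · rw [estTermDeriv, if_pos h0, norm_zero]
      positivity
    · have hqpos : 0 < z.1 k := lt_of_le_of_ne (hz.1.1 k) h0.symm
      have hpos : 0 < p z.2 k := hp.pos (interior_subset hθ₀) (hsub hzθ) fun h => h0 (hz.2.2 k h)
      have hδ : -1 < z.1 k / p z.2 k - 1 := by have := div_pos hqpos hpos; linarith
      rw [estTermDeriv, if_neg h0, Real.norm_eq_abs]
      refine (abs_sub _ _).trans (add_le_add ?_ ?_)
      · rw [abs_mul]
        gcongr
        · exact (abs_add_le _ _).trans (by gcongr; exact (hB _ hδ).1)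
        · exact (hdom z.2 hzθ k).2.1.le
      · rw [abs_mul]
        gcongr
        · have := (hB _ hδ).2.2.1
          rwa [add_sub_cancel] at this
        · exact (hdom z.2 hzθ k).2.2.le

/-- As `∑ p'_k = 0`, multiples of `p'` may be subtracted freely; this turns each term into the
Taylor remainder of `A` at `0` times `p'_k`. -/
lemma tsum_estTerm_approx (hG : IsDisparity G) (hp : IsFamily p Θ)
    (hθ₀ : θ₀ ∈ interior Θ) (hd : LocallyDominated p Θ) (hA : BoundedRAF G)
    (hu : Summable fun k => |score p θ₀ k| * p θ₀ k) :
    ∃ c : ℝ, 0 ≤ c ∧ ∀ q ∈ finiteLaws (p θ₀),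
      |∑' k, estTerm G p q θ₀ k - deriv (raf G) 0 * ∑' k, q k * score p θ₀ k| ≤
        c * remainder (p θ₀) (score p θ₀) q := by
  obtain ⟨c₁, hc₁, hc⟩ := hG.raf_taylor hA
  -- The cells with `q k = 0`: there `estTerm` is `0` instead of a value of `A` at `-1`, so they are
  -- outside the Taylor bound and cost this constant.
  set c₂ := |-(raf G 0 + G (-1)) + deriv (raf G) 0| with hc₂
  have hp₀ := hp.isProb θ₀ (interior_subset hθ₀)
  refine ⟨c₁ + c₂, by positivity, fun q hq => ?_⟩
  have hs1 : HasSum (fun k => estTerm G p q θ₀ k) (∑' k, estTerm G p q θ₀ k) :=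
    (summable_of_hasFiniteSupport (hq.2.1.subset fun k hk => by
      by_contra h
      exact hk (if_pos (by simpa using h)))).hasSum
  have hs2 : HasSum (fun k => q k * score p θ₀ k) (∑' k, q k * score p θ₀ k) :=
    (summable_of_hasFiniteSupport (hq.2.1.subset fun k hk => by
      simp only [Function.mem_support] at hk ⊢
      exact left_ne_zero_of_mul hk)).hasSum
  have hs3 := (hp.tsum_dθ_eq_zero hd hθ₀).1
  have h1 := ((hs1.sub (hs3.mul_left (raf G 0 + G (-1)))).sub
    ((hs2.sub hs3).mul_left (deriv (raf G) 0)))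
  rw [mul_zero, sub_zero, sub_zero] at h1
  have hr := summable_remainder hp₀ hu hq
  rw [← h1.tsum_eq, remainder, ← tsum_mul_left]
  have hle : ∀ k, ‖estTerm G p q θ₀ k - (raf G 0 + G (-1)) * dθ p θ₀ k -
      deriv (raf G) 0 * (q k * score p θ₀ k - dθ p θ₀ k)‖ ≤ (c₁ + c₂) * (|score p θ₀ k| *
        min |q k - p θ₀ k| ((q k - p θ₀ k) ^ 2 / p θ₀ k)) := fun k => by
    rcases eq_or_ne (p θ₀ k) 0 with h0 | h0
    · simp [estTerm, hq.2.2 k h0, hp.dθ_eq_zero hθ₀ h0, h0]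
    · have hpos : 0 < p θ₀ k := lt_of_le_of_ne (hp₀.1 k) h0.symm
      set δ := q k / p θ₀ k - 1 with hδ
      have hm : min |q k - p θ₀ k| ((q k - p θ₀ k) ^ 2 / p θ₀ k) = min |δ| (δ ^ 2) * p θ₀ k := by
        rw [min_mul_of_nonneg _ _ hpos.le]
        have : q k - p θ₀ k = δ * p θ₀ k := by rw [hδ]; field_simp
        rw [this, abs_mul, abs_of_pos hpos]
        congr 1
        field_simp
      have hmn : 0 ≤ min |δ| (δ ^ 2) := le_min (abs_nonneg _) (sq_nonneg _)
      have hpu := hp.score_mul hθ₀ k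
      have hqu : q k * score p θ₀ k - dθ p θ₀ k = δ * dθ p θ₀ k := by
        rw [← hpu, hδ]; field_simp
      rw [hm, hqu, Real.norm_eq_abs]
      have habs : |dθ p θ₀ k| = |score p θ₀ k| * p θ₀ k := by
        rw [← hpu, abs_mul, abs_of_pos hpos]
      by_cases hq0 : q k = 0
      · have hδ1 : δ = -1 := by rw [hδ, hq0]; simp
        rw [estTerm, if_pos hq0, hδ1]
        rw [show (0 : ℝ) - (raf G 0 + G (-1)) * dθ p θ₀ k - deriv (raf G) 0 * (-1 * dθ p θ₀ k) =
          (-(raf G 0 + G (-1)) + deriv (raf G) 0) * dθ p θ₀ k by ring, abs_mul, ← hc₂, habs]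
        have : min |(-1 : ℝ)| ((-1) ^ 2) = 1 := by norm_num
        rw [this, one_mul]
        exact mul_le_mul_of_nonneg_right (by linarith) (by positivity)
      · have hqpos : 0 < q k := lt_of_le_of_ne (hq.1.1 k) (Ne.symm hq0)
        have hδ1 : -1 < δ := by have := div_pos hqpos hpos; rw [hδ]; linarith
        rw [estTerm, if_neg hq0, ← hδ]
        rw [show (raf G δ + G (-1)) * dθ p θ₀ k - (raf G 0 + G (-1)) * dθ p θ₀ k -
          deriv (raf G) 0 * (δ * dθ p θ₀ k) = (raf G δ - raf G 0 - deriv (raf G) 0 * δ) *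
            dθ p θ₀ k by ring, abs_mul, habs]
        calc _ ≤ (c₁ * min |δ| (δ ^ 2)) * (|score p θ₀ k| * p θ₀ k) :=
              mul_le_mul_of_nonneg_right (hc δ hδ1) (by positivity)
          _ ≤ ((c₁ + c₂) * min |δ| (δ ^ 2)) * (|score p θ₀ k| * p θ₀ k) := by
              gcongr
              exact le_add_of_nonneg_right (abs_nonneg _)
          _ = _ := by ring
  have hs : Summable fun k => (c₁ + c₂) * (|score p θ₀ k| *
        min |q k - p θ₀ k| ((q k - p θ₀ k) ^ 2 / p θ₀ k)) := hr.mul_left _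
  have hs' := hs.of_nonneg_of_le (fun _ => norm_nonneg _) hle
  have h2 := norm_tsum_le_tsum_norm hs'
  rw [Real.norm_eq_abs] at h2
  exact h2.trans (Summable.tsum_le_tsum hle hs' hs)

/-- The mean value theorem without an order on the endpoints, since `T q` may lie on either side of
`θ₀`. -/
lemma exists_mem_uIcc_deriv_eq {f f' : ℝ → ℝ} {a b : ℝ}
    (hf : ∀ x ∈ uIcc a b, HasDerivAt f (f' x) x) :
    ∃ c ∈ uIcc a b, f b - f a = f' c * (b - a) := by
  rcases lt_trichotomy a b with h | h | h
  · rw [uIcc_of_le h.le] at hf ⊢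
    obtain ⟨c, hc, he⟩ := exists_hasDerivAt_eq_slope f f' h
      (fun x hx => (hf x hx).continuousAt.continuousWithinAt)
      fun x hx => hf x (Ioo_subset_Icc_self hx)
    refine ⟨c, Ioo_subset_Icc_self hc, ?_⟩
    rw [he, div_mul_cancel₀ _ (by linarith)]
  · exact ⟨a, left_mem_uIcc, by simp [h]⟩
  · rw [uIcc_of_ge h.le] at hf ⊢
    obtain ⟨c, hc, he⟩ := exists_hasDerivAt_eq_slope f f' h
      (fun x hx => (hf x hx).continuousAt.continuousWithinAt)
      fun x hx => hf x (Ioo_subset_Icc_self hx)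
    refine ⟨c, Ioo_subset_Icc_self hc, ?_⟩
    rw [he]
    have : a - b ≠ 0 := by linarith
    field_simp
    ring

/-- Disparity functionals with bounded generator and residual adjustment function are
approximately linear, with the influence function of the maximum likelihood functional. -/
theorem approxLinear_disparityFunctional (hG : IsDisparity G) (hb : BoundedGenerator G)
    (hp : IsFamily p Θ) {C : Set ℝ} (hC : IsCompact C) (hCΘ : C ⊆ Θ)
    (hcont : ∀ k, ContinuousOn (fun θ => p θ k) C) (hθ₀ : θ₀ ∈ interior Θ)
    (hΓ : p θ₀ ∈ GammaHat G p Θ C) {T : (ℕ → ℝ) → ℝ} (hT : IsDisparityFunctional G p Θ T)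
    (hd : LocallyDominated p Θ) (hA : BoundedRAF G) (hI : 0 < fisherInfo p θ₀)
    (hu : Summable fun k => |score p θ₀ k| * p θ₀ k) :
    ApproxLinear T (p θ₀) (score p θ₀) (fisherInfo p θ₀) θ₀ := by
  have hθ := interior_subset hθ₀
  obtain ⟨hTlim, hTmin⟩ := disparityFunctional_consistent hG.continuousOn hG.map_zero hp hC hCΘ
    hcont hθ (tendstoUniformlyOn_disparity_of_bounded hG hb hp hθ)
    (fun θ h => disparity_nonneg_of_bounded hG hb hp hθ h) hΓ hT
  obtain ⟨c, hc0, hc⟩ := tsum_estTerm_approx hG hp hθ₀ hd hA hu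
  have hA0 := hG.deriv_raf_zero
  set A' := deriv (raf G) 0 with hA'
  have hA'pos : 0 < |A'| := abs_pos.2 hA0
  refine ⟨2 / fisherInfo p θ₀ * (c / |A'|), by positivity, fun ε hε => ?_⟩
  obtain ⟨η, hη, hsol⟩ := approx_solution hI hε
  -- Dividing the estimating equation by `-A'(0)` makes the slope tend to the Fisher information,
  -- whatever the disparity.
  have hlim := (tendsto_tsum_estTermDeriv hG hp hθ₀ hd hA).div_const (-A')
  rw [← hA', neg_div_neg_eq, mul_div_cancel_left₀ _ hA0] at hlim
  have h1 := hlim.eventually (Metric.closedBall_mem_nhds _ hη)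
  obtain ⟨P, hP, Q, hQ, hPQ⟩ := eventually_prod_iff.1 h1
  obtain ⟨r, hr, hball⟩ := Metric.eventually_nhds_iff_ball.1
    (hQ.and (isOpen_interior.mem_nhds hθ₀))
  filter_upwards [hP, eventually_finiteLaws (p θ₀), hTmin,
    hTlim.eventually (Metric.ball_mem_nhds θ₀ hr)] with q hqP hqE hqmin hqr
  have hsub : uIcc θ₀ (T q) ⊆ Metric.ball θ₀ r :=
    (convex_ball θ₀ r).ordConnected.uIcc_subset (Metric.mem_ball_self hr) hqr
  -- Near `θ₀` the minimiser is interior, so the estimating function vanishes there.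
  have hzero : ∑' k, estTerm G p q (T q) k = 0 := by
    have hTi : T q ∈ interior Θ := (hball _ hqr).2
    have := (hqmin.2.isLocalMin (mem_interior_iff_mem_nhds.1 hTi)).hasDerivAt_eq_zero
      (hasDerivAt_disparity hG hp hθ hqE hTi)
    linarith
  obtain ⟨x, hx, hxe⟩ := exists_mem_uIcc_deriv_eq
    (f := fun t => ∑' k, estTerm G p q t k) (f' := fun t => ∑' k, estTermDeriv G p q t k)
    (a := θ₀) (b := T q)
    fun x hx => hasDerivAt_tsum_estTerm hG hp hθ hqE (hball _ (hsub hx)).2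
  -- The mean value point lies between `θ₀` and `T q`, hence in the ball where the slope is within
  -- `η` of its limit.
  have hdx := hPQ hqP (hball _ (hsub hx)).1
  rw [Real.dist_eq] at hdx
  have := hsol _ (T q - θ₀) (∑' k, q k * score p θ₀ k)
    ((∑' k, estTerm G p q θ₀ k - A' * ∑' k, q k * score p θ₀ k) / A') hdx (by
      simp only [hzero] at hxe
      field_simp
      linarith)
  refine this.trans (add_le_add le_rfl ?_)
  rw [abs_div, mul_assoc]
  refine mul_le_mul_of_nonneg_left ?_ (by positivity)
  rw [div_mul_eq_mul_div]
  exact div_le_div_of_nonneg_right (hc q hqE) hA'pos.le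

end

/-! ### Vanishing of the expected remainder -/

/-- The order of magnitude of the mean of the remainder at the empirical distribution of a sample of
size `x²` tends to zero after multiplication by `x`. -/
def NegligibleRemainder (p₀ u : ℕ → ℝ) : Prop :=
  Tendsto (fun x : ℝ => ∑' k, |u k| * min (x * p₀ k) (1 / x)) atTop (𝓝 0)

lemma summable_abs_mul_of_sq {p₀ u : ℕ → ℝ} (h₀ : IsProb p₀)
    (hu : Summable fun k => u k ^ 2 * p₀ k) : Summable fun k => |u k| * p₀ k := by
  refine (hu.add h₀.2.summable).of_nonneg_of_le (fun k => mul_nonneg (abs_nonneg _) (h₀.1 k))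
    fun k => ?_
  have : |u k| ≤ u k ^ 2 + 1 := by nlinarith [sq_abs (u k), sq_nonneg (|u k| - 1)]
  nlinarith [h₀.1 k]

section
variable {p : ℝ → ℕ → ℝ} {Θ : Set ℝ} {θ₀ : ℝ}

lemma IsFamily.hasDerivAt_sqrtFamily (hp : IsFamily p Θ) (hθ₀ : θ₀ ∈ interior Θ) (k : ℕ) :
    HasDerivAt (fun t => sqrtFamily p t k) (score p θ₀ k * √(p θ₀ k) / 2) θ₀ := by
  rcases eq_or_ne (p θ₀ k) 0 with h | h
  · rw [h, Real.sqrt_zero, mul_zero, zero_div]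
    refine (hasDerivAt_const θ₀ (0 : ℝ)).congr_of_eventuallyEq ?_
    filter_upwards [isOpen_interior.mem_nhds hθ₀] with t ht
    rw [sqrtFamily, hp.common_support θ₀ (interior_subset hθ₀) t (interior_subset ht) k h,
      Real.sqrt_zero]
  · have hpos := hp.pos (interior_subset hθ₀) (interior_subset hθ₀) h
    refine ((hp.hasDerivAt hθ₀ k).sqrt h).congr_deriv ?_
    rw [score]
    have h1 := Real.sqrt_pos.2 hpos
    rw [div_eq_div_iff (by positivity) (by norm_num), div_mul_eq_mul_div, div_mul_eq_mul_div,
      eq_div_iff hpos.ne']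
    nth_rewrite 1 [← Real.sq_sqrt hpos.le]
    ring

/-- Moving a factor `√a` out of the minimum turns the score into twice `s' = u √p / 2` and makes the
remaining minimum of the form `min(y, 1 / y)`, which is at most `1`. -/
lemma score_mul_min {u a x : ℝ} (ha : 0 ≤ a) (hx : 0 < x) (h : a = 0 → u = 0) :
    |u| * min (x * a) (1 / x) = 2 * |u * √a / 2| * min (x * √a) (1 / (x * √a)) := by
  rcases ha.eq_or_lt with h0 | h0
  · simp [h h0.symm]
  · have h1 := Real.sqrt_pos.2 h0
    rw [abs_div, abs_mul, abs_of_pos h1, abs_two, mul_div_cancel₀ _ two_ne_zero, mul_assoc,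
      mul_min_of_nonneg _ _ h1.le]
    congr 2
    · nth_rewrite 1 [← Real.sq_sqrt h0.le]; ring
    · field_simp

lemma IsFamily.score_eq_zero {k : ℕ} (h : p θ₀ k = 0) : score p θ₀ k = 0 := by
  rw [score, h, div_zero]

/-- Each term is at most `|u_k| / x`, and all are dominated by `2 |s'_k|` because `min(y, 1 / y) ≤
1`. -/
lemma negligibleRemainder_of_summable (hp : IsFamily p Θ) (hθ₀ : θ₀ ∈ interior Θ)
    (hs : Summable fun k => |dθ (sqrtFamily p) θ₀ k|) :
    NegligibleRemainder (p θ₀) (score p θ₀) := by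
  have hp₀ := hp.isProb θ₀ (interior_subset hθ₀)
  rw [NegligibleRemainder, ← tsum_zero (α := ℝ) (β := ℕ)]
  refine tendsto_tsum_of_dominated_convergence (hs.mul_left 2) (fun k => ?_) ?_
  · refine squeeze_zero' (g := fun x => |score p θ₀ k| * x⁻¹) ?_ ?_ ?_
    · filter_upwards [eventually_gt_atTop 0] with x hx
      have := hp₀.1 k
      positivity
    · filter_upwards with x
      rw [← one_div]
      exact mul_le_mul_of_nonneg_left (min_le_right _ _) (abs_nonneg _)
    · simpa using tendsto_inv_atTop_zero.const_mul |score p θ₀ k|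
  · filter_upwards [eventually_gt_atTop 0] with x hx k
    have hd : dθ (sqrtFamily p) θ₀ k = score p θ₀ k * √(p θ₀ k) / 2 :=
      (hp.hasDerivAt_sqrtFamily hθ₀ k).deriv
    have h0 := hp₀.1 k
    rw [Real.norm_of_nonneg (by positivity), score_mul_min h0 hx IsFamily.score_eq_zero, hd]
    refine mul_le_of_le_one_right (by positivity) ?_
    rcases le_total (x * √(p θ₀ k)) 1 with h | h
    · exact (min_le_left _ _).trans h
    · exact (min_le_right _ _).trans (by rw [div_le_one (by linarith)]; exact h)

end

/-! ### Square summable sequences -/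

/-- The space of square summable sequences. -/
abbrev L2Seq := lp (fun _ : ℕ => ℝ) 2

lemma memℓp_two_iff {f : ℕ → ℝ} : Memℓp f 2 ↔ Summable fun k => f k ^ 2 := by
  rw [memℓp_gen_iff (by norm_num)]
  simp

open Classical in
/-- A square summable sequence as an element of `ℓ²`, with value `0` for the other sequences. -/
noncomputable def toL2 (f : ℕ → ℝ) : L2Seq :=
  if h : Summable fun k => f k ^ 2 then ⟨f, memℓp_two_iff.2 h⟩ else 0

lemma toL2_apply {f : ℕ → ℝ} (h : Summable fun k => f k ^ 2) (k : ℕ) : toL2 f k = f k := by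
  rw [toL2, dif_pos h]

lemma L2Seq.summable_sq (x : L2Seq) : Summable fun k => x k ^ 2 :=
  memℓp_two_iff.1 (lp.memℓp x)

lemma L2Seq.hasSum_inner (x y : L2Seq) : HasSum (fun k => x k * y k) (inner ℝ x y) := by
  have := lp.hasSum_inner (𝕜 := ℝ) x y
  refine this.congr_fun fun k => ?_
  simp [mul_comm]

lemma L2Seq.hasSum_sq (x : L2Seq) : HasSum (fun k => x k ^ 2) (‖x‖ ^ 2) := by
  have := L2Seq.hasSum_inner x x
  rw [real_inner_self_eq_norm_sq] at this
  exact this.congr_fun fun k => sq _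

/-- This turns the coordinate form of `ℓ²` differentiability into a derivative in a Hilbert space.
Square summability is required near `θ` because `toL2` takes a default value otherwise. -/
lemma hasDerivAt_toL2 {f : ℝ → ℕ → ℝ} {f' : ℕ → ℝ} {θ : ℝ}
    (hf : ∀ᶠ t in 𝓝 θ, Summable fun k => f t k ^ 2) (h : HasL2DerivAt f f' θ) :
    HasDerivAt (fun t => toL2 (f t)) (toL2 f') θ := by
  rw [hasDerivAt_iff_tendsto_slope_zero, tendsto_iff_norm_sub_tendsto_zero]
  have hsq := h.2.2.sqrt
  rw [Real.sqrt_zero] at hsq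
  refine hsq.congr' ?_
  have hadd : Tendsto (fun β : ℝ => θ + β) (𝓝[≠] 0) (𝓝 θ) := by
    have : Tendsto (fun β : ℝ => θ + β) (𝓝 0) (𝓝 (θ + 0)) :=
      (continuous_const.add continuous_id).tendsto 0
    rw [add_zero] at this
    exact this.mono_left nhdsWithin_le_nhds
  filter_upwards [hadd.eventually hf] with β hβ
  rw [← Real.sqrt_sq (norm_nonneg (β⁻¹ • (toL2 (f (θ + β)) - toL2 (f θ)) - toL2 f'))]
  congr 1
  rw [← (L2Seq.hasSum_sq _).tsum_eq]
  refine tsum_congr fun k => ?_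
  have h1 : (β⁻¹ • (toL2 (f (θ + β)) - toL2 (f θ)) - toL2 f') k =
      β⁻¹ * (toL2 (f (θ + β)) k - toL2 (f θ) k) - toL2 f' k := rfl
  rw [h1, toL2_apply hβ, toL2_apply hf.self_of_nhds, toL2_apply h.1, div_eq_inv_mul]

lemma hasDerivAt_L2Seq_apply {F : ℝ → L2Seq} {F' : L2Seq} {θ : ℝ} (h : HasDerivAt F F' θ) (k : ℕ) :
    HasDerivAt (fun t => F t k) (F' k) θ := by
  rw [hasDerivAt_iff_tendsto_slope_zero, tendsto_iff_norm_sub_tendsto_zero] at h ⊢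
  refine squeeze_zero (fun _ => norm_nonneg _) (fun β => ?_) h
  exact lp.norm_apply_le_norm two_ne_zero (β⁻¹ • (F (θ + β) - F θ) - F') k

/-- The Cauchy–Schwarz inequality, together with the summability it provides. -/
lemma tsum_mul_le_norm_mul_sqrt (x : L2Seq) {b : ℕ → ℝ}
    (hb : Summable fun k => b k ^ 2) :
    Summable (fun k => |x k| * b k) ∧ ∑' k, |x k| * b k ≤ ‖x‖ * √(∑' k, b k ^ 2) := by
  have hx : Summable fun k => |x k| ^ 2 := by simpa using L2Seq.summable_sq x
  have h := L2Seq.hasSum_inner (toL2 fun k => |x k|) (toL2 b)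
  simp only [toL2_apply hx, toL2_apply hb] at h
  refine ⟨h.summable, h.tsum_eq.trans_le ((real_inner_le_norm _ _).trans_eq ?_)⟩
  congr 1
  · rw [← Real.sqrt_sq (norm_nonneg (toL2 fun k => |x k|)), ← Real.sqrt_sq (norm_nonneg x),
      ← (L2Seq.hasSum_sq _).tsum_eq, ← (L2Seq.hasSum_sq x).tsum_eq]
    simp [toL2_apply hx]
  · rw [← Real.sqrt_sq (norm_nonneg (toL2 b)), ← (L2Seq.hasSum_sq _).tsum_eq]
    simp [toL2_apply hb]

/-! ### The squared Hellinger distance -/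

/-- The element `√q` of `ℓ²`. -/
noncomputable def sqrtL2 (q : ℕ → ℝ) : L2Seq := toL2 fun k => √(q k)

lemma sqrtL2_apply {q : ℕ → ℝ} (hq : IsProb q) (k : ℕ) : sqrtL2 q k = √(q k) :=
  toL2_apply (by simpa [Real.sq_sqrt (hq.1 _)] using hq.2.summable) k

lemma norm_sqrtL2 {q : ℕ → ℝ} (hq : IsProb q) : ‖sqrtL2 q‖ = 1 := by
  have h := (L2Seq.hasSum_sq (sqrtL2 q)).tsum_eq
  simp only [sqrtL2_apply hq, Real.sq_sqrt (hq.1 _), hq.2.tsum_eq] at h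
  rw [← Real.sqrt_sq (norm_nonneg (sqrtL2 q)), ← h, Real.sqrt_one]

lemma sq_sqrt_sub_sqrt_le {a b : ℝ} (ha : 0 ≤ a) (hb : 0 ≤ b) :
    (√a - √b) ^ 2 ≤ |a - b| := by
  have h1 : a - b = (√a - √b) * (√a + √b) := by
    linear_combination Real.sq_sqrt hb - Real.sq_sqrt ha
  have h2 := Real.sqrt_nonneg a
  have h3 := Real.sqrt_nonneg b
  rw [h1, abs_mul, abs_of_nonneg (by positivity : 0 ≤ √a + √b), ← sq_abs, sq]
  refine mul_le_mul_of_nonneg_left ?_ (abs_nonneg _)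
  exact abs_le.2 ⟨by linarith, by linarith⟩

/-- Together with `sq_sqrt_sub_sqrt_le`, this bounds `(√q - √p)²` by exactly the minimum appearing
in `remainder`. -/
lemma sq_sqrt_sub_sqrt_le_div {a b : ℝ} (ha : 0 ≤ a) (hb : 0 < b) :
    (√a - √b) ^ 2 ≤ (a - b) ^ 2 / b := by
  have h1 : a - b = (√a - √b) * (√a + √b) := by
    linear_combination Real.sq_sqrt hb.le - Real.sq_sqrt ha
  have h2 := Real.sqrt_nonneg a
  have h3 := Real.sqrt_nonneg b
  rw [h1, mul_pow, le_div_iff₀ hb]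
  refine mul_le_mul_of_nonneg_left ?_ (sq_nonneg _)
  nlinarith [Real.sq_sqrt hb.le]

lemma tendsto_sqrtL2 {p₀ : ℕ → ℝ} (h₀ : IsProb p₀) :
    Tendsto (fun q => ‖sqrtL2 q - sqrtL2 p₀‖) (𝓝[finiteLaws p₀] p₀) (𝓝 0) := by
  have h1 := (tendsto_tsum_abs_sub h₀).sqrt
  rw [Real.sqrt_zero] at h1
  refine squeeze_zero' (Eventually.of_forall fun _ => norm_nonneg _) ?_ h1
  filter_upwards [eventually_finiteLaws p₀] with q hq
  refine Real.le_sqrt_of_sq_le ?_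
  refine hasSum_le (fun k => ?_) (L2Seq.hasSum_sq _) (h₀.summable_abs_sub hq.1).hasSum
  have : (sqrtL2 q - sqrtL2 p₀) k = sqrtL2 q k - sqrtL2 p₀ k := rfl
  rw [this, sqrtL2_apply hq.1, sqrtL2_apply h₀]
  exact sq_sqrt_sub_sqrt_le (hq.1.1 k) (h₀.1 k)

lemma hellinger_zero : hellinger 0 = 0 := by simp [hellinger]

lemma continuousOn_hellinger : ContinuousOn hellinger (Ici (-1)) := by
  unfold hellinger
  fun_prop

section
variable {p : ℝ → ℕ → ℝ} {Θ : Set ℝ} {θ₀ : ℝ}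

/-- The support condition on `q` is essential: a cell with `p θ k = 0 < q k` counts as `0` in the
disparity but not in the norm. -/
lemma disparity_hellinger (hp : IsFamily p Θ) (hθ₀ : θ₀ ∈ Θ) {q : ℕ → ℝ} (hq : IsProb q)
    (hs : ∀ k, p θ₀ k = 0 → q k = 0) {θ : ℝ} (hθ : θ ∈ Θ) :
    disparity hellinger p q θ = ‖sqrtL2 q - sqrtL2 (p θ)‖ ^ 2 := by
  rw [← (L2Seq.hasSum_sq _).tsum_eq, disparity]
  refine tsum_congr fun k => ?_
  have : (sqrtL2 q - sqrtL2 (p θ)) k = sqrtL2 q k - sqrtL2 (p θ) k := rfl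
  rw [this, sqrtL2_apply hq, sqrtL2_apply (hp.isProb θ hθ)]
  rcases eq_or_ne (p θ k) 0 with h | h
  · simp [h, hs k (hp.common_support θ hθ θ₀ hθ₀ k h)]
  · have hpos := hp.pos hθ hθ h
    have h1 := Real.sqrt_pos.2 hpos
    rw [hellinger, sub_add_cancel, Real.sqrt_div (hq.1 k)]
    nth_rewrite 2 [← Real.sq_sqrt hpos.le]
    rw [← mul_pow]
    congr 1
    field_simp

/-- A difference of squares: one factor is at most `‖√q - √p₀‖`, the other at most `4` because all
these vectors are unit vectors. This replaces boundedness of `G'`, which fails for the Hellinger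
generator. -/
lemma tendstoUniformlyOn_disparity_hellinger (hp : IsFamily p Θ) (hθ₀ : θ₀ ∈ Θ) :
    TendstoUniformlyOn (disparity hellinger p) (disparity hellinger p (p θ₀))
      (𝓝[finiteLaws (p θ₀)] (p θ₀)) Θ := by
  have hp₀ := hp.isProb θ₀ hθ₀
  have ht := (tendsto_sqrtL2 hp₀).mul_const 4
  rw [zero_mul] at ht
  rw [Metric.tendstoUniformlyOn_iff]
  intro ε hε
  filter_upwards [ht.eventually_lt_const hε, eventually_finiteLaws (p θ₀)] with q hq hqE θ hθ
  refine lt_of_le_of_lt ?_ hq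
  rw [dist_comm, Real.dist_eq, disparity_hellinger hp hθ₀ hqE.1 hqE.2.2 hθ,
    disparity_hellinger hp hθ₀ hp₀ (fun _ h => h) hθ, sq_sub_sq, abs_mul, mul_comm]
  have h1 := norm_sqrtL2 hqE.1
  have h2 := norm_sqrtL2 hp₀
  have h3 := norm_sqrtL2 (hp.isProb θ hθ)
  have h4 := norm_sub_le (sqrtL2 q) (sqrtL2 (p θ))
  have h5 := norm_sub_le (sqrtL2 (p θ₀)) (sqrtL2 (p θ))
  have h6 := abs_norm_sub_norm_le (sqrtL2 q - sqrtL2 (p θ)) (sqrtL2 (p θ₀) - sqrtL2 (p θ))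
  rw [sub_sub_sub_cancel_right] at h6
  refine mul_le_mul h6 ?_ (abs_nonneg _) (norm_nonneg _)
  rw [abs_of_nonneg (by positivity)]
  linarith

variable {s' s'' : ℝ → ℕ → ℝ}

lemma TwiceL2Diff.hasDerivAt_sqrtL2 (hp : IsFamily p Θ) (h : TwiceL2Diff p Θ s' s'') {θ : ℝ}
    (hθ : θ ∈ interior Θ) : HasDerivAt (fun t => sqrtL2 (p t)) (toL2 (s' θ)) θ := by
  refine hasDerivAt_toL2 (f := sqrtFamily p) ?_ (h θ hθ).1
  filter_upwards [isOpen_interior.mem_nhds hθ] with t ht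
  have := hp.isProb t (interior_subset ht)
  simpa [sqrtFamily, Real.sq_sqrt (this.1 _)] using this.2.summable

lemma TwiceL2Diff.hasDerivAt_deriv (h : TwiceL2Diff p Θ s' s'') {θ : ℝ}
    (hθ : θ ∈ interior Θ) : HasDerivAt (fun t => toL2 (s' t)) (toL2 (s'' θ)) θ := by
  refine hasDerivAt_toL2 ?_ (h θ hθ).2
  filter_upwards [isOpen_interior.mem_nhds hθ] with t ht
  exact (h t ht).1.1

/-- The curve `s` stays on the unit sphere; differentiating `‖s‖² = 1` gives orthogonality, and
`inner_deriv_eq` differentiates once more. -/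
lemma TwiceL2Diff.inner_eq_zero (hp : IsFamily p Θ) (h : TwiceL2Diff p Θ s' s'') {θ : ℝ}
    (hθ : θ ∈ interior Θ) : inner ℝ (sqrtL2 (p θ)) (toL2 (s' θ)) = 0 := by
  have hd := h.hasDerivAt_sqrtL2 hp hθ
  have h1 := hd.inner ℝ hd
  have hc : (fun t => inner ℝ (sqrtL2 (p t)) (sqrtL2 (p t))) =ᶠ[𝓝 θ] fun _ => (1 : ℝ) := by
    filter_upwards [isOpen_interior.mem_nhds hθ] with t ht
    rw [real_inner_self_eq_norm_sq, norm_sqrtL2 (hp.isProb t (interior_subset ht)), one_pow]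
  have h2 := h1.deriv
  rw [hc.deriv_eq, deriv_const, real_inner_comm (sqrtL2 (p θ)) (toL2 (s' θ))] at h2
  linarith [real_inner_comm (sqrtL2 (p θ)) (toL2 (s' θ))]

lemma TwiceL2Diff.inner_deriv_eq (hp : IsFamily p Θ) (h : TwiceL2Diff p Θ s' s'') {θ : ℝ}
    (hθ : θ ∈ interior Θ) :
    inner ℝ (sqrtL2 (p θ)) (toL2 (s'' θ)) = -‖toL2 (s' θ)‖ ^ 2 := by
  have h1 := (h.hasDerivAt_sqrtL2 hp hθ).inner ℝ (h.hasDerivAt_deriv hθ)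
  have hc : (fun t => inner ℝ (sqrtL2 (p t)) (toL2 (s' t))) =ᶠ[𝓝 θ] fun _ => (0 : ℝ) := by
    filter_upwards [isOpen_interior.mem_nhds hθ] with t ht
    exact h.inner_eq_zero hp ht
  have h2 := h1.deriv
  rw [hc.deriv_eq, deriv_const, real_inner_self_eq_norm_sq] at h2
  linarith

/-- Coordinates are continuous on `ℓ²`, so the `ℓ²` derivative agrees with the classical one, and
hence with the score. -/
lemma TwiceL2Diff.deriv_apply (hp : IsFamily p Θ) (h : TwiceL2Diff p Θ s' s'')
    (hθ₀ : θ₀ ∈ interior Θ) (k : ℕ) :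
    toL2 (s' θ₀) k = score p θ₀ k * √(p θ₀ k) / 2 := by
  have h1 := hasDerivAt_L2Seq_apply (h.hasDerivAt_sqrtL2 hp hθ₀) k
  refine h1.unique ((hp.hasDerivAt_sqrtFamily hθ₀ k).congr_of_eventuallyEq ?_)
  filter_upwards [isOpen_interior.mem_nhds hθ₀] with t ht
  exact sqrtL2_apply (hp.isProb t (interior_subset ht)) k

lemma TwiceL2Diff.hasSum_fisherInfo (hp : IsFamily p Θ) (h : TwiceL2Diff p Θ s' s'')
    (hθ₀ : θ₀ ∈ interior Θ) :
    HasSum (fun k => score p θ₀ k ^ 2 * p θ₀ k) (4 * ‖toL2 (s' θ₀)‖ ^ 2) := by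
  refine ((L2Seq.hasSum_sq (toL2 (s' θ₀))).mul_left 4).congr_fun fun k => ?_
  rw [h.deriv_apply hp hθ₀, div_pow, mul_pow, Real.sq_sqrt ((hp.isProb _
    (interior_subset hθ₀)).1 k)]
  ring

lemma TwiceL2Diff.hasSum_score (hp : IsFamily p Θ) (h : TwiceL2Diff p Θ s' s'')
    (hθ₀ : θ₀ ∈ interior Θ) : HasSum (fun k => score p θ₀ k * p θ₀ k) 0 := by
  have hp₀ := hp.isProb _ (interior_subset hθ₀)
  have := (L2Seq.hasSum_inner (sqrtL2 (p θ₀)) (toL2 (s' θ₀))).mul_left 2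
  rw [h.inner_eq_zero hp hθ₀, mul_zero] at this
  refine this.congr_fun fun k => ?_
  rw [h.deriv_apply hp hθ₀, sqrtL2_apply hp₀]
  nth_rewrite 1 [← Real.sq_sqrt (hp₀.1 k)]
  ring

/-- Since `2 √p (√q - √p) = (q - p) - (√q - √p)²`, the linear functional of `√q` differs from that
of `q` only by the sum of `u_k (√q_k - √p_k)²`. -/
lemma TwiceL2Diff.inner_sqrtL2_approx (hp : IsFamily p Θ) (h : TwiceL2Diff p Θ s' s'')
    (hθ₀ : θ₀ ∈ interior Θ) {q : ℕ → ℝ} (hq : q ∈ finiteLaws (p θ₀)) :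
    |4 * inner ℝ (sqrtL2 q) (toL2 (s' θ₀)) - ∑' k, q k * score p θ₀ k| ≤
      remainder (p θ₀) (score p θ₀) q := by
  have hp₀ := hp.isProb _ (interior_subset hθ₀)
  have hq' : HasSum (fun k => q k * score p θ₀ k) (∑' k, q k * score p θ₀ k) :=
    (summable_of_hasFiniteSupport (hq.2.1.subset fun k hk => by
      simp only [Function.mem_support] at hk ⊢
      exact left_ne_zero_of_mul hk)).hasSum
  have h0 := h.inner_eq_zero hp hθ₀
  have h1 := ((L2Seq.hasSum_inner (sqrtL2 q - sqrtL2 (p θ₀)) (toL2 (s' θ₀))).mul_left 4).sub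
    (hq'.sub (h.hasSum_score hp hθ₀))
  rw [inner_sub_left, h0, sub_zero, sub_zero] at h1
  have hr := summable_remainder hp₀
    (summable_abs_mul_of_sq hp₀ (h.hasSum_fisherInfo hp hθ₀).summable) hq
  rw [← h1.tsum_eq, remainder]
  have hle : ∀ k, ‖4 * ((sqrtL2 q - sqrtL2 (p θ₀)) k * toL2 (s' θ₀) k) -
      (q k * score p θ₀ k - score p θ₀ k * p θ₀ k)‖ ≤ |score p θ₀ k| *
        min |q k - p θ₀ k| ((q k - p θ₀ k) ^ 2 / p θ₀ k) := fun k => by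
    have : (sqrtL2 q - sqrtL2 (p θ₀)) k = sqrtL2 q k - sqrtL2 (p θ₀) k := rfl
    rw [this, sqrtL2_apply hq.1, sqrtL2_apply hp₀, h.deriv_apply hp hθ₀, Real.norm_eq_abs]
    rcases eq_or_ne (p θ₀ k) 0 with h0 | h0
    · simp [IsFamily.score_eq_zero h0]
    · have hpos := hp.pos (interior_subset hθ₀) (interior_subset hθ₀) h0
      have : 4 * ((√(q k) - √(p θ₀ k)) * (score p θ₀ k * √(p θ₀ k) / 2)) -
          (q k * score p θ₀ k - score p θ₀ k * p θ₀ k) =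
          -(score p θ₀ k * (√(q k) - √(p θ₀ k)) ^ 2) := by
        linear_combination score p θ₀ k * Real.sq_sqrt (hq.1.1 k) -
          score p θ₀ k * Real.sq_sqrt hpos.le
      rw [this, abs_neg, abs_mul, abs_of_nonneg (sq_nonneg (√(q k) - √(p θ₀ k)))]
      exact mul_le_mul_of_nonneg_left (le_min (sq_sqrt_sub_sqrt_le (hq.1.1 k) hpos.le)
        (sq_sqrt_sub_sqrt_le_div (hq.1.1 k) hpos)) (abs_nonneg _)
  have hs' := hr.of_nonneg_of_le (fun _ => norm_nonneg _) hle
  have h2 := norm_tsum_le_tsum_norm hs'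
  rw [Real.norm_eq_abs] at h2
  exact h2.trans (Summable.tsum_le_tsum hle hs' hr)

end

/-! ### Linearisation of minimum Hellinger distance functionals -/

section
variable {p : ℝ → ℕ → ℝ} {Θ : Set ℝ} {θ₀ : ℝ} {s' s'' : ℝ → ℕ → ℝ}

lemma TwiceL2Diff.fisherInfo_eq (hp : IsFamily p Θ) (h : TwiceL2Diff p Θ s' s'')
    (hθ₀ : θ₀ ∈ interior Θ) :
    fisherInfo p θ₀ = -(4 * inner ℝ (sqrtL2 (p θ₀)) (toL2 (s'' θ₀))) := by
  rw [h.inner_deriv_eq hp hθ₀, fisherInfo, (h.hasSum_fisherInfo hp hθ₀).tsum_eq]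
  ring

lemma TwiceL2Diff.fisherInfo_pos (hp : IsFamily p Θ) (h : TwiceL2Diff p Θ s' s'')
    (hθ₀ : θ₀ ∈ interior Θ) (hneg : ∑' k, s'' θ₀ k * √(p θ₀ k) < 0) : 0 < fisherInfo p θ₀ := by
  have h1 := (L2Seq.hasSum_inner (sqrtL2 (p θ₀)) (toL2 (s'' θ₀))).tsum_eq
  simp only [sqrtL2_apply (hp.isProb _ (interior_subset hθ₀)), toL2_apply (h θ₀ hθ₀).2.1] at h1
  rw [h.fisherInfo_eq hp hθ₀, ← h1]
  simp only [mul_comm (√_)]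
  linarith

/-- At an interior minimiser `√q - s(θ)` is orthogonal to the tangent `s'(θ)`, and `s(θ)` itself is
orthogonal to it. -/
lemma inner_sqrtL2_deriv_eq_zero (hp : IsFamily p Θ) (h : TwiceL2Diff p Θ s' s'')
    (hθ₀ : θ₀ ∈ Θ) {q : ℕ → ℝ} (hq : q ∈ finiteLaws (p θ₀)) {θ : ℝ} (hθ : θ ∈ interior Θ)
    (hmin : IsArgmin hellinger p Θ q θ) : inner ℝ (sqrtL2 q) (toL2 (s' θ)) = 0 := by
  have hd := (h.hasDerivAt_sqrtL2 hp hθ).const_sub (sqrtL2 q)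
  have h1 := hd.inner ℝ hd
  have hc : disparity hellinger p q =ᶠ[𝓝 θ] fun t =>
      inner ℝ (sqrtL2 q - sqrtL2 (p t)) (sqrtL2 q - sqrtL2 (p t)) := by
    filter_upwards [isOpen_interior.mem_nhds hθ] with t ht
    rw [real_inner_self_eq_norm_sq,
      disparity_hellinger hp hθ₀ hq.1 hq.2.2 (interior_subset ht)]
  have h2 := (hmin.2.isLocalMin (mem_interior_iff_mem_nhds.1 hθ)).hasDerivAt_eq_zero
    (h1.congr_of_eventuallyEq hc)
  have h3 := h.inner_eq_zero hp hθ
  simp only [inner_neg_right, inner_neg_left, inner_sub_left, inner_sub_right] at h2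
  rw [real_inner_comm (sqrtL2 q) (toL2 (s' θ)), real_inner_comm (sqrtL2 (p θ)) (toL2 (s' θ))] at h2
  linarith [real_inner_comm (sqrtL2 q) (toL2 (s' θ)), real_inner_comm (sqrtL2 (p θ)) (toL2 (s' θ))]

/-- Minimum Hellinger distance functionals are approximately linear, with the influence function of
the maximum likelihood functional. -/
theorem approxLinear_hellinger (hp : IsFamily p Θ) {C : Set ℝ} (hC : IsCompact C) (hCΘ : C ⊆ Θ)
    (hcont : ∀ k, ContinuousOn (fun θ => p θ k) C) (hθ₀ : θ₀ ∈ interior Θ)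
    (hΓ : p θ₀ ∈ GammaHat hellinger p Θ C) {T : (ℕ → ℝ) → ℝ}
    (hT : IsDisparityFunctional hellinger p Θ T) (h : TwiceL2Diff p Θ s' s'')
    (hI : 0 < fisherInfo p θ₀) :
    ApproxLinear T (p θ₀) (score p θ₀) (fisherInfo p θ₀) θ₀ := by
  have hθ := interior_subset hθ₀
  have hp₀ := hp.isProb θ₀ hθ
  obtain ⟨hTlim, hTmin⟩ := disparityFunctional_consistent continuousOn_hellinger hellinger_zero
    hp hC hCΘ hcont hθ (tendstoUniformlyOn_disparity_hellinger hp hθ)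
    (fun θ hθ' => by
      rw [disparity_hellinger hp hθ hp₀ (fun _ h => h) hθ']; positivity) hΓ hT
  refine ⟨2 / fisherInfo p θ₀, by positivity, fun ε hε => ?_⟩
  obtain ⟨η, hη, hsol⟩ := approx_solution hI hε
  have hlin : Tendsto (fun q => ‖sqrtL2 q - sqrtL2 (p θ₀)‖ * ‖toL2 (s'' θ₀)‖)
      (𝓝[finiteLaws (p θ₀)] (p θ₀)) (𝓝 0) := by
    simpa using (tendsto_sqrtL2 hp₀).mul_const ‖toL2 (s'' θ₀)‖
  have hder := (hasDerivAt_iff_isLittleO.1 (h.hasDerivAt_deriv hθ₀)).def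
    (show (0 : ℝ) < η / 8 by positivity)
  filter_upwards [eventually_finiteLaws (p θ₀), hTmin, hTlim.eventually hder,
    hTlim.eventually (isOpen_interior.mem_nhds hθ₀),
    hlin.eventually_lt_const (show (0 : ℝ) < η / 8 by positivity)] with q hqE hqmin hqd hqi hql
  set x := T q - θ₀ with hx
  set ρ := toL2 (s' (T q)) - toL2 (s' θ₀) - x • toL2 (s'' θ₀) with hρ
  have hzero := inner_sqrtL2_deriv_eq_zero hp h hθ hqE hqi hqmin
  have hexp : inner ℝ (sqrtL2 q) (toL2 (s' θ₀)) + x * inner ℝ (sqrtL2 q) (toL2 (s'' θ₀)) +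
      inner ℝ (sqrtL2 q) ρ = 0 := by
    rw [hρ, inner_sub_right, inner_sub_right, hzero, real_inner_smul_right]
    ring
  have hrem : |inner ℝ (sqrtL2 q) ρ| ≤ η / 8 * |x| := by
    have := abs_real_inner_le_norm (sqrtL2 q) ρ
    rw [norm_sqrtL2 hqE.1, one_mul] at this
    exact this.trans hqd
  have hsec : |inner ℝ (sqrtL2 q) (toL2 (s'' θ₀)) -
      inner ℝ (sqrtL2 (p θ₀)) (toL2 (s'' θ₀))| ≤ η / 8 := by
    rw [← inner_sub_left]
    exact (abs_real_inner_le_norm _ _).trans hql.le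
  have happ := h.inner_sqrtL2_approx hp hθ₀ hqE
  have hIeq := h.fisherInfo_eq hp hθ₀
  have key : |x - (∑' k, q k * score p θ₀ k) / fisherInfo p θ₀| ≤
      ε * |∑' k, q k * score p θ₀ k| + 2 / fisherInfo p θ₀ *
        |4 * inner ℝ (sqrtL2 q) (toL2 (s' θ₀)) - ∑' k, q k * score p θ₀ k| := by
    -- The Taylor error is absorbed into the slope by dividing by `x`. If `x = 0` that error
    -- vanishes and any slope close to the information serves.
    rcases eq_or_ne x 0 with hx0 | hx0
    · refine hsol (fisherInfo p θ₀) _ _ _ (by simpa using hη.le) ?_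
      rw [hx0] at hrem hexp ⊢
      rw [abs_zero, mul_zero] at hrem
      have := abs_nonpos_iff.1 hrem
      linarith
    -- Its distance to the information is at most `4 (η / 8 + η / 8) = η`.
    · refine hsol (-(4 * (inner ℝ (sqrtL2 q) (toL2 (s'' θ₀)) + inner ℝ (sqrtL2 q) ρ / x)))
        _ _ _ ?_ ?_
      · have h1 : |inner ℝ (sqrtL2 q) ρ / x| ≤ η / 8 := by
          rwa [abs_div, div_le_iff₀ (abs_pos.2 hx0)]
        rw [hIeq, abs_le]
        rw [abs_le] at h1 hsec
        constructor <;> linarith [h1.1, h1.2, hsec.1, hsec.2]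
      · have : x * (inner ℝ (sqrtL2 q) ρ / x) = inner ℝ (sqrtL2 q) ρ := by field_simp
        linear_combination (-4) * hexp + (-4) * this
  refine key.trans (add_le_add le_rfl ?_)
  exact mul_le_mul_of_nonneg_left happ (by positivity)

/-! ### The remainder for families that are twice differentiable in `ℓ²` -/

/-- For `k > η y`, the factor `y²` in `y³ a` is paid for by `k² / η²`; for the other `k` the bound
`1` is used. -/
lemma min_mul_one_le {a y η : ℝ} (ha : 0 ≤ a) (hy : 0 < y) (hη : 0 < η) (k : ℕ) :
    min (y ^ 3 * a) 1 ≤ (if (k : ℝ) ≤ η * y then 1 else 0) +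
      y / η ^ 2 * (if (k : ℝ) ≤ η * y then 0 else (k : ℝ) ^ 2 * a) := by
  split_ifs with h
  · simp
  · rw [not_le] at h
    refine (min_le_left _ _).trans ?_
    have h1 : (η * y) ^ 2 ≤ (k : ℝ) ^ 2 := by gcongr
    rw [zero_add, div_mul_eq_mul_div, le_div_iff₀ (by positivity)]
    calc y ^ 3 * a * η ^ 2 = y * ((η * y) ^ 2 * a) := by ring
      _ ≤ y * ((k : ℝ) ^ 2 * a) := by gcongr

lemma summable_min_one {a : ℕ → ℝ} (ha : ∀ k, 0 ≤ a k) (hs : Summable a) {c : ℝ} (hc : 0 ≤ c) :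
    Summable fun k => min (c * a k) 1 :=
  (hs.mul_left c).of_nonneg_of_le (fun k => le_min (mul_nonneg hc (ha k)) zero_le_one)
    fun _ => min_le_left _ _

/-- The indices up to `η y` contribute at most `η + 1 / y`, the others `η⁻²` times a tail of the
second moment. This is where finite offspring variance enters the Hellinger case. -/
lemma tendsto_inv_mul_tsum_min {p₀ : ℕ → ℝ} (h₀ : IsProb p₀)
    (h2 : Summable fun k : ℕ => (k : ℝ) ^ 2 * p₀ k) :
    Tendsto (fun y : ℝ => y⁻¹ * ∑' k, min (y ^ 3 * p₀ k) 1) atTop (𝓝 0) := by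
  have htail : ∀ η > 0, Tendsto (fun y : ℝ => ∑' k : ℕ,
      if (k : ℝ) ≤ η * y then 0 else (k : ℝ) ^ 2 * p₀ k) atTop (𝓝 0) := fun η hη => by
    suffices h : Tendsto (fun y : ℝ => ∑' k : ℕ, if (k : ℝ) ≤ η * y then 0 else (k : ℝ) ^ 2 * p₀ k)
        atTop (𝓝 (∑' _ : ℕ, (0 : ℝ))) by
      rwa [tsum_zero] at h
    refine tendsto_tsum_of_dominated_convergence h2 (fun k => ?_) ?_
    · refine tendsto_const_nhds.congr' ?_
      filter_upwards [eventually_ge_atTop ((k : ℝ) / η)] with y hy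
      rw [if_pos (by rw [div_le_iff₀ hη] at hy; linarith)]
    · filter_upwards with y k
      have := h₀.1 k
      split_ifs
      · rw [norm_zero]; positivity
      · rw [Real.norm_of_nonneg (by positivity)]
  have hbound : ∀ η > 0, ∀ y > 0, y⁻¹ * ∑' k, min (y ^ 3 * p₀ k) 1 ≤ η + y⁻¹ +
      (η ^ 2)⁻¹ * ∑' k : ℕ, (if (k : ℝ) ≤ η * y then 0 else (k : ℝ) ^ 2 * p₀ k) := by
    intro η hη y hy
    have hs1 : HasSum (fun k : ℕ => if (k : ℝ) ≤ η * y then (1 : ℝ) else 0)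
        (∑ k ∈ Finset.range (⌊η * y⌋₊ + 1), if (k : ℝ) ≤ η * y then (1 : ℝ) else 0) := by
      refine hasSum_sum_of_ne_finset_zero fun k hk => if_neg fun h => hk ?_
      rw [Finset.mem_range]
      exact Nat.lt_succ_of_le (Nat.le_floor h)
    have hs2 : Summable fun k : ℕ => if (k : ℝ) ≤ η * y then 0 else (k : ℝ) ^ 2 * p₀ k := by
      refine h2.of_nonneg_of_le (fun k => ?_) fun k => ?_
      · have := h₀.1 k
        split_ifs <;> positivity
      · have := h₀.1 k
        split_ifs
        · positivity
        · exact le_rfl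
    have hcard : (∑ k ∈ Finset.range (⌊η * y⌋₊ + 1), if (k : ℝ) ≤ η * y then (1 : ℝ) else 0) ≤
        η * y + 1 := by
      refine (Finset.sum_le_card_nsmul _ _ 1 fun k _ => by split_ifs <;> norm_num).trans ?_
      simp only [Finset.card_range, nsmul_eq_mul, mul_one]
      push_cast
      linarith [Nat.floor_le (by positivity : 0 ≤ η * y)]
    have h3 := hasSum_le (fun k => min_mul_one_le (h₀.1 k) hy hη k)
      (summable_min_one h₀.1 h₀.2.summable (by positivity : 0 ≤ y ^ 3)).hasSum
      (hs1.add (hs2.hasSum.mul_left (y / η ^ 2)))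
    calc y⁻¹ * ∑' k, min (y ^ 3 * p₀ k) 1
        ≤ y⁻¹ * ((η * y + 1) + y / η ^ 2 *
          ∑' k : ℕ, (if (k : ℝ) ≤ η * y then 0 else (k : ℝ) ^ 2 * p₀ k)) := by
          gcongr
          exact h3.trans (by gcongr)
      _ = _ := by field_simp
  refine tendsto_order.2 ⟨fun a ha => ?_, fun a ha => ?_⟩
  · filter_upwards [eventually_gt_atTop 0] with y hy
    refine lt_of_lt_of_le ha (mul_nonneg (by positivity) (tsum_nonneg fun k => ?_))
    have := h₀.1 k
    positivity
  · have h3 := ((tendsto_const_nhds (x := a / 2)).add tendsto_inv_atTop_zero).add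
      ((htail (a / 2) (by positivity)).const_mul ((a / 2) ^ 2)⁻¹)
    rw [add_zero, mul_zero, add_zero] at h3
    filter_upwards [h3.eventually_lt_const (by linarith : a / 2 < a), eventually_gt_atTop 0]
      with y hy hy0
    exact (hbound (a / 2) (by positivity) y hy0).trans_lt hy

/-- Differentiability of `s'` at the single point `θ₀` gives `‖s'(t) - s'(θ₀)‖ ≤ c |t - θ₀|`; the
mean value inequality turns this into a second order bound. -/
lemma TwiceL2Diff.norm_taylor_le (hp : IsFamily p Θ) (h : TwiceL2Diff p Θ s' s'')
    (hθ₀ : θ₀ ∈ interior Θ) : ∃ c : ℝ, 0 ≤ c ∧ ∃ r > 0, ∀ β, |β| < r → θ₀ + β ∈ Θ ∧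
      ‖sqrtL2 (p (θ₀ + β)) - sqrtL2 (p θ₀) - β • toL2 (s' θ₀)‖ ≤ c * β ^ 2 := by
  obtain ⟨c, hc0, hc⟩ := (h.hasDerivAt_deriv hθ₀).isBigO_sub.exists_pos
  obtain ⟨r, hr, hball⟩ := Metric.eventually_nhds_iff_ball.1
    (hc.bound.and (isOpen_interior.mem_nhds hθ₀))
  refine ⟨c, hc0.le, r, hr, fun β hβ => ?_⟩
  have hin : ∀ t ∈ uIcc θ₀ (θ₀ + β), t ∈ Metric.ball θ₀ r ∧ |t - θ₀| ≤ |β| := fun t ht => by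
    have := abs_sub_left_of_mem_uIcc ht
    rw [add_sub_cancel_left] at this
    exact ⟨by rw [Metric.mem_ball, Real.dist_eq]; linarith, this⟩
  refine ⟨interior_subset (hball _ (hin _ right_mem_uIcc).1).2, ?_⟩
  have hd : ∀ t ∈ uIcc θ₀ (θ₀ + β), HasDerivWithinAt
      (fun t => sqrtL2 (p t) - (t - θ₀) • toL2 (s' θ₀)) (toL2 (s' t) - toL2 (s' θ₀))
      (uIcc θ₀ (θ₀ + β)) t := fun t ht => by
    have h1 := (h.hasDerivAt_sqrtL2 hp (hball t (hin t ht).1).2).sub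
      (((hasDerivAt_id t).sub_const θ₀).smul_const (toL2 (s' θ₀)))
    rw [one_smul] at h1
    exact h1.hasDerivWithinAt
  have h2 := (convex_uIcc θ₀ (θ₀ + β)).norm_image_sub_le_of_norm_hasDerivWithin_le
    (C := c * |β|) hd (fun t ht => ((hball t (hin t ht).1).1).trans
      (mul_le_mul_of_nonneg_left (hin t ht).2 hc0.le)) left_mem_uIcc right_mem_uIcc
  simp only [add_sub_cancel_left, sub_self, zero_smul, sub_zero] at h2
  rw [Real.norm_eq_abs, mul_assoc, abs_mul_abs_self, ← sq] at h2
  rwa [sub_right_comm]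

/-- The square root family being nonnegative, its first derivative is small where the family is. -/
lemma TwiceL2Diff.exists_deriv_bound (hp : IsFamily p Θ) (h : TwiceL2Diff p Θ s' s'')
    (hθ₀ : θ₀ ∈ interior Θ) : ∃ c : ℝ, 0 ≤ c ∧ ∃ r > 0, ∀ β, 0 < β → β < r →
      ∃ g₁ g₂ : L2Seq, ‖g₁‖ ≤ c * β ∧ ‖g₂‖ ≤ c * β ∧
        ∀ k, |toL2 (s' θ₀) k| ≤ √(p θ₀ k) / β + (|g₁ k| + |g₂ k|) := by
  obtain ⟨c, hc0, r, hr, hT⟩ := h.norm_taylor_le hp hθ₀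
  have hp₀ := hp.isProb θ₀ (interior_subset hθ₀)
  refine ⟨c, hc0, r, hr, fun β hβ hβr => ?_⟩
  have h1 := hT β (by rwa [abs_of_pos hβ])
  have h2 := hT (-β) (by rwa [abs_neg, abs_of_pos hβ])
  refine ⟨β⁻¹ • (sqrtL2 (p (θ₀ + β)) - sqrtL2 (p θ₀) - β • toL2 (s' θ₀)),
    β⁻¹ • (sqrtL2 (p (θ₀ + -β)) - sqrtL2 (p θ₀) - (-β) • toL2 (s' θ₀)), ?_, ?_, fun k => ?_⟩
  · rw [norm_smul, norm_inv, Real.norm_of_nonneg hβ.le, inv_mul_le_iff₀ hβ]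
    exact h1.2.trans_eq (by ring)
  · rw [norm_smul, norm_inv, Real.norm_of_nonneg hβ.le, inv_mul_le_iff₀ hβ]
    exact h2.2.trans_eq (by ring)
  · have e1 : (β⁻¹ • (sqrtL2 (p (θ₀ + β)) - sqrtL2 (p θ₀) - β • toL2 (s' θ₀))) k =
      β⁻¹ * (sqrtL2 (p (θ₀ + β)) k - sqrtL2 (p θ₀) k - β * toL2 (s' θ₀) k) := rfl
    have e2 : (β⁻¹ • (sqrtL2 (p (θ₀ + -β)) - sqrtL2 (p θ₀) - (-β) • toL2 (s' θ₀))) k =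
      β⁻¹ * (sqrtL2 (p (θ₀ + -β)) k - sqrtL2 (p θ₀) k - (-β) * toL2 (s' θ₀) k) := rfl
    rw [e1, e2, sqrtL2_apply hp₀, sqrtL2_apply (hp.isProb _ h1.1),
      sqrtL2_apply (hp.isProb _ h2.1), abs_mul, abs_mul, abs_of_pos (inv_pos.2 hβ)]
    set a := √(p (θ₀ + β) k)
    set b := √(p (θ₀ + -β) k)
    set s := √(p θ₀ k)
    set d := toL2 (s' θ₀) k
    have ha : 0 ≤ a := Real.sqrt_nonneg _
    have hb : 0 ≤ b := Real.sqrt_nonneg _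
    -- Nonnegativity of `s(θ₀ + β)` bounds `-β d`, that of `s(θ₀ - β)` bounds `β d`, each by `s`
    -- plus a Taylor error.
    have h3 : β * |d| ≤ s + (|a - s - β * d| + |b - s - -β * d|) := by
      rw [← abs_of_pos hβ, ← abs_mul, abs_of_pos hβ, abs_le]
      constructor
      · linarith [le_abs_self (a - s - β * d), abs_nonneg (b - s - -β * d)]
      · linarith [le_abs_self (b - s - -β * d), abs_nonneg (a - s - β * d)]
    rw [← mul_le_mul_iff_right₀ hβ]
    refine h3.trans_eq ?_
    field_simp

/-- Put `M y = y⁻¹ ∑ min(y³ p_k, 1)`, which tends to `0`. With `x = y^{3/2}` and `β = y^{-1/2}`, the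
part `s / β` of the bound on `s'` contributes `M y`. By Cauchy–Schwarz the two `ℓ²` errors of size
`c β` contribute at most `2 c √(M y)`. -/
lemma TwiceL2Diff.negligibleRemainder (hp : IsFamily p Θ) (h : TwiceL2Diff p Θ s' s'')
    (hθ₀ : θ₀ ∈ interior Θ) (h2 : Summable fun k : ℕ => (k : ℝ) ^ 2 * p θ₀ k) :
    NegligibleRemainder (p θ₀) (score p θ₀) := by
  have hp₀ := hp.isProb θ₀ (interior_subset hθ₀)
  obtain ⟨c, hc0, r, hr, hbd⟩ := h.exists_deriv_bound hp hθ₀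
  set M : ℝ → ℝ := fun y => y⁻¹ * ∑' k, min (y ^ 3 * p θ₀ k) 1 with hM
  have hMlim := tendsto_inv_mul_tsum_min hp₀ h2
  have hlim : Tendsto (fun y => 2 * (M y + 2 * c * √(M y))) atTop (𝓝 0) := by
    have := (hMlim.add (hMlim.sqrt.const_mul (2 * c))).const_mul 2
    simpa using this
  have hlim2 := hlim.comp (tendsto_rpow_atTop (show (0 : ℝ) < 2 / 3 by norm_num))
  refine squeeze_zero' ?_ ?_ hlim2
  · filter_upwards [eventually_gt_atTop 0] with x hx
    refine tsum_nonneg fun k => ?_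
    have := hp₀.1 k
    positivity
  have hsmall : ∀ᶠ y : ℝ in atTop, √y⁻¹ < r := by
    have := tendsto_inv_atTop_zero (𝕜 := ℝ).sqrt
    rw [Real.sqrt_zero] at this
    exact this.eventually_lt_const hr
  filter_upwards [eventually_gt_atTop 0,
    (tendsto_rpow_atTop (show (0 : ℝ) < 2 / 3 by norm_num)).eventually hsmall] with x hx hβr
  simp only [Function.comp_apply]
  set y : ℝ := x ^ (2 / 3 : ℝ) with hy
  have hy0 : 0 < y := Real.rpow_pos_of_pos hx _
  have hyx : y ^ 3 = x ^ 2 := by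
    rw [hy, ← Real.rpow_natCast, ← Real.rpow_mul hx.le]
    norm_num
  set β := √y⁻¹ with hβ
  have hβ0 : 0 < β := Real.sqrt_pos.2 (by positivity)
  have hβ2 : β ^ 2 = y⁻¹ := Real.sq_sqrt (by positivity)
  have hβx : β * x = y := by
    have : (β * x) ^ 2 = y ^ 2 := by
      rw [mul_pow, hβ2, ← hyx]; field_simp
    exact (sq_eq_sq₀ (by positivity) hy0.le).1 this
  obtain ⟨g₁, g₂, hg₁, hg₂, hle⟩ := hbd β hβ0 hβr
  set m : ℕ → ℝ := fun k => min (x * √(p θ₀ k)) (1 / (x * √(p θ₀ k))) with hm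
  have hm0 : ∀ k, 0 ≤ m k := fun k => by positivity
  have hm1 : ∀ k, x * √(p θ₀ k) * m k ≤ min (y ^ 3 * p θ₀ k) 1 := fun k => by
    have hs := Real.sqrt_nonneg (p θ₀ k)
    refine le_min ?_ ?_
    · refine (mul_le_mul_of_nonneg_left (min_le_left _ _) (by positivity)).trans_eq ?_
      rw [hyx]
      nth_rewrite 3 [← Real.sq_sqrt (hp₀.1 k)]
      ring
    · refine (mul_le_mul_of_nonneg_left (min_le_right _ _) (by positivity)).trans ?_
      rw [mul_one_div]
      exact div_self_le_one _
  have hm2 : ∀ k, m k ^ 2 ≤ min (y ^ 3 * p θ₀ k) 1 := fun k => by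
    refine le_trans ?_ (hm1 k)
    rw [sq]
    exact mul_le_mul_of_nonneg_right (min_le_left _ _) (hm0 k)
  have hsM := summable_min_one hp₀.1 hp₀.2.summable (by positivity : 0 ≤ y ^ 3)
  have hsm : Summable fun k => m k ^ 2 := hsM.of_nonneg_of_le (fun _ => sq_nonneg _) hm2
  obtain ⟨hs1, ht1⟩ := tsum_mul_le_norm_mul_sqrt g₁ hsm
  obtain ⟨hs2, ht2⟩ := tsum_mul_le_norm_mul_sqrt g₂ hsm
  have hterm : ∀ k, |score p θ₀ k| * min (x * p θ₀ k) (1 / x) ≤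
      2 * (y⁻¹ * min (y ^ 3 * p θ₀ k) 1 + (|g₁ k| * m k + |g₂ k| * m k)) := fun k => by
    rw [score_mul_min (hp₀.1 k) hx IsFamily.score_eq_zero, ← h.deriv_apply hp hθ₀, mul_assoc]
    refine mul_le_mul_of_nonneg_left ?_ two_pos.le
    refine (mul_le_mul_of_nonneg_right (hle k) (hm0 k)).trans ?_
    rw [add_mul, ← add_mul (|g₁ k|)]
    refine add_le_add ?_ le_rfl
    rw [← hβx, mul_inv, mul_assoc, div_mul_eq_mul_div, div_eq_inv_mul]
    refine mul_le_mul_of_nonneg_left ?_ (by positivity)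
    rw [le_inv_mul_iff₀ hx, ← mul_assoc, hβx]
    exact hm1 k
  have hsum := ((hsM.mul_left y⁻¹).add (hs1.add hs2)).mul_left 2
  have hsl := hsum.of_nonneg_of_le (fun k => by have := hp₀.1 k; positivity) hterm
  refine (hsl.tsum_le_tsum hterm hsum).trans ?_
  rw [tsum_mul_left, (hsM.mul_left y⁻¹).tsum_add (hs1.add hs2), hs1.tsum_add hs2, tsum_mul_left]
  refine mul_le_mul_of_nonneg_left (add_le_add le_rfl ?_) two_pos.le
  have hsq : β * √(∑' k, m k ^ 2) ≤ √(M y) := by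
    rw [hβ, ← Real.sqrt_mul (by positivity)]
    exact Real.sqrt_le_sqrt (mul_le_mul_of_nonneg_left (hsm.tsum_le_tsum hm2 hsM) (by positivity))
  calc _ ≤ c * β * √(∑' k, m k ^ 2) + c * β * √(∑' k, m k ^ 2) := by
        refine add_le_add (ht1.trans ?_) (ht2.trans ?_) <;> gcongr
    _ = 2 * c * (β * √(∑' k, m k ^ 2)) := by ring
    _ ≤ 2 * c * √(M y) := by gcongr

end

/-! ### Independence -/

section Indep
variable {Ω : Type*} [MeasurableSpace Ω] {P : Measure Ω}

/-- If `f` is independent of `(g, h)` and `g` of `h`, then `(f, g)` is independent of `h`. -/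
lemma indepFun_prodMk_left {α β γ : Type*} [MeasurableSpace α] [MeasurableSpace β]
    [MeasurableSpace γ] [IsProbabilityMeasure P] {f : Ω → α} {g : Ω → β} {h : Ω → γ}
    (hf : Measurable f) (hg : Measurable g) (hh : Measurable h)
    (h1 : IndepFun f (fun ω => (g ω, h ω)) P) (h2 : IndepFun g h P) :
    IndepFun (fun ω => (f ω, g ω)) h P := by
  have i1 : IsProbabilityMeasure (P.map f) := Measure.isProbabilityMeasure_map hf.aemeasurable
  have i2 : IsProbabilityMeasure (P.map g) := Measure.isProbabilityMeasure_map hg.aemeasurable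
  have i3 : IsProbabilityMeasure (P.map h) := Measure.isProbabilityMeasure_map hh.aemeasurable
  have hfg : IndepFun f g P := h1.comp measurable_id measurable_fst
  rw [indepFun_iff_map_prod_eq_prod_map_map (hf.prodMk hg).aemeasurable hh.aemeasurable,
    (indepFun_iff_map_prod_eq_prod_map_map hf.aemeasurable hg.aemeasurable).1 hfg]
  have e1 := (indepFun_iff_map_prod_eq_prod_map_map hf.aemeasurable
    (hg.prodMk hh).aemeasurable).1 h1
  rw [(indepFun_iff_map_prod_eq_prod_map_map hg.aemeasurable hh.aemeasurable).1 h2] at e1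
  rw [← MeasurableEquiv.prodAssoc.map_measurableEquiv_injective.eq_iff, Measure.prodAssoc_prod,
    ← e1, Measure.map_map MeasurableEquiv.prodAssoc.measurable ((hf.prodMk hg).prodMk hh)]
  rfl

/-- Fubini for the product law: the past may be frozen while a fresh generation is averaged. -/
lemma lintegral_indep {α β : Type*} [MeasurableSpace α] [MeasurableSpace β]
    [IsProbabilityMeasure P] {A : Ω → α} {B : Ω → β} (hA : Measurable A) (hB : Measurable B)
    (hAB : IndepFun A B P) {f : α × β → ENNReal} (hf : Measurable f) :
    ∫⁻ ω, f (A ω, B ω) ∂P = ∫⁻ ω, ∫⁻ ω', f (A ω, B ω') ∂P ∂P := by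
  have i1 : IsProbabilityMeasure (P.map A) := Measure.isProbabilityMeasure_map hA.aemeasurable
  have i2 : IsProbabilityMeasure (P.map B) := Measure.isProbabilityMeasure_map hB.aemeasurable
  rw [← lintegral_map hf (hA.prodMk hB),
    (indepFun_iff_map_prod_eq_prod_map_map hA.aemeasurable hB.aemeasurable).1 hAB,
    lintegral_prod _ hf.aemeasurable, lintegral_map hf.lintegral_prod_right' hA]
  refine lintegral_congr fun ω => ?_
  exact lintegral_map (f := fun y => f (A ω, y)) (hf.comp measurable_prodMk_left) hB

lemma integral_indep {α β : Type*} [MeasurableSpace α] [MeasurableSpace β]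
    [IsProbabilityMeasure P] {A : Ω → α} {B : Ω → β} (hA : Measurable A) (hB : Measurable B)
    (hAB : IndepFun A B P) {f : α × β → ℂ} (hf : Measurable f)
    (hi : Integrable (fun ω => f (A ω, B ω)) P) :
    ∫ ω, f (A ω, B ω) ∂P = ∫ ω, ∫ ω', f (A ω, B ω') ∂P ∂P := by
  have i1 : IsProbabilityMeasure (P.map A) := Measure.isProbabilityMeasure_map hA.aemeasurable
  have i2 : IsProbabilityMeasure (P.map B) := Measure.isProbabilityMeasure_map hB.aemeasurable
  have e := (indepFun_iff_map_prod_eq_prod_map_map hA.aemeasurable hB.aemeasurable).1 hAB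
  have hi' : Integrable f ((P.map A).prod (P.map B)) := by
    rw [← e]
    exact (integrable_map_measure hf.aestronglyMeasurable (hA.prodMk hB).aemeasurable).2 hi
  rw [← integral_map (f := f) (hA.prodMk hB).aemeasurable hf.aestronglyMeasurable, e,
    integral_prod _ hi', integral_map hA.aemeasurable
      hi'.integral_prod_left.aestronglyMeasurable]
  refine integral_congr_ae (Eventually.of_forall fun ω => ?_)
  exact integral_map hB.aemeasurable (hf.comp measurable_prodMk_left).aestronglyMeasurable

end Indep

lemma measurable_apply_nat {Ω β : Type*} {m : MeasurableSpace Ω} [MeasurableSpace β]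
    {f : ℕ → Ω → β} (hf : ∀ r, Measurable (f r)) {κ : Ω → ℕ} (hκ : Measurable κ) :
    Measurable fun ω => f (κ ω) ω :=
  (measurable_from_prod_countable_right (f := fun z : ℕ × Ω => f z.1 z.2) hf).comp
    (hκ.prodMk measurable_id)

/-! ### The history of a controlled branching process -/

section History
variable {Ω : Type*} {N : ℕ} {X φ : ℕ → ℕ → Ω → ℕ}

/-- The number of progenitors of generation `n`. -/
def progenitors (N : ℕ) (X φ : ℕ → ℕ → Ω → ℕ) (n : ℕ) (ω : Ω) : ℕ := φ n (Z N X φ n ω) ω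

/-- The sum over the progenitors of generation `n` of a function of their offspring numbers. -/
def genSum (N : ℕ) (X φ : ℕ → ℕ → Ω → ℕ) (h : ℕ → ℝ) (n : ℕ) (ω : Ω) : ℝ :=
  ∑ j ∈ Finset.range (progenitors N X φ n ω), h (X n j ω)

/-- All control variables. -/
def controls (φ : ℕ → ℕ → Ω → ℕ) (ω : Ω) (i : ℕ × ℕ) : ℕ := φ i.1 i.2 ω

/-- The offspring variables of the generations before `n`. -/
def pastOffspring (X : ℕ → ℕ → Ω → ℕ) (n : ℕ) (ω : Ω) (i : ℕ × ℕ) : ℕ :=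
  if i.1 < n then X i.1 i.2 ω else 0

/-- The σ-algebra generated by the control variables and the offspring variables of the generations
before `n`. -/
@[reducible] def history (X φ : ℕ → ℕ → Ω → ℕ) (n : ℕ) : MeasurableSpace Ω :=
  MeasurableSpace.comap (fun ω => (controls φ ω, pastOffspring X n ω)) inferInstance

lemma measurable_controls_history (n l k : ℕ) : Measurable[history X φ n] (φ l k) := by
  have h : Measurable fun z : (ℕ × ℕ → ℕ) × (ℕ × ℕ → ℕ) => z.1 (l, k) := by fun_prop
  exact h.comp (comap_measurable _)

lemma measurable_offspring_history {n l : ℕ} (hl : l < n) (j : ℕ) :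
    Measurable[history X φ n] (X l j) := by
  have h : Measurable fun z : (ℕ × ℕ → ℕ) × (ℕ × ℕ → ℕ) => z.2 (l, j) := by fun_prop
  have h2 := h.comp (comap_measurable (fun ω => (controls φ ω, pastOffspring X n ω)))
  have h3 : X l j = (fun z : (ℕ × ℕ → ℕ) × (ℕ × ℕ → ℕ) => z.2 (l, j)) ∘
      fun ω => (controls φ ω, pastOffspring X n ω) := by
    funext ω
    simp [pastOffspring, hl]
  rw [h3]
  exact h2

lemma history_mono : Monotone (history X φ) := by
  intro a b hab
  have h : (fun ω => (controls φ ω, pastOffspring X a ω)) =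
      (fun z : (ℕ × ℕ → ℕ) × (ℕ × ℕ → ℕ) =>
        (z.1, fun i : ℕ × ℕ => if i.1 < a then z.2 i else 0)) ∘
      fun ω => (controls φ ω, pastOffspring X b ω) := by
    funext ω
    simp only [Function.comp_apply, Prod.mk.injEq, true_and]
    funext i
    unfold pastOffspring
    split_ifs with h1 h2
    · rfl
    · omega
    · rfl
  have hm : Measurable (fun z : (ℕ × ℕ → ℕ) × (ℕ × ℕ → ℕ) =>
      (z.1, fun i : ℕ × ℕ => if i.1 < a then z.2 i else 0)) := by
    refine measurable_fst.prodMk (measurable_pi_iff.2 fun i => ?_)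
    split_ifs <;> fun_prop
  unfold history
  rw [h, ← MeasurableSpace.comap_comp]
  exact MeasurableSpace.comap_mono hm.comap_le

lemma measurable_Z_history (n : ℕ) : Measurable[history X φ n] (Z N X φ n) := by
  induction n with
  | zero => exact measurable_const
  | succ n ih =>
    have h1 : Measurable[history X φ (n + 1)] (Z N X φ n) :=
      ih.mono (history_mono n.le_succ) le_rfl
    have h2 : Measurable[history X φ (n + 1)] fun ω => φ n (Z N X φ n ω) ω :=
      measurable_apply_nat (fun r => measurable_controls_history (n + 1) n r) h1
    refine measurable_apply_nat (f := fun r ω => ∑ j ∈ Finset.range r, X n j ω) (fun r => ?_) h2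
    exact Finset.measurable_sum _ fun j _ => measurable_offspring_history n.lt_succ_self j

lemma measurable_progenitors_history {l n : ℕ} (hl : l ≤ n) :
    Measurable[history X φ n] (progenitors N X φ l) :=
  measurable_apply_nat (fun r => measurable_controls_history n l r)
    ((measurable_Z_history l).mono (history_mono hl) le_rfl)

lemma measurable_genSum_history (h : ℕ → ℝ) {l n : ℕ} (hl : l < n) :
    Measurable[history X φ n] (genSum N X φ h l) := by
  refine measurable_apply_nat (f := fun r ω => ∑ j ∈ Finset.range r, h (X l j ω)) (fun r => ?_)
    (measurable_progenitors_history hl.le)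
  exact Finset.measurable_sum _ fun j _ =>
    (measurable_of_countable h).comp (measurable_offspring_history hl j)

lemma measurable_totalProgenitors_history (n : ℕ) :
    Measurable[history X φ n] (totalProgenitors N X φ (n + 1)) :=
  Finset.measurable_sum _ fun _ hl =>
    measurable_progenitors_history (Nat.lt_succ_iff.1 (Finset.mem_range.1 hl))

variable [MeasurableSpace Ω] {P : Measure Ω} {q : ℕ → ℝ}

lemma IsCBP.measurable_history (h : IsCBP P q X φ) (n : ℕ) :
    Measurable fun ω => (controls φ ω, pastOffspring X n ω) := by
  refine (measurable_pi_iff.2 fun i : ℕ × ℕ => h.measurable_control i.1 i.2).prodMk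
    (measurable_pi_iff.2 fun i => ?_)
  unfold pastOffspring
  split_ifs
  · exact h.measurable_offspring _ _
  · exact measurable_const

lemma IsCBP.history_le (h : IsCBP P q X φ) (n : ℕ) : history X φ n ≤ ‹MeasurableSpace Ω› :=
  (h.measurable_history n).comap_le

lemma IsCBP.measurable_generation (h : IsCBP P q X φ) (n : ℕ) :
    Measurable fun ω (j : ℕ) => X n j ω :=
  measurable_pi_iff.2 fun j => h.measurable_offspring n j

lemma IsCBP.indepFun_pastOffspring (h : IsCBP P q X φ) (n : ℕ) :
    IndepFun (pastOffspring X n) (fun ω (j : ℕ) => X n j ω) P := by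
  have h1 := indep_iSup_of_disjoint (fun i : ℕ × ℕ => (h.measurable_offspring i.1 i.2).comap_le)
    h.offspring_indep.iIndep (S := {i | i.1 < n}) (T := {i | i.1 = n})
    (Set.disjoint_left.2 fun i (h1 : i.1 < n) (h2 : i.1 = n) => by omega)
  rw [IndepFun_iff_Indep]
  refine indep_of_indep_of_le h1 (Measurable.comap_le ?_) (Measurable.comap_le ?_)
  · refine (@measurable_pi_iff _ _ _ (_) _ _).2 fun i => ?_
    unfold pastOffspring
    split_ifs with hi
    · exact (comap_measurable (fun ω => X i.1 i.2 ω)).mono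
        (le_iSup₂_of_le (f := fun (i : ℕ × ℕ) (_ : i ∈ {i : ℕ × ℕ | i.1 < n}) =>
          MeasurableSpace.comap (fun ω => X i.1 i.2 ω) _) i hi le_rfl) le_rfl
    · exact measurable_const
  · refine (@measurable_pi_iff _ _ _ (_) _ _).2 fun j => ?_
    exact (comap_measurable (fun ω => X n j ω)).mono
        (le_iSup₂_of_le (f := fun (i : ℕ × ℕ) (_ : i ∈ {i : ℕ × ℕ | i.1 = n}) =>
          MeasurableSpace.comap (fun ω => X i.1 i.2 ω) _) (n, j) rfl le_rfl) le_rfl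

/-- The history contains all control variables, future ones included. It therefore determines how
many progenitors generation `n` has, yet remains independent of their offspring numbers. -/
lemma IsCBP.indepFun_history [IsProbabilityMeasure P] (h : IsCBP P q X φ) (n : ℕ) :
    IndepFun (fun ω => (controls φ ω, pastOffspring X n ω)) (fun ω (j : ℕ) => X n j ω) P := by
  have hc : Measurable (controls φ) := measurable_pi_iff.2 fun i => h.measurable_control i.1 i.2
  refine indepFun_prodMk_left hc (measurable_snd.comp (h.measurable_history n))
    (h.measurable_generation n) ?_ (h.indepFun_pastOffspring n)
  have hm : Measurable fun x : ℕ × ℕ → ℕ =>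
      ((fun i : ℕ × ℕ => if i.1 < n then x i else 0), fun j : ℕ => x (n, j)) := by
    refine Measurable.prodMk (measurable_pi_iff.2 fun i => ?_) (measurable_pi_iff.2 fun j => ?_)
    · split_ifs <;> fun_prop
    · fun_prop
  exact h.indep.symm.comp measurable_id hm

lemma IsCBP.indepFun_of_history [IsProbabilityMeasure P] (h : IsCBP P q X φ) {n : ℕ} {α : Type*}
    [MeasurableSpace α] {A : Ω → α} (hA : Measurable[history X φ n] A) :
    IndepFun A (fun ω (j : ℕ) => X n j ω) P := by
  have := h.indepFun_history n
  rw [IndepFun_iff_Indep] at this ⊢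
  exact indep_of_indep_of_le_left this hA.comap_le

/-! ### Moments of sums over a generation -/

lemma IsCBP.map_offspring [IsProbabilityMeasure P] (h : IsCBP P q X φ) (n j k : ℕ) :
    (P.map (X n j)).real {k} = q k := by
  rw [map_measureReal_apply (h.measurable_offspring n j) (MeasurableSet.singleton k)]
  exact h.offspring_law n j k

lemma IsCBP.nonneg (h : IsCBP P q X φ) (k : ℕ) : 0 ≤ q k :=
  h.offspring_law 0 0 k ▸ measureReal_nonneg

lemma IsCBP.integrable_offspring [IsProbabilityMeasure P] (h : IsCBP P q X φ) (n j : ℕ)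
    {f : ℕ → ℝ} (hf : Summable fun k => |f k| * q k) :
    Integrable (fun ω => f (X n j ω)) P ∧ ∫ ω, f (X n j ω) ∂P = ∑' k, f k * q k := by
  have hm := h.measurable_offspring n j
  have hfm : Measurable f := measurable_of_countable f
  have i1 : IsProbabilityMeasure (P.map (X n j)) := Measure.isProbabilityMeasure_map hm.aemeasurable
  have hi : Integrable f (P.map (X n j)) := by
    refine ⟨hfm.aestronglyMeasurable, ?_⟩
    rw [HasFiniteIntegral, lintegral_countable']
    have : ∀ k, ‖f k‖ₑ * (P.map (X n j)) {k} = ENNReal.ofReal (|f k| * q k) := fun k => by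
      rw [ENNReal.ofReal_mul (abs_nonneg _), ← h.map_offspring n j k, ofReal_measureReal,
        ← Real.norm_eq_abs, ofReal_norm]
    simp_rw [this]
    rw [← ENNReal.ofReal_tsum_of_nonneg (fun k => mul_nonneg (abs_nonneg _) (h.nonneg k)) hf]
    exact ENNReal.ofReal_lt_top
  refine ⟨(integrable_map_measure hfm.aestronglyMeasurable hm.aemeasurable).1 hi, ?_⟩
  have := integral_countable hi
  rw [integral_map hm.aemeasurable hfm.aestronglyMeasurable] at this
  rw [this]
  refine tsum_congr fun k => ?_
  rw [h.map_offspring, smul_eq_mul, mul_comm]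

/-- `f` is centered and has variance `v` under the law `q`. -/
structure Centered (q f : ℕ → ℝ) (v : ℝ) : Prop where
  isProb : IsProb q
  hasSum : HasSum (fun k => f k * q k) 0
  hasSum_sq : HasSum (fun k => f k ^ 2 * q k) v

lemma Centered.nonneg {q f : ℕ → ℝ} {v : ℝ} (hf : Centered q f v) : 0 ≤ v :=
  hf.hasSum_sq.nonneg fun k => mul_nonneg (sq_nonneg _) (hf.isProb.1 k)

lemma Centered.summable_abs {q f : ℕ → ℝ} {v : ℝ} (hf : Centered q f v) :
    Summable fun k => |f k| * q k :=
  summable_abs_mul_of_sq hf.isProb hf.hasSum_sq.summable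

lemma IsCBP.iIndepFun_generation (h : IsCBP P q X φ) (f : ℕ → ℝ) (n : ℕ) :
    iIndepFun (fun j ω => f (X n j ω)) P := by
  have h1 := h.offspring_indep.precomp (g := fun j : ℕ => (n, j)) (Prod.mk_right_injective n)
  exact h1.comp (fun _ => f) fun _ => measurable_of_countable f

variable [IsProbabilityMeasure P] {f : ℕ → ℝ} {v : ℝ}

lemma IsCBP.integral_eq_zero (h : IsCBP P q X φ) (hf : Centered q f v) (n j : ℕ) :
    ∫ ω, f (X n j ω) ∂P = 0 := by
  rw [(h.integrable_offspring n j hf.summable_abs).2, hf.hasSum.tsum_eq]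

lemma IsCBP.memLp_two (h : IsCBP P q X φ) (hf : Centered q f v) (n j : ℕ) :
    MemLp (fun ω => f (X n j ω)) 2 P := by
  have hm : Measurable fun ω => f (X n j ω) :=
    (measurable_of_countable f).comp (h.measurable_offspring n j)
  refine (memLp_two_iff_integrable_sq hm.aestronglyMeasurable).2
    (h.integrable_offspring n j (f := fun k => f k ^ 2) ?_).1
  simpa using hf.hasSum_sq.summable

lemma IsCBP.integral_sq (h : IsCBP P q X φ) (hf : Centered q f v) (n j : ℕ) :
    ∫ ω, f (X n j ω) ^ 2 ∂P = v := by
  rw [(h.integrable_offspring n j (f := fun k => f k ^ 2)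
    (by simpa using hf.hasSum_sq.summable)).2, hf.hasSum_sq.tsum_eq]

lemma IsCBP.lintegral_sq_sum (h : IsCBP P q X φ) (hf : Centered q f v) (n r : ℕ) :
    ∫⁻ ω, ENNReal.ofReal ((∑ j ∈ Finset.range r, f (X n j ω)) ^ 2) ∂P =
      ENNReal.ofReal (r * v) := by
  have hm := fun j => h.memLp_two hf n j
  have hsum : MemLp (fun ω => ∑ j ∈ Finset.range r, f (X n j ω)) 2 P :=
    memLp_finsetSum _ fun j _ => hm j
  have hvar := IndepFun.variance_sum (s := Finset.range r) (X := fun j ω => f (X n j ω))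
    (fun j _ => hm j) fun i _ j _ hij => (h.iIndepFun_generation f n).indepFun hij
  have h0 : ∫ ω, ∑ j ∈ Finset.range r, f (X n j ω) ∂P = 0 := by
    rw [integral_finsetSum _ fun j _ => (h.integrable_offspring n j hf.summable_abs).1]
    exact Finset.sum_eq_zero fun j _ => h.integral_eq_zero hf n j
  have heq : (∑ j ∈ Finset.range r, fun ω => f (X n j ω)) =
      fun ω => ∑ j ∈ Finset.range r, f (X n j ω) := by
    funext ω; simp
  rw [heq, variance_of_integral_eq_zero hsum.1.aemeasurable h0,
    Finset.sum_congr rfl fun j _ => by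
      rw [variance_of_integral_eq_zero (hm j).1.aemeasurable (h.integral_eq_zero hf n j),
        h.integral_sq hf n j]] at hvar
  rw [← ofReal_integral_eq_lintegral_ofReal hsum.integrable_sq
    (Eventually.of_forall fun ω => sq_nonneg _), hvar]
  simp

lemma IsCBP.measurable_sum_generation (f : ℕ → ℝ) :
    Measurable fun z : ℕ × (ℕ → ℕ) => ∑ j ∈ Finset.range z.1, f (z.2 j) := by
  refine measurable_from_prod_countable_right fun r => ?_
  exact Finset.measurable_sum (f := fun j (y : ℕ → ℕ) => f (y j)) (Finset.range r) fun j _ =>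
    (measurable_of_countable f).comp (measurable_pi_apply j)

/-- The second moment of a sum over a number of members of a generation that depends on the past. -/
lemma IsCBP.lintegral_sq_randomSum (h : IsCBP P q X φ) (hf : Centered q f v) {n : ℕ} {κ : Ω → ℕ}
    (hκ : Measurable[history X φ n] κ) (w : ℕ → ENNReal) :
    ∫⁻ ω, w (κ ω) * ENNReal.ofReal ((∑ j ∈ Finset.range (κ ω), f (X n j ω)) ^ 2) ∂P =
      ∫⁻ ω, w (κ ω) * ENNReal.ofReal (κ ω * v) ∂P := by
  have hm : Measurable fun z : ℕ × (ℕ → ℕ) =>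
      w z.1 * ENNReal.ofReal ((∑ j ∈ Finset.range z.1, f (z.2 j)) ^ 2) :=
    ((measurable_of_countable w).comp measurable_fst).mul
      ((IsCBP.measurable_sum_generation f).pow_const 2).ennreal_ofReal
  have := lintegral_indep (hκ.mono (h.history_le n) le_rfl) (h.measurable_generation n)
    (h.indepFun_of_history hκ) hm
  refine this.trans (lintegral_congr fun ω => ?_)
  dsimp only
  rw [lintegral_const_mul, h.lintegral_sq_sum hf]
  exact (Measurable.pow_const (Finset.measurable_sum _ fun j _ =>
    (measurable_of_countable f).comp (h.measurable_offspring n j)) 2).ennreal_ofReal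

/-- The first absolute moment of a sum over a number of members of a generation that depends on the
past. -/
lemma IsCBP.lintegral_abs_randomSum_le (h : IsCBP P q X φ) (hf : Summable fun k => |f k| * q k)
    {n : ℕ} {κ : Ω → ℕ} (hκ : Measurable[history X φ n] κ) :
    ∫⁻ ω, ENNReal.ofReal |∑ j ∈ Finset.range (κ ω), f (X n j ω)| ∂P ≤
      ∫⁻ ω, ENNReal.ofReal (κ ω * ∑' k, |f k| * q k) ∂P := by
  have hm : Measurable fun z : ℕ × (ℕ → ℕ) =>
      ENNReal.ofReal |∑ j ∈ Finset.range z.1, f (z.2 j)| :=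
    (continuous_abs.measurable.comp (IsCBP.measurable_sum_generation f)).ennreal_ofReal
  have := lintegral_indep (hκ.mono (h.history_le n) le_rfl) (h.measurable_generation n)
    (h.indepFun_of_history hκ) hm
  refine this.trans_le (lintegral_mono fun ω => ?_)
  dsimp only
  have hint : ∀ j, Integrable (fun ω => |f (X n j ω)|) P := fun j =>
    (h.integrable_offspring n j (f := fun k => |f k|) (by simpa using hf)).1
  have hle : ∀ ω', ENNReal.ofReal |∑ j ∈ Finset.range (κ ω), f (X n j ω')| ≤
      ENNReal.ofReal (∑ j ∈ Finset.range (κ ω), |f (X n j ω')|) := fun ω' =>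
    ENNReal.ofReal_le_ofReal (Finset.abs_sum_le_sum_abs _ _)
  refine (lintegral_mono hle).trans ?_
  rw [← ofReal_integral_eq_lintegral_ofReal (integrable_finsetSum _ fun j _ => hint j)
    (Eventually.of_forall fun ω => Finset.sum_nonneg fun _ _ => abs_nonneg _),
    integral_finsetSum _ fun j _ => hint j, Finset.sum_congr rfl fun j _ =>
      (h.integrable_offspring n j (f := fun k => |f k|) (by simpa using hf)).2]
  simp

end History

/-! ### Growth of sequences -/

lemma tendsto_natCast_succ_pow_div_pow {ρ : ℝ} (hρ : 1 < ρ) :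
    Tendsto (fun l : ℕ => ((l : ℝ) + 1) ^ 2 / ρ ^ (l + 1)) atTop (𝓝 0) := by
  have := (tendsto_pow_const_div_const_pow_of_one_lt 2 hρ).comp (tendsto_add_atTop_nat 1)
  refine this.congr fun l => ?_
  simp

/-- If `z_{l+1}` is `m r_l` up to an error of order `l √r_l` and `z_l` grows geometrically, then so
does `r_l`. -/
lemma tendsto_div_pow_of_approx {ρ m W : ℝ} (hρ : 1 < ρ) (hm : 0 < m) (hW : 0 < W)
    {z r : ℕ → ℕ} (hz : Tendsto (fun l => (z l : ℝ) / ρ ^ l) atTop (𝓝 W))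
    (h : ∀ᶠ l in atTop, |(z (l + 1) : ℝ) - m * r l| ≤ (l + 1) * √(r l)) :
    Tendsto (fun l => (r l : ℝ) / ρ ^ l) atTop (𝓝 (W * ρ / m)) := by
  have hz1 := hz.comp (tendsto_add_atTop_nat 1)
  have hρ0 : 0 < ρ := by linarith
  -- Otherwise `√(r l)` would be at most `(l + 1) / a` for arbitrarily large `l`, making `z (l + 1)`
  -- quadratic in `l` and contradicting geometric growth.
  have hsmall : Tendsto (fun l : ℕ => ((l : ℝ) + 1) / √(r l)) atTop (𝓝 0) := by
    refine tendsto_order.2 ⟨fun a ha => ?_, fun a ha => ?_⟩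
    · filter_upwards with l
      exact lt_of_lt_of_le ha (by positivity)
    · have h0 := (tendsto_natCast_succ_pow_div_pow hρ).const_mul (m * (a⁻¹ ^ 2) + a⁻¹)
      rw [mul_zero] at h0
      filter_upwards [h, h0.eventually_lt_const (half_pos hW),
        hz1.eventually_const_lt (half_lt_self hW)] with l h1 h2 h3
      simp only [Function.comp_apply] at h3
      by_contra hcon
      rw [not_lt] at hcon
      have hr0 : 0 < √(r l : ℝ) := by
        rcases (Real.sqrt_nonneg (r l : ℝ)).eq_or_lt with h0 | h0
        · rw [← h0, div_zero] at hcon; linarith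
        · exact h0
      rw [le_div_iff₀ hr0] at hcon
      have h4 : √(r l : ℝ) ≤ a⁻¹ * (l + 1) := by
        rw [inv_mul_eq_div, le_div_iff₀ ha]; linarith
      have h5 : (r l : ℝ) ≤ (a⁻¹ * (l + 1)) ^ 2 := by
        rw [← Real.sq_sqrt (Nat.cast_nonneg (r l))]; gcongr
      have h6 : (z (l + 1) : ℝ) ≤ (m * (a⁻¹ ^ 2) + a⁻¹) * ((l : ℝ) + 1) ^ 2 := by
        have := (abs_le.1 h1).2
        calc (z (l + 1) : ℝ) ≤ m * r l + (l + 1) * √(r l) := by linarith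
          _ ≤ m * (a⁻¹ * (l + 1)) ^ 2 + (l + 1) * (a⁻¹ * (l + 1)) := by gcongr
          _ = _ := by ring
      have h7 : (z (l + 1) : ℝ) / ρ ^ (l + 1) ≤
          (m * (a⁻¹ ^ 2) + a⁻¹) * (((l : ℝ) + 1) ^ 2 / ρ ^ (l + 1)) := by
        rw [← mul_div_assoc]; gcongr
      linarith
  have hpos : ∀ᶠ l in atTop, 0 < (r l : ℝ) := by
    filter_upwards [h, hz1.eventually_const_lt hW] with l h1 h2
    simp only [Function.comp_apply] at h2
    rcases (Nat.cast_nonneg (α := ℝ) (r l)).eq_or_lt with h0 | h0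
    · rw [← h0] at h1
      simp only [mul_zero, sub_zero, Real.sqrt_zero, abs_nonpos_iff] at h1
      rw [h1, zero_div] at h2
      exact absurd h2 (lt_irrefl _)
    · exact h0
  have hratio : Tendsto (fun l => (z (l + 1) : ℝ) / r l) atTop (𝓝 m) := by
    rw [tendsto_iff_norm_sub_tendsto_zero]
    refine squeeze_zero' (Eventually.of_forall fun _ => norm_nonneg _) ?_ hsmall
    filter_upwards [h, hpos] with l h1 h2
    rw [div_sub' h2.ne', Real.norm_eq_abs, abs_div, abs_of_pos h2, mul_comm (r l : ℝ) m,
      div_le_div_iff₀ h2 (Real.sqrt_pos.2 h2)]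
    calc _ ≤ ((l + 1) * √(r l : ℝ)) * √(r l : ℝ) := by gcongr
      _ = _ := by rw [mul_assoc, Real.mul_self_sqrt h2.le]
  have h2 := (hz1.mul_const ρ).div hratio hm.ne'
  refine h2.congr' ?_
  filter_upwards [hpos, hz1.eventually_const_lt hW] with l h3 h4
  simp only [Function.comp_apply, Pi.div_apply] at h4 ⊢
  have : (z (l + 1) : ℝ) ≠ 0 := by
    intro h0; rw [h0, zero_div] at h4; exact lt_irrefl _ h4
  field_simp
  ring

lemma tendsto_atTop_of_div_pow {ρ V : ℝ} (hρ : 1 < ρ) (hV : 0 < V) {r : ℕ → ℕ}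
    (hr : Tendsto (fun l => (r l : ℝ) / ρ ^ l) atTop (𝓝 V)) :
    Tendsto r atTop atTop := by
  have h1 := (tendsto_pow_atTop_atTop_of_one_lt hρ).atTop_mul_pos hV hr
  refine tendsto_natCast_atTop_iff.1 (h1.congr fun l => ?_)
  field_simp

lemma tendsto_succ_div_sqrt {ρ V : ℝ} (hρ : 1 < ρ) (hV : 0 < V) {r : ℕ → ℕ}
    (hr : Tendsto (fun l => (r l : ℝ) / ρ ^ l) atTop (𝓝 V)) :
    Tendsto (fun l : ℕ => ((l : ℝ) + 1) / √(r l)) atTop (𝓝 0) := by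
  have h1 := (((tendsto_natCast_succ_pow_div_pow hρ).mul_const ρ).div hr hV.ne').sqrt
  rw [zero_mul, zero_div, Real.sqrt_zero] at h1
  refine h1.congr fun l => ?_
  have hρ0 : 0 < ρ := by linarith
  simp only [Pi.div_apply]
  rw [pow_succ ρ l, div_mul_eq_mul_div, mul_div_mul_right _ _ hρ0.ne',
    div_div_div_cancel_right₀ (by positivity), Real.sqrt_div (by positivity),
    Real.sqrt_sq (by positivity)]

/-- The error `r l - V ρ^l` is `o(ρ^l)`, and summing preserves this because the geometric series
diverges. -/
lemma tendsto_sum_div_pow {ρ V : ℝ} (hρ : 1 < ρ) {r : ℕ → ℕ}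
    (hr : Tendsto (fun l => (r l : ℝ) / ρ ^ l) atTop (𝓝 V)) :
    Tendsto (fun n => ((∑ l ∈ Finset.range n, r l : ℕ) : ℝ) / ρ ^ n) atTop
      (𝓝 (V / (ρ - 1))) := by
  have hρ0 : 0 < ρ := by linarith
  have hρ1 : 0 < ρ - 1 := by linarith
  have h1 : (fun l => (r l : ℝ) - V * ρ ^ l) =o[atTop] fun l => ρ ^ l := by
    rw [Asymptotics.isLittleO_iff_tendsto fun l h0 => absurd h0 (pow_pos hρ0 l).ne']
    have := hr.sub_const V
    rw [sub_self] at this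
    refine this.congr fun l => ?_
    field_simp
  have hgeom : ∀ n, ∑ l ∈ Finset.range n, ρ ^ l = (ρ ^ n - 1) / (ρ - 1) := fun n =>
    geom_sum_eq hρ.ne' n
  have hatTop : Tendsto (fun n => ∑ l ∈ Finset.range n, ρ ^ l) atTop atTop := by
    simp_rw [hgeom]
    exact (tendsto_atTop_add_const_right _ (-1)
      (tendsto_pow_atTop_atTop_of_one_lt hρ)).atTop_div_const hρ1
  have h2 := h1.sum_range (fun l => by positivity) hatTop
  have hinv : Tendsto (fun n : ℕ => (ρ ^ n)⁻¹) atTop (𝓝 0) :=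
    tendsto_inv_atTop_zero.comp (tendsto_pow_atTop_atTop_of_one_lt hρ)
  have hg : Tendsto (fun n => (∑ l ∈ Finset.range n, ρ ^ l) / ρ ^ n) atTop (𝓝 (1 / (ρ - 1))) := by
    have h3 := (hinv.const_sub 1).div_const (ρ - 1)
    rw [sub_zero] at h3
    refine h3.congr fun n => ?_
    rw [hgeom]
    field_simp
  have h4 := h2.tendsto_div_nhds_zero.mul hg
  have h5 := h4.add (hg.const_mul V)
  rw [zero_mul, zero_add, mul_one_div] at h5
  refine h5.congr' ?_
  filter_upwards [hatTop.eventually_gt_atTop 0] with n hn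
  rw [Finset.sum_sub_distrib, ← Finset.mul_sum]
  push_cast
  field_simp
  ring

lemma tendsto_sum_div_sum {ρ V : ℝ} (hρ : 1 < ρ) (hV : 0 < V) {r : ℕ → ℕ}
    (hr : Tendsto (fun l => (r l : ℝ) / ρ ^ l) atTop (𝓝 V))
    {s : ℕ → ℝ} (hs : ∀ᶠ l in atTop, |s l| ≤ (l + 1) * √(r l)) :
    Tendsto (fun n => (∑ l ∈ Finset.range n, s l) / ((∑ l ∈ Finset.range n, r l : ℕ) : ℝ)) atTop
      (𝓝 0) := by
  have hr' := tendsto_atTop_of_div_pow hρ hV hr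
  have h1 : s =o[atTop] fun l => (r l : ℝ) := by
    rw [Asymptotics.isLittleO_iff_tendsto' ?_]
    · refine squeeze_zero_norm' ?_ (tendsto_succ_div_sqrt hρ hV hr)
      filter_upwards [hs, hr'.eventually_gt_atTop 0] with l h1 h2
      have h3 : 0 < (r l : ℝ) := by exact_mod_cast h2
      rw [norm_div, Real.norm_eq_abs, Real.norm_of_nonneg h3.le,
        div_le_div_iff₀ h3 (Real.sqrt_pos.2 h3)]
      calc _ ≤ ((l + 1) * √(r l : ℝ)) * √(r l : ℝ) := by gcongr
        _ = _ := by rw [mul_assoc, Real.mul_self_sqrt h3.le]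
    · filter_upwards [hr'.eventually_gt_atTop 0] with l h2 h0
      have h3 : 0 < (r l : ℝ) := by exact_mod_cast h2
      exact absurd h0 h3.ne'
  have hatTop : Tendsto (fun n => ∑ l ∈ Finset.range n, (r l : ℝ)) atTop atTop := by
    have := (tendsto_pow_atTop_atTop_of_one_lt hρ).atTop_mul_pos
      (div_pos hV (by linarith : 0 < ρ - 1)) (tendsto_sum_div_pow hρ hr)
    refine this.congr fun n => ?_
    push_cast
    have hρ0 : 0 < ρ := by linarith
    field_simp
  have h2 := (h1.sum_range (fun l => by positivity) hatTop).tendsto_div_nhds_zero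
  refine h2.congr fun n => ?_
  push_cast
  rfl

/-! ### Almost sure growth -/

lemma hasSum_of_eq {f g : ℕ → ℝ} {a b : ℝ} (h : HasSum f a) (hfg : ∀ k, f k = g k) (hab : a = b) :
    HasSum g b :=
  hab ▸ (funext hfg : f = g) ▸ h

lemma centered_sub_mean {q : ℕ → ℝ} (hq : IsProb q) (h2 : Summable fun k : ℕ => (k : ℝ) ^ 2 * q k) :
    ∃ v, Centered q (fun k => (k : ℝ) - ∑' i : ℕ, (i : ℝ) * q i) v := by
  have h1 : Summable fun k : ℕ => (k : ℝ) * q k := by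
    have := summable_abs_mul_of_sq (u := fun k : ℕ => (k : ℝ)) hq h2
    simpa using this
  set m := ∑' i : ℕ, (i : ℝ) * q i with hm
  refine ⟨_, hq, ?_, hasSum_of_eq ((h2.hasSum.sub (h1.hasSum.mul_left (2 * m))).add
    (hq.2.mul_left (m ^ 2))) (fun k => by ring) rfl⟩
  exact hasSum_of_eq (h1.hasSum.sub (hq.2.mul_left m)) (fun k => by ring) (by rw [mul_one, sub_self])

lemma centered_indicator {q : ℕ → ℝ} (hq : IsProb q) (k : ℕ) :
    Centered q (fun i => (if i = k then 1 else 0) - q k) (q k - q k ^ 2) := by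
  have h1 : HasSum (fun i => (if i = k then q k else 0)) (q k) := hasSum_ite_eq k (q k)
  refine ⟨hq, hasSum_of_eq (h1.sub (hq.2.mul_left (q k))) (fun i => ?_) (by ring),
    hasSum_of_eq ((h1.mul_left (1 - 2 * q k)).add (hq.2.mul_left (q k ^ 2))) (fun i => ?_) (by ring)⟩
  · split_ifs with h
    · subst h; ring
    · ring
  · split_ifs with h
    · subst h; ring
    · ring

section Growth
variable {Ω : Type*} {N : ℕ} {X φ : ℕ → ℕ → Ω → ℕ}

lemma genSum_sub_const (g : ℕ → ℝ) (c : ℝ) (l : ℕ) (ω : Ω) :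
    genSum N X φ (fun k => g k - c) l ω =
      genSum N X φ g l ω - c * progenitors N X φ l ω := by
  simp [genSum, Finset.sum_sub_distrib, mul_comm]

lemma genSum_natCast (l : ℕ) (ω : Ω) :
    genSum N X φ (fun k => (k : ℝ)) l ω = Z N X φ (l + 1) ω := by
  simp [genSum, Z, progenitors]

lemma genSum_indicator (k l : ℕ) (ω : Ω) :
    genSum N X φ (fun i => if i = k then 1 else 0) l ω = offspringCount N X φ l k ω := by
  simp [genSum, offspringCount, progenitors]

/-- Grouping progenitors by offspring number identifies the linear functional of the empirical law
with an average over individuals. -/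
lemma mle_mul (u : ℕ → ℝ) (n : ℕ) (ω : Ω) :
    HasSum (fun k => mle N X φ n ω k * u k)
      ((∑ l ∈ Finset.range n, genSum N X φ u l ω) / totalProgenitors N X φ n ω) := by
  have h1 : ∀ l, HasSum (fun k => (offspringCount N X φ l k ω : ℝ) * u k)
      (genSum N X φ u l ω) := fun l => by
    have : ∀ j ∈ Finset.range (progenitors N X φ l ω),
        HasSum (fun k => if k = X l j ω then u (X l j ω) else 0) (u (X l j ω)) := fun j _ =>
      hasSum_ite_eq _ _
    refine hasSum_of_eq (hasSum_sum this) (fun k => ?_) rfl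
    rw [offspringCount, Finset.card_filter]
    push_cast
    rw [Finset.sum_mul]
    refine Finset.sum_congr rfl fun j _ => ?_
    by_cases hk : k = X l j ω
    · simp [hk]
    · simp [hk, Ne.symm hk]
  have h2 := (hasSum_sum fun l (_ : l ∈ Finset.range n) => h1 l).div_const
    (totalProgenitors N X φ n ω : ℝ)
  refine hasSum_of_eq h2 (fun k => ?_) rfl
  rw [mle, ← Finset.sum_mul]
  push_cast
  ring

lemma mle_mem_finiteLaws {q : ℕ → ℝ} {n : ℕ} {ω : Ω} (h0 : 0 < totalProgenitors N X φ n ω)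
    (h : ∀ l j, q (X l j ω) ≠ 0) : mle N X φ n ω ∈ finiteLaws q := by
  have hpos : (0 : ℝ) < totalProgenitors N X φ n ω := by exact_mod_cast h0
  have h1 : ∀ k, mle N X φ n ω k ≠ 0 → ∃ l ∈ Finset.range n,
      ∃ j ∈ Finset.range (progenitors N X φ l ω), X l j ω = k := fun k hk => by
    by_contra! hcon
    refine hk ?_
    rw [mle, Finset.sum_eq_zero fun l hl => ?_, Nat.cast_zero, zero_div]
    rw [offspringCount, Finset.card_eq_zero, Finset.filter_eq_empty_iff]
    exact fun j hj => hcon l hl j hj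
  refine ⟨⟨fun k => by unfold mle; positivity, ?_⟩, ?_, fun k hk => ?_⟩
  · refine hasSum_of_eq (mle_mul (fun _ => 1) n ω) (fun k => mul_one _) ?_
    rw [div_eq_one_iff_eq hpos.ne']
    simp [genSum, totalProgenitors, progenitors]
  · refine ((Finset.range n).finite_toSet.biUnion fun l _ =>
      ((Finset.range (progenitors N X φ l ω)).finite_toSet.image fun j => X l j ω)).subset ?_
    intro k hk
    obtain ⟨l, hl, j, hj, hk⟩ := h1 k hk
    exact mem_iUnion₂.2 ⟨l, hl, j, hj, hk⟩
  · by_contra hcon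
    obtain ⟨l, -, j, -, rfl⟩ := h1 k hcon
    exact h l j hk

variable [MeasurableSpace Ω] {P : Measure Ω} {q : ℕ → ℝ}

lemma IsCBP.isProb [IsProbabilityMeasure P] (h : IsCBP P q X φ) : IsProb q := by
  refine ⟨h.nonneg, ?_⟩
  have hm := h.measurable_offspring 0 0
  have i1 : IsProbabilityMeasure (P.map (X 0 0)) := Measure.isProbabilityMeasure_map hm.aemeasurable
  have h1 : ∑' k, P.map (X 0 0) {k} = 1 := by
    have := lintegral_countable' (μ := P.map (X 0 0)) fun _ : ℕ => (1 : ENNReal)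
    simpa using this.symm
  have h2 := ENNReal.hasSum_toReal (f := fun k => P.map (X 0 0) {k}) (by simp [h1])
  rw [← ENNReal.tsum_toReal_eq fun k => measure_ne_top _ _, h1] at h2
  exact hasSum_of_eq h2 (fun k => h.map_offspring 0 0 k) rfl

lemma IsCBP.ae_ne_zero [IsProbabilityMeasure P] (h : IsCBP P q X φ) : ∀ᵐ ω ∂P, ∀ l j, q (X l j ω) ≠ 0 := by
  refine ae_all_iff.2 fun l => ae_all_iff.2 fun j => ?_
  have : ∀ k, q k = 0 → ∀ᵐ ω ∂P, X l j ω ≠ k := fun k hk => by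
    have h1 := h.offspring_law l j k
    rw [hk, measureReal_eq_zero_iff] at h1
    rw [ae_iff]
    simpa using h1
  have h2 := ae_all_iff.2 fun k => ae_all_iff.2 (this k)
  filter_upwards [h2] with ω h3 h4
  exact h3 _ h4 rfl

lemma IsCBP.measurable_progenitors (h : IsCBP P q X φ) (l : ℕ) :
    Measurable (progenitors N X φ l) :=
  (measurable_progenitors_history le_rfl).mono (h.history_le l) le_rfl

lemma IsCBP.measurable_genSum (h : IsCBP P q X φ) (f : ℕ → ℝ) (l : ℕ) :
    Measurable (genSum N X φ f l) :=
  (measurable_genSum_history f l.lt_succ_self).mono (h.history_le (l + 1)) le_rfl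

/-- The squares divided by `r_l (l + 1)²` have expectations at most `v / (l + 1)²`. Their sum is
thus almost surely finite, so the terms are eventually below `1`. No independence between
generations is used. -/
lemma IsCBP.ae_eventually_genSum_le [IsProbabilityMeasure P] (h : IsCBP P q X φ) {f : ℕ → ℝ} {v : ℝ} (hf : Centered q f v) :
    ∀ᵐ ω ∂P, ∀ᶠ l : ℕ in atTop,
      |genSum N X φ f l ω| ≤ (l + 1) * √(progenitors N X φ l ω : ℝ) := by
  -- In an empty generation the weight is `0⁻¹ = 0`, and so is the sum.
  set w : ℕ → ℕ → ENNReal := fun l r => ENNReal.ofReal (((r : ℝ) * ((l : ℝ) + 1) ^ 2)⁻¹) with hw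
  set F : ℕ → Ω → ENNReal := fun l ω =>
    w l (progenitors N X φ l ω) * ENNReal.ofReal (genSum N X φ f l ω ^ 2) with hF
  have hFm : ∀ l, Measurable (F l) := fun l =>
    ((measurable_of_countable (w l)).comp (h.measurable_progenitors l)).mul
      ((h.measurable_genSum f l).pow_const 2).ennreal_ofReal
  have hs : Summable fun l : ℕ => v * (((l : ℝ) + 1) ^ 2)⁻¹ := by
    have := (summable_nat_add_iff 1).2 (Real.summable_nat_pow_inv.2 one_lt_two)
    exact (by simpa using this : Summable fun l : ℕ => (((l : ℝ) + 1) ^ 2)⁻¹).mul_left v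
  have hle : ∀ l, ∫⁻ ω, F l ω ∂P ≤ ENNReal.ofReal (v * (((l : ℝ) + 1) ^ 2)⁻¹) := fun l => by
    refine (h.lintegral_sq_randomSum hf (measurable_progenitors_history (N := N) le_rfl)
      (w l)).trans_le ?_
    refine (lintegral_mono (g := fun _ => ENNReal.ofReal (v * (((l : ℝ) + 1) ^ 2)⁻¹))
      fun ω => ?_).trans (by simp)
    rw [hw, ← ENNReal.ofReal_mul (by positivity)]
    refine ENNReal.ofReal_le_ofReal ?_
    have hv := hf.nonneg
    rcases Nat.eq_zero_or_pos (progenitors N X φ l ω) with h0 | h0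
    · rw [h0]; simp; positivity
    · have : (0 : ℝ) < progenitors N X φ l ω := by exact_mod_cast h0
      rw [mul_inv]
      field_simp
      exact le_rfl
  have hfin : ∫⁻ ω, ∑' l, F l ω ∂P ≠ ⊤ := by
    rw [lintegral_tsum fun l => (hFm l).aemeasurable]
    refine ne_top_of_le_ne_top ?_ (ENNReal.tsum_le_tsum hle)
    rw [← ENNReal.ofReal_tsum_of_nonneg (fun l => mul_nonneg hf.nonneg (by positivity)) hs]
    exact ENNReal.ofReal_ne_top
  filter_upwards [ae_lt_top (Measurable.tsum hFm) hfin] with ω hω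
  have h0 := ENNReal.tendsto_atTop_zero_of_tsum_ne_top hω.ne
  filter_upwards [h0.eventually_lt_const one_pos] with l hl
  rcases Nat.eq_zero_or_pos (progenitors N X φ l ω) with h1 | h1
  · simp [genSum, h1]
  · have h2 : (0 : ℝ) < progenitors N X φ l ω := by exact_mod_cast h1
    simp only [hF, hw] at hl
    rw [← ENNReal.ofReal_mul (by positivity), ENNReal.ofReal_lt_one, inv_mul_lt_iff₀ (by positivity),
      mul_one] at hl
    refine abs_le_of_sq_le_sq ?_ (by positivity)
    rw [mul_pow, Real.sq_sqrt h2.le]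
    linarith

/-- The number of progenitors grows like `ρ ^ l`. -/
def GeometricGrowth (N : ℕ) (X φ : ℕ → ℕ → Ω → ℕ) (ρ : ℝ) (ω : Ω) : Prop :=
  ∃ V > 0, Tendsto (fun l => (progenitors N X φ l ω : ℝ) / ρ ^ l) atTop (𝓝 V)

/-- The deviation `Z_{l+1} - m r_l` is a centred sum over generation `l`, so the progenitor numbers
inherit the growth of `Z`. Positivity of `m` follows from `τ m > 1`. -/
lemma IsCBP.ae_geometricGrowth [IsProbabilityMeasure P] (h : IsCBP P q X φ) (hs : Supercritical P q N X φ) :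
    ∃ ρ > 1, ∀ᵐ ω ∂P, ω ∈ survival N X φ → GeometricGrowth N X φ ρ ω := by
  obtain ⟨τ, m, W, hm, -, -, hρ, -, hW, -, hsurv⟩ := hs
  have hm0 : 0 ≤ m := hm ▸ tsum_nonneg fun k => mul_nonneg k.cast_nonneg (h.nonneg k)
  have hm1 : 0 < m := hm0.lt_of_ne fun h0 => by rw [← h0, mul_zero] at hρ; linarith
  obtain ⟨v, hv⟩ := centered_sub_mean h.isProb h.offspring_variance
  rw [← hm] at hv
  refine ⟨τ * m, hρ, ?_⟩
  filter_upwards [hW, hsurv.mem_iff, h.ae_eventually_genSum_le (N := N) hv] with ω h1 h2 h3 h4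
  have h5 : 0 < W ω := h2.2 h4
  have h6 := tendsto_div_pow_of_approx (z := fun l => Z N X φ l ω)
    (r := fun l => progenitors N X φ l ω) hρ hm1 h5 h1 (by
      filter_upwards [h3] with l h7
      rwa [genSum_sub_const, genSum_natCast] at h7)
  exact ⟨_, by positivity, h6⟩

lemma IsCBP.ae_tendsto_mle [IsProbabilityMeasure P] (h : IsCBP P q X φ) {ρ : ℝ} (hρ : 1 < ρ) :
    ∀ᵐ ω ∂P, GeometricGrowth N X φ ρ ω →
      Tendsto (fun n => mle N X φ n ω) atTop (𝓝[finiteLaws q] q) := by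
  have h1 : ∀ᵐ ω ∂P, ∀ k, ∀ᶠ l : ℕ in atTop,
      |genSum N X φ (fun i => (if i = k then 1 else 0) - q k) l ω| ≤
        (l + 1) * √(progenitors N X φ l ω : ℝ) :=
    ae_all_iff.2 fun k => h.ae_eventually_genSum_le (centered_indicator h.isProb k)
  filter_upwards [h1, h.ae_ne_zero] with ω h2 h3 ⟨V, hV, h4⟩
  have hΔ := tendsto_sum_div_pow hρ h4
  have hΔ' : Tendsto (fun n => totalProgenitors N X φ n ω) atTop atTop :=
    tendsto_atTop_of_div_pow hρ (div_pos hV (sub_pos.2 hρ)) hΔ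
  refine tendsto_nhdsWithin_iff.2 ⟨tendsto_pi_nhds.2 fun k => ?_, ?_⟩
  · have h5 := (tendsto_sum_div_sum hρ hV h4 (h2 k)).add_const (q k)
    rw [zero_add] at h5
    refine h5.congr' ?_
    filter_upwards [hΔ'.eventually_gt_atTop 0] with n hn
    have hn' : (totalProgenitors N X φ n ω : ℝ) ≠ 0 := by exact_mod_cast hn.ne'
    have h6 : ∑ l ∈ Finset.range n, genSum N X φ (fun i => (if i = k then 1 else 0) - q k) l ω =
        ((∑ l ∈ Finset.range n, offspringCount N X φ l k ω : ℕ) : ℝ) -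
          q k * totalProgenitors N X φ n ω := by
      simp only [genSum_sub_const, genSum_indicator, Finset.sum_sub_distrib, ← Finset.mul_sum]
      push_cast [totalProgenitors]
      rfl
    rw [h6]
    change _ / (totalProgenitors N X φ n ω : ℝ) + _ = _
    rw [mle]
    field_simp
    ring
  · filter_upwards [hΔ'.eventually_gt_atTop 0] with n hn
    exact mle_mem_finiteLaws hn h3

end Growth

/-! ### Tightness -/

lemma sum_pow_le {s : ℝ} (hs : 1 < s) (n : ℕ) :
    ∑ l ∈ Finset.range n, s ^ l ≤ s ^ n / (s - 1) := by
  rw [geom_sum_eq hs.ne']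
  have : 0 < s - 1 := by linarith
  gcongr
  linarith

/-- Cauchy–Schwarz with weights `s^l`. If the `a l` have second moments of order `s^{2l}`, the
square of the sum has mean of order `s^{2n}`, without any orthogonality between generations. -/
lemma sq_sum_le_of_geometric {s : ℝ} (hs : 1 < s) (a : ℕ → ℝ) (n : ℕ) :
    (∑ l ∈ Finset.range n, a l) ^ 2 ≤
      s ^ n / (s - 1) * ∑ l ∈ Finset.range n, a l ^ 2 / s ^ l := by
  have hs0 : 0 < s := by linarith
  rcases n.eq_zero_or_pos with rfl | hn
  · simp
  have hpos : 0 < ∑ l ∈ Finset.range n, s ^ l :=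
    Finset.sum_pos (fun l _ => by positivity) (Finset.nonempty_range_iff.2 hn.ne')
  have := Finset.sq_sum_div_le_sum_sq_div (Finset.range n) a (g := fun l => s ^ l)
    fun l _ => by positivity
  rw [div_le_iff₀ hpos] at this
  calc _ ≤ _ := this
    _ ≤ (∑ l ∈ Finset.range n, a l ^ 2 / s ^ l) * (s ^ n / (s - 1)) :=
      mul_le_mul_of_nonneg_left (sum_pow_le hs n) (Finset.sum_nonneg fun l _ => by positivity)
    _ = _ := mul_comm _ _

section Tight
variable {Ω : Type*} {N : ℕ} {X φ : ℕ → ℕ → Ω → ℕ} {s : ℝ}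

/-- The numbers of progenitors grow like `(s ^ 2) ^ l`, with constants controlled by `j`. -/
def growthEvent (N : ℕ) (X φ : ℕ → ℕ → Ω → ℕ) (s : ℝ) (j : ℕ) : Set Ω :=
  {ω | (∀ l, (progenitors N X φ l ω : ℝ) ≤ j * (s ^ 2) ^ l) ∧
    ∀ n ≥ j, (s ^ 2) ^ n ≤ j * totalProgenitors N X φ n ω}

lemma growthEvent_mono : Monotone (growthEvent N X φ s) := by
  intro a b hab ω hω
  have hab' : (a : ℝ) ≤ b := by exact_mod_cast hab
  exact ⟨fun l => (hω.1 l).trans (by gcongr), fun n hn => (hω.2 n (hab.trans hn)).trans (by gcongr)⟩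

lemma GeometricGrowth.exists_mem {ω : Ω} (hs : 1 < s) (h : GeometricGrowth N X φ (s ^ 2) ω) :
    ∃ j, ω ∈ growthEvent N X φ s j := by
  obtain ⟨V, hV, h⟩ := h
  have hρ : 1 < s ^ 2 := by nlinarith
  obtain ⟨B, hB⟩ := h.bddAbove_range
  have hΔ := tendsto_sum_div_pow hρ h
  have hV' : 0 < V / (s ^ 2 - 1) := div_pos hV (by linarith)
  obtain ⟨n₀, hn₀⟩ := eventually_atTop.1 (hΔ.eventually_const_lt (half_lt_self hV'))
  obtain ⟨j, hj⟩ := exists_nat_ge (max B (max n₀ (V / (s ^ 2 - 1) / 2)⁻¹))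
  have h1 : B ≤ j := (le_max_left _ _).trans hj
  have h2 : n₀ ≤ j := by exact_mod_cast ((le_max_left _ _).trans (le_max_right _ _)).trans hj
  have h3 : (V / (s ^ 2 - 1) / 2)⁻¹ ≤ (j : ℝ) := ((le_max_right _ _).trans (le_max_right _ _)).trans hj
  refine ⟨j, fun l => ?_, fun n hn => ?_⟩
  · have := hB (mem_range_self l)
    rw [div_le_iff₀ (by positivity)] at this
    exact this.trans (by gcongr)
  · have := hn₀ n (h2.trans hn)
    rw [lt_div_iff₀ (by positivity)] at this
    have h4 : (s ^ 2) ^ n ≤ (V / (s ^ 2 - 1) / 2)⁻¹ * totalProgenitors N X φ n ω := by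
      rw [inv_mul_eq_div, le_div_iff₀ (half_pos hV'), mul_comm]
      exact this.le
    exact h4.trans (by gcongr)

/-- The sum over the progenitors of generation `l`, of which at most `b` are taken into account. -/
noncomputable def truncSum (N : ℕ) (X φ : ℕ → ℕ → Ω → ℕ) (b : ℝ) (f : ℕ → ℝ) (l : ℕ) (ω : Ω) : ℝ :=
  ∑ i ∈ Finset.range (min (progenitors N X φ l ω) ⌊b⌋₊), f (X l i ω)

/-- The growth event depends on the whole future and cannot be conditioned on. Truncating the number
of summands is determined by the history, gives bounded moments, and changes nothing on the event.
-/
lemma truncSum_eq {j : ℕ} {ω : Ω} (h : ω ∈ growthEvent N X φ s j) (f : ℕ → ℝ) (l : ℕ) :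
    truncSum N X φ (j * (s ^ 2) ^ l) f l ω = genSum N X φ f l ω := by
  rw [truncSum, min_eq_left (Nat.le_floor (h.1 l)), genSum]

lemma measurable_trunc_history (b : ℝ) (l : ℕ) :
    Measurable[history X φ l] fun ω => min (progenitors N X φ l ω) ⌊b⌋₊ :=
  (measurable_progenitors_history le_rfl).min measurable_const

lemma measurableSet_survival {m : MeasurableSpace Ω} (h : ∀ n, Measurable[m] (Z N X φ n)) :
    MeasurableSet[m] (survival N X φ) :=
  measurableSet_tendsto atTop h

variable [MeasurableSpace Ω] {P : Measure Ω} {q : ℕ → ℝ}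

lemma IsCBP.measurable_truncSum (h : IsCBP P q X φ) (b : ℝ) (f : ℕ → ℝ) (l : ℕ) :
    Measurable (truncSum N X φ b f l) :=
  measurable_apply_nat (f := fun r ω => ∑ i ∈ Finset.range r, f (X l i ω))
    (fun _ => Finset.measurable_sum _ fun i _ =>
      (measurable_of_countable f).comp (h.measurable_offspring l i))
    ((measurable_trunc_history b l).mono (h.history_le l) le_rfl)

lemma IsCBP.measurable_totalProgenitors (h : IsCBP P q X φ) (n : ℕ) :
    Measurable (totalProgenitors N X φ n) :=
  Finset.measurable_sum _ fun l _ => h.measurable_progenitors l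

lemma IsCBP.measurable_Z (h : IsCBP P q X φ) (n : ℕ) : Measurable (Z N X φ n) :=
  (measurable_Z_history n).mono (h.history_le n) le_rfl

lemma IsCBP.measurableSet_growthEvent (h : IsCBP P q X φ) (j : ℕ) :
    MeasurableSet (growthEvent N X φ s j) := by
  have h1 : ∀ l, Measurable fun ω => (progenitors N X φ l ω : ℝ) := fun l =>
    measurable_from_top.comp (h.measurable_progenitors l)
  have h2 : ∀ n, Measurable fun ω => (totalProgenitors N X φ n ω : ℝ) := fun n =>
    measurable_from_top.comp (h.measurable_totalProgenitors n)
  have h3 : growthEvent N X φ s j =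
      (⋂ l, {ω | (progenitors N X φ l ω : ℝ) ≤ j * (s ^ 2) ^ l}) ∩
        ⋂ n, ⋂ (_ : n ≥ j), {ω | (s ^ 2) ^ n ≤ j * (totalProgenitors N X φ n ω : ℝ)} := by
    ext ω; simp [growthEvent]
  rw [h3]
  exact (MeasurableSet.iInter fun l => measurableSet_le (h1 l) measurable_const).inter
    (MeasurableSet.iInter fun n => MeasurableSet.iInter fun _ =>
      measurableSet_le measurable_const ((h2 n).const_mul _))

/-- The sum of `f` over the offspring numbers of all progenitors before generation `n`, divided by
the square root of their number. -/
noncomputable def normSum (N : ℕ) (X φ : ℕ → ℕ → Ω → ℕ) (f : ℕ → ℝ) (n : ℕ) (ω : Ω) : ℝ :=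
  (∑ l ∈ Finset.range n, genSum N X φ f l ω) / √(totalProgenitors N X φ n ω : ℝ)

lemma IsCBP.measurable_normSum (h : IsCBP P q X φ) (f : ℕ → ℝ) (n : ℕ) :
    Measurable (normSum N X φ f n) :=
  (Finset.measurable_sum _ fun l _ => h.measurable_genSum f l).div
    (measurable_from_top.comp (h.measurable_totalProgenitors n)).sqrt

variable [IsProbabilityMeasure P]

lemma IsCBP.exists_measure_diff_le (h : IsCBP P q X φ) (hs : 1 < s)
    (hg : ∀ᵐ ω ∂P, ω ∈ survival N X φ → GeometricGrowth N X φ (s ^ 2) ω) {ε : ENNReal}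
    (hε : 0 < ε) : ∃ j, P (survival N X φ \ growthEvent N X φ s j) < ε := by
  have h1 : Tendsto (fun j => P (survival N X φ \ growthEvent N X φ s j)) atTop
      (𝓝 (P (⋂ j, survival N X φ \ growthEvent N X φ s j))) := by
    refine tendsto_measure_iInter_atTop (fun j => ?_) (fun a b hab => ?_)
      ⟨0, measure_ne_top _ _⟩
    · exact ((measurableSet_survival h.measurable_Z).diff
        (h.measurableSet_growthEvent j)).nullMeasurableSet
    · exact sdiff_subset_sdiff_right (growthEvent_mono hab)
  have h2 : P (⋂ j, survival N X φ \ growthEvent N X φ s j) = 0 := by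
    refine measure_mono_null (t := {ω | ¬ (ω ∈ survival N X φ → GeometricGrowth N X φ (s ^ 2) ω)})
      (fun ω hω => ?_) hg
    rw [mem_iInter] at hω
    intro hcon
    obtain ⟨j, hj⟩ := (hcon (hω 0).1).exists_mem hs
    exact (hω j).2 hj
  rw [h2] at h1
  exact (h1.eventually_lt_const hε).exists

lemma IsCBP.tendsto_measure_survival_inter (h : IsCBP P q X φ) (hs : 1 < s)
    (hg : ∀ᵐ ω ∂P, ω ∈ survival N X φ → GeometricGrowth N X φ (s ^ 2) ω) {A : ℕ → Set Ω}
    (hA : ∀ j, Tendsto (fun n => P (growthEvent N X φ s j ∩ A n)) atTop (𝓝 0)) :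
    Tendsto (fun n => P (survival N X φ ∩ A n)) atTop (𝓝 0) := by
  rw [ENNReal.tendsto_nhds_zero]
  intro ε hε
  obtain ⟨j, hj⟩ := h.exists_measure_diff_le hs hg (ENNReal.half_pos hε.ne')
  filter_upwards [(hA j).eventually_lt_const (ENNReal.half_pos hε.ne')] with n hn
  calc P (survival N X φ ∩ A n)
      ≤ P (survival N X φ \ growthEvent N X φ s j ∪ growthEvent N X φ s j ∩ A n) := by
        refine measure_mono fun ω hω => ?_
        by_cases h1 : ω ∈ growthEvent N X φ s j
        · exact Or.inr ⟨h1, hω.2⟩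
        · exact Or.inl ⟨hω.1, h1⟩
    _ ≤ ε / 2 + ε / 2 := (measure_union_le _ _).trans (add_le_add hj.le hn.le)
    _ = ε := ENNReal.add_halves ε

variable {f : ℕ → ℝ} {v : ℝ}

lemma IsCBP.lintegral_sq_truncSum_le (h : IsCBP P q X φ) (hf : Centered q f v) {b : ℝ} (hb : 0 ≤ b)
    (l : ℕ) : ∫⁻ ω, ENNReal.ofReal (truncSum N X φ b f l ω ^ 2) ∂P ≤ ENNReal.ofReal (b * v) := by
  have h1 := h.lintegral_sq_randomSum hf (measurable_trunc_history (N := N) b l) fun _ => 1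
  simp only [one_mul] at h1
  refine h1.trans_le ((lintegral_mono (g := fun _ => ENNReal.ofReal (b * v)) fun ω => ?_).trans
    (by simp))
  refine ENNReal.ofReal_le_ofReal (mul_le_mul_of_nonneg_right ?_ hf.nonneg)
  exact le_trans (by exact_mod_cast min_le_right _ _) (Nat.floor_le hb)

lemma IsCBP.lintegral_abs_truncSum_le (h : IsCBP P q X φ) (hf : Summable fun k => |f k| * q k)
    {b : ℝ} (hb : 0 ≤ b) (l : ℕ) : ∫⁻ ω, ENNReal.ofReal |truncSum N X φ b f l ω| ∂P ≤
      ENNReal.ofReal (b * ∑' k, |f k| * q k) := by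
  refine (h.lintegral_abs_randomSum_le hf (measurable_trunc_history (N := N) b l)).trans
    ((lintegral_mono (g := fun _ => ENNReal.ofReal (b * ∑' k, |f k| * q k)) fun ω => ?_).trans
      (by simp))
  refine ENNReal.ofReal_le_ofReal (mul_le_mul_of_nonneg_right ?_
    (tsum_nonneg fun k => mul_nonneg (abs_nonneg _) (h.nonneg k)))
  exact le_trans (by exact_mod_cast min_le_right _ _) (Nat.floor_le hb)

lemma IsCBP.lintegral_sq_sum_truncSum_le (h : IsCBP P q X φ) (hf : Centered q f v) (hs : 1 < s)
    (j n : ℕ) :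
    ∫⁻ ω, ENNReal.ofReal
        ((∑ l ∈ Finset.range n, truncSum N X φ (j * (s ^ 2) ^ l) f l ω) ^ 2) ∂P ≤
      ENNReal.ofReal (j * v * (s ^ n / (s - 1)) ^ 2) := by
  have hs0 : 0 < s := by linarith
  have hs1 : 0 < s - 1 := by linarith
  have hv := hf.nonneg
  have hK : 0 ≤ s ^ n / (s - 1) := by positivity
  calc _ ≤ ∫⁻ ω, ∑ l ∈ Finset.range n, ENNReal.ofReal (s ^ n / (s - 1) / s ^ l) *
        ENNReal.ofReal (truncSum N X φ (j * (s ^ 2) ^ l) f l ω ^ 2) ∂P := by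
        refine lintegral_mono fun ω => ?_
        refine (ENNReal.ofReal_le_ofReal (sq_sum_le_of_geometric hs _ n)).trans_eq ?_
        rw [Finset.mul_sum, ENNReal.ofReal_sum_of_nonneg fun l _ => by positivity]
        refine Finset.sum_congr rfl fun l _ => ?_
        rw [← ENNReal.ofReal_mul (by positivity)]
        congr 1; ring
    _ = ∑ l ∈ Finset.range n, ENNReal.ofReal (s ^ n / (s - 1) / s ^ l) *
        ∫⁻ ω, ENNReal.ofReal (truncSum N X φ (j * (s ^ 2) ^ l) f l ω ^ 2) ∂P := by
        have hm : ∀ l, Measurable fun ω =>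
            ENNReal.ofReal (truncSum N X φ (j * (s ^ 2) ^ l) f l ω ^ 2) := fun l =>
          ((h.measurable_truncSum _ f l).pow_const 2).ennreal_ofReal
        rw [lintegral_finsetSum _ fun l _ => (hm l).const_mul _]
        exact Finset.sum_congr rfl fun l _ => lintegral_const_mul _ (hm l)
    _ ≤ ∑ l ∈ Finset.range n, ENNReal.ofReal (s ^ n / (s - 1) * (j * v) * s ^ l) := by
        refine Finset.sum_le_sum fun l _ => ?_
        refine (mul_le_mul_right (h.lintegral_sq_truncSum_le hf (by positivity) l) _).trans_eq ?_
        rw [← ENNReal.ofReal_mul (by positivity)]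
        congr 1
        field_simp
        ring
    _ ≤ _ := by
        rw [← ENNReal.ofReal_sum_of_nonneg fun l _ => by positivity, ← Finset.mul_sum]
        refine ENNReal.ofReal_le_ofReal ?_
        calc _ ≤ s ^ n / (s - 1) * (j * v) * (s ^ n / (s - 1)) := by
              gcongr; exact sum_pow_le hs n
          _ = _ := by ring

lemma IsCBP.lintegral_abs_sum_truncSum_le (h : IsCBP P q X φ) (hf : Summable fun k => |f k| * q k)
    (hs : 1 < s) (j n : ℕ) :
    ∫⁻ ω, ENNReal.ofReal |∑ l ∈ Finset.range n, truncSum N X φ (j * (s ^ 2) ^ l) f l ω| ∂P ≤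
      ENNReal.ofReal (j * ((s ^ 2) ^ n / (s ^ 2 - 1)) * ∑' k, |f k| * q k) := by
  have hs2 : 1 < s ^ 2 := by nlinarith
  have hf0 : 0 ≤ ∑' k, |f k| * q k := tsum_nonneg fun k => mul_nonneg (abs_nonneg _) (h.nonneg k)
  calc _ ≤ ∫⁻ ω, ∑ l ∈ Finset.range n,
        ENNReal.ofReal |truncSum N X φ (j * (s ^ 2) ^ l) f l ω| ∂P := by
        refine lintegral_mono fun ω => ?_
        refine (ENNReal.ofReal_le_ofReal (Finset.abs_sum_le_sum_abs _ _)).trans_eq ?_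
        rw [ENNReal.ofReal_sum_of_nonneg fun l _ => abs_nonneg _]
    _ = ∑ l ∈ Finset.range n,
        ∫⁻ ω, ENNReal.ofReal |truncSum N X φ (j * (s ^ 2) ^ l) f l ω| ∂P :=
        lintegral_finsetSum _ fun l _ =>
          (continuous_abs.measurable.comp (h.measurable_truncSum _ f l)).ennreal_ofReal
    _ ≤ ∑ l ∈ Finset.range n, ENNReal.ofReal (j * (s ^ 2) ^ l * ∑' k, |f k| * q k) :=
        Finset.sum_le_sum fun l _ => h.lintegral_abs_truncSum_le hf (by positivity) l
    _ ≤ _ := by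
        rw [← ENNReal.ofReal_sum_of_nonneg fun l _ => by positivity, ← Finset.sum_mul,
          ← Finset.mul_sum]
        refine ENNReal.ofReal_le_ofReal ?_
        gcongr
        exact sum_pow_le hs2 n

/-- On the event the total is at least `s^{2n} / j`, so the random normalisation becomes
deterministic and Chebyshev's inequality applies to the truncated sums. -/
lemma IsCBP.measure_growthEvent_inter_normSum_le (h : IsCBP P q X φ) (hf : Centered q f v)
    (hs : 1 < s) (j : ℕ) {n : ℕ} (hn : j ≤ n) {M : ℝ} (hM : 0 < M) :
    P (growthEvent N X φ s j ∩ {ω | M ≤ |normSum N X φ f n ω|}) ≤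
      ENNReal.ofReal (j ^ 2 * v / (s - 1) ^ 2 / M ^ 2) := by
  have hs0 : 0 < s := by linarith
  have hs1 : 0 < s - 1 := by linarith
  set F : Ω → ENNReal := fun ω => ENNReal.ofReal
        ((∑ l ∈ Finset.range n, truncSum N X φ (j * (s ^ 2) ^ l) f l ω) ^ 2) with hF
  have hFm : Measurable F :=
    ((Finset.measurable_sum _ fun l _ => h.measurable_truncSum _ f l).pow_const 2).ennreal_ofReal
  -- For `j = 0` the event is empty, as it would force `s^{2n} ≤ 0`.
  rcases j.eq_zero_or_pos with rfl | hj
  · refine (measure_mono_null (t := ∅) (fun ω hω => ?_) measure_empty).trans_le zero_le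
    have h1 := hω.1.2 n hn
    have h2 : 0 < (s ^ 2) ^ n := by positivity
    rw [Nat.cast_zero, zero_mul] at h1
    exact absurd h1 h2.not_ge
  have hj' : (0 : ℝ) < j := by exact_mod_cast hj
  have hc : 0 < M ^ 2 * (s ^ 2) ^ n / j := by positivity
  refine (measure_mono (t := {ω | ENNReal.ofReal (M ^ 2 * (s ^ 2) ^ n / j) ≤ F ω}) ?_).trans
    ((meas_ge_le_lintegral_div hFm.aemeasurable (by simpa using hc) ENNReal.ofReal_ne_top).trans ?_)
  · rintro ω ⟨h1, h2⟩
    refine ENNReal.ofReal_le_ofReal ?_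
    rw [Finset.sum_congr rfl fun l _ => truncSum_eq h1 f l]
    have h3 := h1.2 n hn
    have h4 : (0 : ℝ) < totalProgenitors N X φ n ω := by
      by_contra hcon
      have : (0 : ℝ) < (s ^ 2) ^ n := by positivity
      nlinarith
    have h5 : M * √(totalProgenitors N X φ n ω) ≤ |∑ l ∈ Finset.range n, genSum N X φ f l ω| := by
      change M ≤ |normSum N X φ f n ω| at h2
      rw [normSum, abs_div, abs_of_nonneg (Real.sqrt_nonneg _),
        le_div_iff₀ (Real.sqrt_pos.2 h4)] at h2
      exact h2
    rw [← sq_abs (∑ l ∈ Finset.range n, genSum N X φ f l ω)]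
    calc M ^ 2 * (s ^ 2) ^ n / j ≤ M ^ 2 * totalProgenitors N X φ n ω := by
          rw [div_le_iff₀ hj']; nlinarith [sq_nonneg M]
      _ = (M * √(totalProgenitors N X φ n ω)) ^ 2 := by rw [mul_pow, Real.sq_sqrt h4.le]
      _ ≤ _ := by gcongr
  · refine (ENNReal.div_le_div_right (h.lintegral_sq_sum_truncSum_le hf hs j n) _).trans_eq ?_
    rw [← ENNReal.ofReal_div_of_pos hc]
    congr 1
    field_simp
    ring

lemma IsCBP.tight_normSum (h : IsCBP P q X φ) (hf : Centered q f v) (hs : 1 < s)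
    (hg : ∀ᵐ ω ∂P, ω ∈ survival N X φ → GeometricGrowth N X φ (s ^ 2) ω) {ε : ENNReal}
    (hε : 0 < ε) :
    ∃ M : ℝ, 0 < M ∧ ∀ᶠ n in atTop, P (survival N X φ ∩ {ω | M ≤ |normSum N X φ f n ω|}) ≤ ε := by
  obtain ⟨j, hj⟩ := h.exists_measure_diff_le hs hg (ENNReal.half_pos hε.ne')
  have h1 : Tendsto (fun M : ℝ => ENNReal.ofReal (j ^ 2 * v / (s - 1) ^ 2 / M ^ 2)) atTop (𝓝 0) := by
    have : Tendsto (fun M : ℝ => j ^ 2 * v / (s - 1) ^ 2 / M ^ 2) atTop (𝓝 0) :=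
      tendsto_const_nhds.div_atTop (tendsto_pow_atTop two_ne_zero)
    simpa using ENNReal.tendsto_ofReal this
  obtain ⟨M, hM, hM0⟩ := ((h1.eventually_lt_const (ENNReal.half_pos hε.ne')).and
    (eventually_gt_atTop 0)).exists
  refine ⟨M, hM0, ?_⟩
  filter_upwards [eventually_ge_atTop j] with n hn
  calc _ ≤ P (survival N X φ \ growthEvent N X φ s j ∪
        growthEvent N X φ s j ∩ {ω | M ≤ |normSum N X φ f n ω|}) := by
        refine measure_mono fun ω hω => ?_
        by_cases h1 : ω ∈ growthEvent N X φ s j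
        · exact Or.inr ⟨h1, hω.2⟩
        · exact Or.inl ⟨hω.1, h1⟩
    _ ≤ ε / 2 + ε / 2 := (measure_union_le _ _).trans (add_le_add hj.le
        ((h.measure_growthEvent_inter_normSum_le hf hs j hn hM0).trans hM.le))
    _ = ε := ENNReal.add_halves ε

end Tight

/-! ### The remainder at the empirical offspring law -/

lemma ofReal_tsum_le {f : ℕ → ℝ} (hf : ∀ k, 0 ≤ f k) :
    ENNReal.ofReal (∑' k, f k) ≤ ∑' k, ENNReal.ofReal (f k) := by
  by_cases h : Summable f
  · exact (ENNReal.ofReal_tsum_of_nonneg hf h).le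
  · rw [tsum_eq_zero_of_not_summable h]; simp

lemma tsum_abs_indicator_sub_le {q : ℕ → ℝ} (hq : IsProb q) (k : ℕ) :
    ∑' i, |(if i = k then 1 else 0) - q k| * q i ≤ 2 * q k := by
  have h1 : HasSum (fun i => (if i = k then q k else 0)) (q k) := hasSum_ite_eq k (q k)
  have h2 := h1.add (hq.2.mul_left (q k))
  rw [mul_one, ← two_mul] at h2
  have hle : ∀ i, |(if i = k then 1 else 0) - q k| * q i ≤
      (if i = k then q k else 0) + q k * q i := fun i => by
    have h3 := abs_sub (if i = k then (1 : ℝ) else 0) (q k)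
    rw [abs_of_nonneg (hq.1 k)] at h3
    refine (mul_le_mul_of_nonneg_right h3 (hq.1 i)).trans_eq ?_
    split_ifs with h
    · subst h; simp; ring
    · simp
  exact (Summable.tsum_le_tsum hle (h2.summable.of_nonneg_of_le
    (fun i => mul_nonneg (abs_nonneg _) (hq.1 i)) hle) h2.summable).trans_eq h2.tsum_eq

section Rem
variable {Ω : Type*} {N : ℕ} {X φ : ℕ → ℕ → Ω → ℕ} {s : ℝ}

lemma sum_genSum_indicator {n : ℕ} {ω : Ω} (h0 : 0 < (totalProgenitors N X φ n ω : ℝ)) (c : ℝ)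
    (k : ℕ) :
    ∑ l ∈ Finset.range n, genSum N X φ (fun i => (if i = k then 1 else 0) - c) l ω =
      totalProgenitors N X φ n ω * (mle N X φ n ω k - c) := by
  simp only [genSum_sub_const, genSum_indicator, Finset.sum_sub_distrib, ← Finset.mul_sum]
  rw [mle, mul_sub, mul_div_cancel₀ _ h0.ne', mul_comm c]
  push_cast [totalProgenitors]
  rfl

/-- The random `Δ` is eliminated: with centred count `d` and any `R ≥ Δ^{-1/2}`, only the moments of
`d` remain to be estimated. -/
lemma sqrt_mul_remainder_term_le {Δ R x y d : ℝ} (hΔ : 0 < Δ) (hR : 1 / √Δ ≤ R) (hy : 0 ≤ y)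
    (hd : d = Δ * (x - y)) :
    √Δ * min |x - y| ((x - y) ^ 2 / y) ≤ min (|d| * R) (d ^ 2 * R ^ 3 / y) := by
  have h0 := Real.sqrt_pos.2 hΔ
  have hR0 : 0 ≤ 1 / √Δ := by positivity
  obtain ⟨r, hr, rfl⟩ : ∃ r > 0, Δ = r ^ 2 := ⟨√Δ, h0, (Real.sq_sqrt hΔ.le).symm⟩
  rw [Real.sqrt_sq hr.le] at *
  have h1 : |x - y| = |d| / r ^ 2 := by
    rw [hd, abs_mul, abs_of_pos hΔ, mul_div_cancel_left₀ _ hΔ.ne']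
  have h2 : x - y = d / r ^ 2 := by rw [hd, mul_div_cancel_left₀ _ hΔ.ne']
  rw [mul_min_of_nonneg _ _ hr.le]
  refine min_le_min ?_ ?_
  · calc r * |x - y| = |d| * (1 / r) := by rw [h1]; field_simp
      _ ≤ _ := by gcongr
  · calc r * ((x - y) ^ 2 / y) = d ^ 2 * (1 / r) ^ 3 / y := by rw [h2]; field_simp
      _ ≤ _ := by gcongr

variable [MeasurableSpace Ω] {P : Measure Ω} {q u : ℕ → ℝ} [IsProbabilityMeasure P]

/-- The mean of a minimum is at most the minimum of the means. Bounding one branch by the first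
absolute moment and the other by the second moment of the truncated centred counts gives `C |u_k|
min(s^n q_k, 1 / s^n)`. The sum over `k` is the hypothesis on the remainder at `x = s^n`, and
Markov's inequality concludes. -/
lemma IsCBP.tendsto_measure_growthEvent_inter_remainder (h : IsCBP P q X φ) (hs : 1 < s)
    (hu : Summable fun k => |u k| * q k) (hR : NegligibleRemainder q u) {ε : ℝ} (hε : 0 < ε)
    (j : ℕ) :
    Tendsto (fun n => P (growthEvent N X φ s j ∩ {ω | ε ≤
      √(totalProgenitors N X φ n ω) * remainder q u (mle N X φ n ω)})) atTop (𝓝 0) := by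
  have hs0 : 0 < s := by linarith
  have hs1 : 0 < s - 1 := by linarith
  have hs2 : 0 < s ^ 2 - 1 := by nlinarith
  have hq := h.isProb
  set R : ℕ → ℝ := fun n => √j / s ^ n with hRdef
  have hR0 : ∀ n, 0 ≤ R n := fun n => by positivity
  set D : ℕ → ℕ → Ω → ℝ := fun n k ω => ∑ l ∈ Finset.range n, truncSum N X φ (j * (s ^ 2) ^ l)
    (fun i => (if i = k then 1 else 0) - q k) l ω with hD
  have hDm : ∀ n k, Measurable (D n k) := fun n k =>
    Finset.measurable_sum _ fun l _ => h.measurable_truncSum _ _ l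
  have hDa : ∀ n k, Measurable fun ω => |D n k ω| := fun n k =>
    continuous_abs.measurable.comp (hDm n k)
  set F : ℕ → ℕ → Ω → ENNReal := fun n k ω => ENNReal.ofReal |u k| *
    min (ENNReal.ofReal (|D n k ω| * R n)) (ENNReal.ofReal (D n k ω ^ 2 * (R n ^ 3 / q k))) with hF
  have hFm : ∀ n k, Measurable (F n k) := fun n k =>
    Measurable.const_mul (Measurable.min
      ((hDa n k).mul_const _).ennreal_ofReal
      (((hDm n k).pow_const 2).mul_const _).ennreal_ofReal) _
  -- The first entry comes from `E|D| ≤ j s^{2n} / (s² - 1) · 2 q_k` times `R`. The second comes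
  -- from `E D² ≤ j q_k s^{2n} / (s - 1)²` times `R³ / q_k`.
  set C : ℝ := max (√j * j * 2 / (s ^ 2 - 1)) (j * √j ^ 3 / (s - 1) ^ 2) with hC
  have hC0 : 0 ≤ C := le_max_of_le_left (by positivity)
  have hint : ∀ n k, ∫⁻ ω, F n k ω ∂P ≤
      ENNReal.ofReal (C * (|u k| * min (s ^ n * q k) (1 / s ^ n))) := fun n k => by
    have hqk := hq.1 k
    have hsn : 0 < s ^ n := by positivity
    have e1 : ∫⁻ ω, ENNReal.ofReal (|D n k ω| * R n) ∂P ≤ ENNReal.ofReal (C * (s ^ n * q k)) := by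
      simp_rw [fun ω => ENNReal.ofReal_mul (p := |D n k ω|) (q := R n) (abs_nonneg _)]
      rw [lintegral_mul_const _ (hDa n k).ennreal_ofReal]
      have hcs := (centered_indicator hq k).summable_abs
      refine (mul_le_mul_left (h.lintegral_abs_sum_truncSum_le hcs hs j n) _).trans ?_
      rw [← ENNReal.ofReal_mul (mul_nonneg (by positivity)
        (tsum_nonneg fun i => mul_nonneg (abs_nonneg _) (hq.1 i)))]
      refine ENNReal.ofReal_le_ofReal ?_
      calc _ ≤ j * ((s ^ 2) ^ n / (s ^ 2 - 1)) * (2 * q k) * R n := by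
            gcongr
            exact tsum_abs_indicator_sub_le hq k
        _ = (√j * j * 2 / (s ^ 2 - 1)) * (s ^ n * q k) := by
            rw [hRdef]
            field_simp
            ring
        _ ≤ _ := by gcongr; exact le_max_left _ _
    have e2 : ∫⁻ ω, ENNReal.ofReal (D n k ω ^ 2 * (R n ^ 3 / q k)) ∂P ≤
        ENNReal.ofReal (C * (1 / s ^ n)) := by
      simp_rw [fun ω => ENNReal.ofReal_mul (p := D n k ω ^ 2) (q := R n ^ 3 / q k) (sq_nonneg _)]
      rw [lintegral_mul_const _ ((hDm n k).pow_const 2).ennreal_ofReal]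
      refine (mul_le_mul_left (h.lintegral_sq_sum_truncSum_le (centered_indicator hq k) hs j n)
        _).trans ?_
      have hv := (centered_indicator hq k).nonneg
      rw [← ENNReal.ofReal_mul (by positivity)]
      refine ENNReal.ofReal_le_ofReal ?_
      have h1 : (q k - q k ^ 2) / q k ≤ 1 := div_le_one_of_le₀ (by nlinarith) hqk
      calc _ = (j * √j ^ 3 / (s - 1) ^ 2) * (1 / s ^ n) * ((q k - q k ^ 2) / q k) := by
            rw [hRdef]
            field_simp
        _ ≤ (j * √j ^ 3 / (s - 1) ^ 2) * (1 / s ^ n) * 1 := by gcongr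
        _ ≤ C * (1 / s ^ n) := by rw [mul_one]; gcongr; exact le_max_right _ _
    rw [hF]
    dsimp only
    rw [lintegral_const_mul _ (Measurable.min
      ((hDa n k).mul_const _).ennreal_ofReal
      (((hDm n k).pow_const 2).mul_const _).ennreal_ofReal), mul_left_comm,
      ENNReal.ofReal_mul (abs_nonneg _), mul_min_of_nonneg _ _ hC0]
    refine mul_le_mul_right ?_ _
    rw [ENNReal.ofReal_mono.map_min]
    refine le_min ((lintegral_mono fun ω => min_le_left _ _).trans e1)
      ((lintegral_mono fun ω => min_le_right _ _).trans e2)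
  have hsum : ∀ n, Summable fun k => C * (|u k| * min (s ^ n * q k) (1 / s ^ n)) := fun n => by
    refine ((hu.mul_left (s ^ n)).of_nonneg_of_le (fun k => ?_) fun k => ?_).mul_left C
    · have := hq.1 k; positivity
    · calc _ ≤ |u k| * (s ^ n * q k) := by gcongr; exact min_le_left _ _
        _ = _ := by ring
  have hlim : Tendsto (fun n => ENNReal.ofReal
      (∑' k, C * (|u k| * min (s ^ n * q k) (1 / s ^ n))) / ENNReal.ofReal ε) atTop (𝓝 0) := by
    have h1 := (hR.comp (tendsto_pow_atTop_atTop_of_one_lt hs)).const_mul C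
    rw [mul_zero] at h1
    have h2 := ENNReal.tendsto_ofReal h1
    rw [ENNReal.ofReal_zero] at h2
    have h3 := ENNReal.Tendsto.div_const h2 (b := ENNReal.ofReal ε) (Or.inr (by simpa using hε))
    rw [ENNReal.zero_div] at h3
    refine h3.congr fun n => ?_
    rw [Function.comp_apply, tsum_mul_left]
  refine tendsto_of_tendsto_of_tendsto_of_le_of_le' tendsto_const_nhds hlim
    (Eventually.of_forall fun _ => zero_le) ?_
  filter_upwards [eventually_ge_atTop j] with n hn
  have hHm : Measurable fun ω => ∑' k, F n k ω := Measurable.tsum (hFm n)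
  refine (measure_mono (t := {ω | ENNReal.ofReal ε ≤ ∑' k, F n k ω}) ?_).trans
    ((meas_ge_le_lintegral_div hHm.aemeasurable (by simpa using hε) ENNReal.ofReal_ne_top).trans ?_)
  · rintro ω ⟨h1, h2⟩
    refine (ENNReal.ofReal_le_ofReal h2).trans ?_
    have h3 := h1.2 n hn
    have h4 : (0 : ℝ) < totalProgenitors N X φ n ω := by
      by_contra hcon
      have : (0 : ℝ) < (s ^ 2) ^ n := by positivity
      have : (0 : ℝ) ≤ j := by positivity
      nlinarith
    have h5 : 1 / √(totalProgenitors N X φ n ω : ℝ) ≤ R n := by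
      rw [hRdef, div_le_div_iff₀ (Real.sqrt_pos.2 h4) (by positivity), one_mul,
        ← Real.sqrt_mul (Nat.cast_nonneg j)]
      refine Real.le_sqrt_of_sq_le ?_
      rw [← pow_mul, mul_comm n, pow_mul]
      exact h3
    rw [remainder, ← tsum_mul_left]
    have hnn : ∀ k, 0 ≤ √(totalProgenitors N X φ n ω : ℝ) * (|u k| *
        min |mle N X φ n ω k - q k| ((mle N X φ n ω k - q k) ^ 2 / q k)) := fun k => by
      have := hq.1 k; positivity
    refine (ofReal_tsum_le hnn).trans (ENNReal.tsum_le_tsum fun k => ?_)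
    rw [hF]
    dsimp only
    rw [mul_left_comm, ENNReal.ofReal_mul (abs_nonneg _), ← ENNReal.ofReal_mono.map_min]
    refine mul_le_mul_right (ENNReal.ofReal_le_ofReal ?_) _
    refine (sqrt_mul_remainder_term_le h4 h5 (hq.1 k) (d := D n k ω) ?_).trans_eq ?_
    · rw [hD]
      dsimp only
      rw [Finset.sum_congr rfl fun l _ => truncSum_eq h1 _ l, sum_genSum_indicator h4]
    · rw [mul_div_assoc]
  · refine ENNReal.div_le_div_right ?_ _
    rw [lintegral_tsum fun k => (hFm n k).aemeasurable,
      ENNReal.ofReal_tsum_of_nonneg (fun k => ?_) (hsum n)]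
    · exact ENNReal.tsum_le_tsum (hint n)
    · have := hq.1 k; positivity

lemma IsCBP.tendsto_measure_remainder (h : IsCBP P q X φ) (hs : 1 < s)
    (hg : ∀ᵐ ω ∂P, ω ∈ survival N X φ → GeometricGrowth N X φ (s ^ 2) ω)
    (hu : Summable fun k => |u k| * q k) (hR : NegligibleRemainder q u) {ε : ℝ} (hε : 0 < ε) :
    Tendsto (fun n => P (survival N X φ ∩ {ω | ε ≤
      √(totalProgenitors N X φ n ω) * remainder q u (mle N X φ n ω)})) atTop (𝓝 0) :=
  h.tendsto_measure_survival_inter hs hg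
    fun j => h.tendsto_measure_growthEvent_inter_remainder hs hu hR hε j

end Rem

/-! ### Characteristic functions -/

/-- `e^{i x}`. -/
noncomputable def expI (x : ℝ) : ℂ := Complex.exp (x * Complex.I)

lemma norm_expI (x : ℝ) : ‖expI x‖ = 1 := Complex.norm_exp_ofReal_mul_I x

lemma measurable_expI : Measurable expI := by
  unfold expI; fun_prop

lemma expI_add (x y : ℝ) : expI (x + y) = expI x * expI y := by
  simp only [expI]
  rw [← Complex.exp_add]
  push_cast
  ring_nf

lemma expI_zero : expI 0 = 1 := by simp [expI]

lemma norm_expI_sub_le (x y : ℝ) : ‖expI x - expI y‖ ≤ |x - y| := by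
  have h1 : expI x - expI y = expI y * (expI (x - y) - 1) := by
    rw [mul_sub, ← expI_add, mul_one, add_sub_cancel]
  have h2 := Real.norm_exp_I_mul_ofReal_sub_one_le (x := x - y)
  rw [mul_comm, Real.norm_eq_abs] at h2
  rw [h1, norm_mul, norm_expI, one_mul]
  exact h2

lemma norm_pow_sub_pow_le {a b : ℂ} (ha : ‖a‖ ≤ 1) (hb : ‖b‖ ≤ 1) (n : ℕ) :
    ‖a ^ n - b ^ n‖ ≤ n * ‖a - b‖ := by
  induction n with
  | zero => simp
  | succ n ih =>
    have h1 : a ^ (n + 1) - b ^ (n + 1) = a ^ n * (a - b) + (a ^ n - b ^ n) * b := by ring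
    rw [h1]
    refine (norm_add_le _ _).trans ?_
    rw [norm_mul, norm_mul, norm_pow]
    have h2 : ‖a‖ ^ n ≤ 1 := pow_le_one₀ (norm_nonneg _) ha
    push_cast
    nlinarith [norm_nonneg (a - b), norm_nonneg (a ^ n - b ^ n)]

/-- This is the second order expansion of a characteristic function, applied to the standard normal
law itself. -/
lemma isLittleO_exp_neg_sq_div_two :
    (fun t : ℝ => Complex.exp (-(t ^ 2 / 2 : ℝ)) - (1 - t ^ 2 / 2)) =o[𝓝 0] fun t => t ^ 2 := by
  have h2 : ∫ x : ℝ, x ^ 2 ∂gaussianReal 0 1 = 1 := by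
    have := variance_of_integral_eq_zero (μ := gaussianReal 0 1) (X := id) (by fun_prop) (by simp)
    simpa using this.symm
  have := taylor_charFun_two (P := gaussianReal 0 1) (X := id) (by fun_prop) (by simp) h2
  refine this.congr_left fun t => ?_
  rw [Measure.map_id, charFun_gaussianReal]
  congr 2
  push_cast
  ring

/-- If the characteristic function `ψ` has the expansion of a standardised law, then
`ψ(θ_n)^{r_n}` has a Gaussian limit when `θ_n → 0` and `r_n θ_n²` converges. -/
lemma tendsto_pow_of_isLittleO {ψ : ℝ → ℂ} (h1 : ∀ t, ‖ψ t‖ ≤ 1)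
    (h : (fun t : ℝ => ψ t - (1 - t ^ 2 / 2)) =o[𝓝 0] fun t => t ^ 2) {θ : ℕ → ℝ} {r : ℕ → ℕ} {c : ℝ}
    (hθ : Tendsto θ atTop (𝓝 0)) (hr : Tendsto (fun n => r n * θ n ^ 2) atTop (𝓝 c)) :
    Tendsto (fun n => ψ (θ n) ^ r n) atTop (𝓝 (Complex.exp (-(c / 2 : ℝ)))) := by
  have h2 : (fun t : ℝ => ψ t - Complex.exp (-(t ^ 2 / 2 : ℝ))) =o[𝓝 0] fun t => t ^ 2 := by
    refine (h.sub isLittleO_exp_neg_sq_div_two).congr_left fun t => ?_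
    ring
  have h3 : Tendsto (fun n => ψ (θ n) ^ r n - Complex.exp (-(r n * θ n ^ 2 / 2 : ℝ))) atTop
      (𝓝 0) := by
    have h4 := (h2.norm_left.comp_tendsto hθ).tendsto_div_nhds_zero
    have h5 := hr.mul h4
    rw [mul_zero] at h5
    refine squeeze_zero_norm' ?_ h5
    filter_upwards with n
    have h6 : Complex.exp (-(r n * θ n ^ 2 / 2 : ℝ)) =
        Complex.exp (-(θ n ^ 2 / 2 : ℝ)) ^ r n := by
      rw [← Complex.exp_nat_mul]
      push_cast
      ring_nf
    have h7 : ‖Complex.exp (-(θ n ^ 2 / 2 : ℝ))‖ ≤ 1 := by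
      rw [← Complex.ofReal_neg, Complex.norm_exp_ofReal]
      exact Real.exp_le_one_iff.2 (by nlinarith [sq_nonneg (θ n)])
    rw [h6]
    refine (norm_pow_sub_pow_le (h1 _) h7 _).trans ?_
    simp only [Function.comp_apply]
    -- At `θ n = 0` the quotient by `θ n ^ 2` is the junk value `0`; the expansion evaluated at `0`
    -- forces `ψ 0 = 1`, so the left side vanishes too.
    rcases eq_or_ne (θ n) 0 with h0 | h0
    · have h8 := (h2.bound one_pos).self_of_nhds
      rw [h0]
      simp only [ne_eq, OfNat.ofNat_ne_zero, not_false_eq_true, zero_pow, norm_zero, mul_zero] at h8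
      have h9 : ψ 0 = 1 := by simpa [sub_eq_zero] using h8
      simp [h9]
    · refine le_of_eq ?_
      field_simp
  have h4 : Tendsto (fun n => Complex.exp (-(r n * θ n ^ 2 / 2 : ℝ))) atTop
      (𝓝 (Complex.exp (-(c / 2 : ℝ)))) := by
    have h5 : Continuous fun x : ℝ => Complex.exp (-(x / 2 : ℝ)) := by fun_prop
    exact (h5.tendsto c).comp hr
  simpa using h3.add h4

/-- A contraction argument: if `g_{n+1}(t) ≤ e_n(t) + g_n(t / s)` with `e_n → 0` pointwise and `g_n` is
eventually small near `0`, then `g_n → 0` pointwise. -/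
lemma tendsto_zero_of_contraction {s : ℝ} (hs : 1 < s) {g e : ℕ → ℝ → ℝ} (h0 : ∀ n t, 0 ≤ g n t)
    (he : ∀ t, Tendsto (fun n => e n t) atTop (𝓝 0))
    (h : ∀ n t, g (n + 1) t ≤ e n t + g n (t / s))
    (hsmall : ∀ ε > 0, ∃ δ > 0, ∀ᶠ n in atTop, ∀ t, |t| ≤ δ → g n t ≤ ε) (t : ℝ) :
    Tendsto (fun n => g n t) atTop (𝓝 0) := by
  have hs0 : 0 < s := by linarith
  refine tendsto_order.2 ⟨fun a ha => Eventually.of_forall fun n => ha.trans_le (h0 n t),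
    fun a ha => ?_⟩
  obtain ⟨δ, hδ, hδ'⟩ := hsmall (a / 2) (half_pos ha)
  -- Each step enlarges the radius of the good interval by the factor `s`. A fixed `t` needs
  -- finitely many steps, so their errors can be kept below any `η`.
  have key : ∀ k : ℕ, ∀ t, |t| ≤ δ * s ^ k → ∀ η > 0, ∀ᶠ n in atTop, g n t ≤ a / 2 + η := by
    intro k
    induction k with
    | zero =>
      intro t ht η hη
      filter_upwards [hδ'] with n hn
      exact (hn t (by simpa using ht)).trans (by linarith)
    | succ k ih =>
      intro t ht η hη
      have h1 := ih (t / s) (by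
        rw [abs_div, abs_of_pos hs0, div_le_iff₀ hs0, mul_assoc, ← pow_succ]; exact ht) (η / 2)
        (half_pos hη)
      have h2 : ∀ᶠ n in atTop, g (n + 1) t ≤ a / 2 + η := by
        filter_upwards [h1, (he t).eventually_lt_const (half_pos hη)] with n h3 h4
        linarith [h n t]
      obtain ⟨n₀, hn₀⟩ := eventually_atTop.1 h2
      filter_upwards [eventually_ge_atTop (n₀ + 1)] with n hn
      obtain ⟨m, rfl⟩ := Nat.exists_eq_add_of_le' (Nat.one_le_of_lt hn)
      exact hn₀ m (by omega)
  obtain ⟨k, hk⟩ := (((tendsto_pow_atTop_atTop_of_one_lt hs).const_mul_atTop hδ).eventually_ge_atTop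
    |t|).exists
  filter_upwards [key k t hk (a / 4) (by linarith)] with n hn
  linarith

section CLT
variable {Ω : Type*} {N : ℕ} {X φ : ℕ → ℕ → Ω → ℕ} [MeasurableSpace Ω] {P : Measure Ω} {q : ℕ → ℝ}
  {f : ℕ → ℝ}

/-- The characteristic function of `f` under the law of the offspring variables. -/
noncomputable def offspringCharFun (P : Measure Ω) (X : ℕ → ℕ → Ω → ℕ) (f : ℕ → ℝ) (t : ℝ) : ℂ :=
  charFun (P.map fun ω => f (X 0 0 ω)) t

lemma IsCBP.measurable_apply_offspring (h : IsCBP P q X φ) (f : ℕ → ℝ) (n j : ℕ) :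
    Measurable fun ω => f (X n j ω) :=
  (measurable_of_countable f).comp (h.measurable_offspring n j)

variable [IsProbabilityMeasure P]

lemma IsCBP.norm_offspringCharFun_le_one (h : IsCBP P q X φ) (f : ℕ → ℝ) (t : ℝ) :
    ‖offspringCharFun P X f t‖ ≤ 1 := by
  have := Measure.isProbabilityMeasure_map (μ := P)
    (h.measurable_apply_offspring f 0 0).aemeasurable
  exact norm_charFun_le_one t

lemma IsCBP.isLittleO_offspringCharFun (h : IsCBP P q X φ) (hf : Centered q f 1) :
    (fun t : ℝ => offspringCharFun P X f t - (1 - t ^ 2 / 2)) =o[𝓝 0] fun t => t ^ 2 := by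
  refine taylor_charFun_two (h.measurable_apply_offspring f 0 0).aemeasurable
    (h.integral_eq_zero hf 0 0) ?_
  exact h.integral_sq hf 0 0

lemma IsCBP.map_offspring_eq (h : IsCBP P q X φ) (f : ℕ → ℝ) (n j : ℕ) :
    P.map (fun ω => f (X n j ω)) = P.map fun ω => f (X 0 0 ω) := by
  have h1 : P.map (X n j) = P.map (X 0 0) := by
    have i1 := Measure.isProbabilityMeasure_map (μ := P) (h.measurable_offspring n j).aemeasurable
    have i2 := Measure.isProbabilityMeasure_map (μ := P) (h.measurable_offspring 0 0).aemeasurable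
    refine Measure.ext_of_singleton fun k => ?_
    rw [← ofReal_measureReal, ← ofReal_measureReal, h.map_offspring, h.map_offspring]
  have h2 := congrArg (Measure.map f) h1
  rwa [Measure.map_map (measurable_of_countable f) (h.measurable_offspring n j),
    Measure.map_map (measurable_of_countable f) (h.measurable_offspring 0 0)] at h2

lemma IsCBP.integral_expI_sum (h : IsCBP P q X φ) (f : ℕ → ℝ) (n r : ℕ) (a : ℝ) :
    ∫ ω, expI (a * ∑ i ∈ Finset.range r, f (X n i ω)) ∂P = offspringCharFun P X f a ^ r := by
  have hm := fun j => (h.measurable_apply_offspring f n j)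
  have h1 := iIndepFun.charFun_map_fun_finsetSum_eq_prod (P := P) (s := Finset.range r)
    (X := fun j ω => f (X n j ω)) (fun j _ => (hm j).aemeasurable)
    ((h.iIndepFun_generation f n).restrict _)
  have h2 := congrFun h1 a
  rw [charFun_apply_real, integral_map (Finset.measurable_sum _ fun j _ => hm j).aemeasurable
    (by fun_prop), Finset.prod_apply, Finset.prod_congr rfl fun j _ => by
      rw [h.map_offspring_eq f n j]] at h2
  rw [Finset.prod_const, Finset.card_range] at h2
  refine Eq.trans ?_ h2
  refine integral_congr_ae (Eventually.of_forall fun ω => ?_)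
  simp [expI]

/-- The conditional characteristic function of `normSum f (n + 1)` at `t` given the history of
generation `n`. -/
noncomputable def condCharFun (P : Measure Ω) (N : ℕ) (X φ : ℕ → ℕ → Ω → ℕ) (f : ℕ → ℝ) (t : ℝ)
    (n : ℕ) (ω : Ω) : ℂ :=
  expI (t / √(totalProgenitors N X φ (n + 1) ω : ℝ) *
    ∑ l ∈ Finset.range n, genSum N X φ f l ω) *
  offspringCharFun P X f (t / √(totalProgenitors N X φ (n + 1) ω : ℝ)) ^ progenitors N X φ n ω

/-- The weight `ξ` is there to be the conditional probability of survival, which is determined by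
the history whereas survival is not. The normalisation is `Δ_n`, also known from the history, so
only the last generation is averaged. -/
lemma IsCBP.integral_mul_expI_normSum (h : IsCBP P q X φ) (f : ℕ → ℝ) (t : ℝ) (n : ℕ) {ξ : Ω → ℝ}
    (hξ : Measurable[history X φ n] ξ) (hi : Integrable ξ P) :
    ∫ ω, (ξ ω : ℂ) * expI (t * normSum N X φ f (n + 1) ω) ∂P =
      ∫ ω, (ξ ω : ℂ) * condCharFun P N X φ f t n ω ∂P := by
  have hθ : Measurable[history X φ n] fun ω => t / √(totalProgenitors N X φ (n + 1) ω : ℝ) :=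
    Measurable.const_div (measurable_from_top.comp (measurable_totalProgenitors_history n)).sqrt t
  have hS : Measurable[history X φ n] fun ω => ∑ l ∈ Finset.range n, genSum N X φ f l ω :=
    Finset.measurable_sum _ fun l hl => measurable_genSum_history f (Finset.mem_range.1 hl)
  have hζ : Measurable[history X φ n] fun ω => (ξ ω : ℂ) *
      expI (t / √(totalProgenitors N X φ (n + 1) ω : ℝ) *
        ∑ l ∈ Finset.range n, genSum N X φ f l ω) :=
    (Complex.measurable_ofReal.comp hξ).mul (measurable_expI.comp (hθ.mul hS))
  have hA := (measurable_progenitors_history (N := N) (X := X) (φ := φ) (le_refl n)).prodMk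
    (hθ.prodMk hζ)
  have hF : Measurable fun z : (ℕ × ℝ × ℂ) × (ℕ → ℕ) =>
      z.1.2.2 * expI (z.1.2.1 * ∑ i ∈ Finset.range z.1.1, f (z.2 i)) := by
    have h1 := (IsCBP.measurable_sum_generation f).comp
      ((measurable_fst.comp measurable_fst).prodMk measurable_snd :
        Measurable fun z : (ℕ × ℝ × ℂ) × (ℕ → ℕ) => (z.1.1, z.2))
    have h2 : Measurable fun z : (ℕ × ℝ × ℂ) × (ℕ → ℕ) => z.1.2.1 := by fun_prop
    have h3 : Measurable fun z : (ℕ × ℝ × ℂ) × (ℕ → ℕ) => z.1.2.2 := by fun_prop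
    exact h3.mul (measurable_expI.comp (h2.mul h1))
  have heq : ∀ ω, (ξ ω : ℂ) * expI (t * normSum N X φ f (n + 1) ω) =
      (ξ ω : ℂ) * expI (t / √(totalProgenitors N X φ (n + 1) ω : ℝ) *
        ∑ l ∈ Finset.range n, genSum N X φ f l ω) *
      expI (t / √(totalProgenitors N X φ (n + 1) ω : ℝ) *
        ∑ i ∈ Finset.range (progenitors N X φ n ω), f (X n i ω)) := fun ω => by
    rw [mul_assoc, ← expI_add, normSum, Finset.sum_range_succ, ← mul_add, genSum]
    congr 2
    ring
  have hle := h.history_le n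
  have hint : Integrable (fun ω => (ξ ω : ℂ) * expI (t * normSum N X φ f (n + 1) ω)) P := by
    refine hi.ofReal.mul_bdd (c := 1) ?_ ?_
    · exact (measurable_expI.comp ((h.measurable_normSum f (n + 1)).const_mul t)).aestronglyMeasurable
    · exact Eventually.of_forall fun ω => (norm_expI _).le
  have h1 := integral_indep (P := P) (hA.mono hle le_rfl) (h.measurable_generation n)
    (h.indepFun_of_history hA) hF (by simpa only [heq] using hint)
  simp_rw [heq]
  refine h1.trans (integral_congr_ae (Eventually.of_forall fun ω => ?_))
  dsimp only
  rw [integral_const_mul, h.integral_expI_sum, condCharFun, mul_assoc]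

lemma IsCBP.norm_condCharFun_le_one (h : IsCBP P q X φ) (f : ℕ → ℝ) (t : ℝ) (n : ℕ) (ω : Ω) :
    ‖condCharFun P N X φ f t n ω‖ ≤ 1 := by
  rw [condCharFun, norm_mul, norm_expI, one_mul, norm_pow]
  exact pow_le_one₀ (norm_nonneg _) (h.norm_offspringCharFun_le_one f _)

lemma IsCBP.measurable_condCharFun (h : IsCBP P q X φ) (f : ℕ → ℝ) (t : ℝ) (n : ℕ) :
    Measurable (condCharFun P N X φ f t n) := by
  have := Measure.isProbabilityMeasure_map (μ := P)
    (h.measurable_apply_offspring f 0 0).aemeasurable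
  have hθ : Measurable fun ω => t / √(totalProgenitors N X φ (n + 1) ω : ℝ) :=
    Measurable.const_div (measurable_from_top.comp (h.measurable_totalProgenitors (n + 1))).sqrt t
  refine (measurable_expI.comp (hθ.mul (Finset.measurable_sum _ fun l _ =>
    h.measurable_genSum f l))).mul ?_
  exact measurable_apply_nat (f := fun r ω =>
      offspringCharFun P X f (t / √(totalProgenitors N X φ (n + 1) ω : ℝ)) ^ r)
    (fun r => ((measurable_charFun).comp hθ).pow_const r) (h.measurable_progenitors n)

end CLT

/-! ### The central limit theorem on the survival event -/

section CLT
variable {Ω : Type*} {N : ℕ} {X φ : ℕ → ℕ → Ω → ℕ} {s : ℝ}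

lemma GeometricGrowth.tendsto_totalProgenitors {ω : Ω} (hs : 1 < s)
    (h : GeometricGrowth N X φ (s ^ 2) ω) :
    Tendsto (fun n => (totalProgenitors N X φ n ω : ℝ)) atTop atTop := by
  obtain ⟨V, hV, h⟩ := h
  have hρ : 1 < s ^ 2 := by nlinarith
  exact tendsto_natCast_atTop_atTop.comp (tendsto_atTop_of_div_pow hρ
    (div_pos hV (sub_pos.2 hρ)) (tendsto_sum_div_pow hρ h))

lemma GeometricGrowth.tendsto_sqrt_ratio {ω : Ω} (hs : 1 < s)
    (h : GeometricGrowth N X φ (s ^ 2) ω) :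
    Tendsto (fun n => √(totalProgenitors N X φ n ω : ℝ) / √(totalProgenitors N X φ (n + 1) ω : ℝ))
      atTop (𝓝 (1 / s)) := by
  obtain ⟨V, hV, h⟩ := h
  have hs0 : 0 < s := by linarith
  have hρ : 1 < s ^ 2 := by nlinarith
  have hU := div_pos hV (sub_pos.2 hρ)
  have h1 := tendsto_sum_div_pow hρ h
  have h2 := ((h1.div (h1.comp (tendsto_add_atTop_nat 1)) hU.ne').div_const (s ^ 2)).sqrt
  rw [div_self hU.ne', Real.sqrt_div zero_le_one, Real.sqrt_one, Real.sqrt_sq hs0.le] at h2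
  refine h2.congr fun n => ?_
  rw [← Real.sqrt_div (Nat.cast_nonneg _)]
  congr 1
  simp only [Pi.div_apply, Function.comp_apply, totalProgenitors, progenitors]
  rw [pow_succ (s ^ 2) n]
  field_simp

lemma GeometricGrowth.tendsto_progenitors_mul_sq {ω : Ω} (hs : 1 < s)
    (h : GeometricGrowth N X φ (s ^ 2) ω) (t : ℝ) :
    Tendsto (fun n => progenitors N X φ n ω *
      (t / √(totalProgenitors N X φ (n + 1) ω : ℝ)) ^ 2) atTop (𝓝 (t ^ 2 * (1 - 1 / s ^ 2))) := by
  obtain ⟨V, hV, h⟩ := h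
  have hs0 : 0 < s := by linarith
  have hρ : 1 < s ^ 2 := by nlinarith
  have hρ' := sub_pos.2 hρ
  have hU := div_pos hV hρ'
  have h1 := tendsto_sum_div_pow hρ h
  have h2 := ((h.div (h1.comp (tendsto_add_atTop_nat 1)) hU.ne').mul_const (t ^ 2 / s ^ 2))
  have h3 : V / (V / (s ^ 2 - 1)) * (t ^ 2 / s ^ 2) = t ^ 2 * (1 - 1 / s ^ 2) := by
    field_simp
  rw [h3] at h2
  refine h2.congr fun n => ?_
  rw [div_pow, Real.sq_sqrt (Nat.cast_nonneg _)]
  simp only [Pi.div_apply, Function.comp_apply, totalProgenitors, progenitors]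
  rw [pow_succ (s ^ 2) n]
  field_simp

lemma normSum_mul_sqrt (f : ℕ → ℝ) (n : ℕ) (ω : Ω) :
    normSum N X φ f n ω * √(totalProgenitors N X φ n ω : ℝ) =
      ∑ l ∈ Finset.range n, genSum N X φ f l ω := by
  rcases Nat.eq_zero_or_pos (totalProgenitors N X φ n ω) with h0 | h0
  · rw [h0, Nat.cast_zero, Real.sqrt_zero, mul_zero]
    refine (Finset.sum_eq_zero fun l hl => ?_).symm
    have : progenitors N X φ l ω = 0 := (Finset.sum_eq_zero_iff.1 h0) l hl
    rw [genSum, this, Finset.sum_range_zero]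
  · exact div_mul_cancel₀ _ (Real.sqrt_pos.2 (by exact_mod_cast h0)).ne'

lemma totalProgenitors_mono (ω : Ω) : Monotone fun n => totalProgenitors N X φ n ω :=
  monotone_nat_of_le_succ fun n => by
    simp only [totalProgenitors, Finset.sum_range_succ]
    exact Nat.le_add_right _ _

lemma sqrt_ratio_mem (n : ℕ) (ω : Ω) :
    √(totalProgenitors N X φ n ω : ℝ) / √(totalProgenitors N X φ (n + 1) ω : ℝ) ∈ Icc (0 : ℝ) 1 :=
  ⟨by positivity, div_le_one_of_le₀ (Real.sqrt_le_sqrt (by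
    exact_mod_cast totalProgenitors_mono ω n.le_succ)) (Real.sqrt_nonneg _)⟩

variable [MeasurableSpace Ω] {P : Measure Ω} {q f : ℕ → ℝ} [IsProbabilityMeasure P]

/-- Lévy's upward theorem: survival is determined by the sequence of generation sizes, hence by the
union of the histories. -/
lemma IsCBP.tendsto_eLpNorm_condExp_survival (h : IsCBP P q X φ) :
    Tendsto (fun n => ∫ ω, ‖(P[(survival N X φ).indicator (fun _ => (1 : ℝ)) | history X φ n]) ω -
      (survival N X φ).indicator (fun _ => (1 : ℝ)) ω‖ ∂P) atTop (𝓝 0) := by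
  let ℱ : Filtration ℕ ‹MeasurableSpace Ω› := ⟨fun n => history X φ n, history_mono, h.history_le⟩
  have hm : MeasurableSet[⨆ n, ℱ n] (survival N X φ) :=
    measurableSet_survival fun n => (measurable_Z_history n).mono (le_iSup (fun n => ℱ n) n) le_rfl
  have hi : Integrable ((survival N X φ).indicator fun _ => (1 : ℝ)) P :=
    (integrable_const 1).indicator (measurableSet_survival h.measurable_Z)
  have h1 := hi.tendsto_eLpNorm_condExp (ℱ := ℱ) (stronglyMeasurable_const.indicator hm)
  have h2 := (ENNReal.tendsto_toReal ENNReal.zero_ne_top).comp h1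
  refine h2.congr fun n => ?_
  have h3 : Integrable (P[(survival N X φ).indicator (fun _ => (1 : ℝ)) | ℱ n] -
    (survival N X φ).indicator fun _ => (1 : ℝ)) P := integrable_condExp.sub hi
  rw [Function.comp_apply, eLpNorm_one_eq_lintegral_enorm,
    ← integral_norm_eq_lintegral_enorm h3.1]
  rfl

/-- A bound for an integral over the survival event through the tightness of `normSum`. -/
lemma IsCBP.norm_setIntegral_survival_le (h : IsCBP P q X φ) {H : Ω → ℂ} {B : Ω → ℝ} {M : ℝ} {n : ℕ}
    (h2 : ∀ ω, ‖H ω‖ ≤ 2) (hB : Integrable B P) (hB0 : ∀ ω, 0 ≤ B ω)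
    (hHB : ∀ ω, |normSum N X φ f n ω| < M → ‖H ω‖ ≤ B ω) :
    ‖∫ ω in survival N X φ, H ω ∂P‖ ≤
      2 * P.real (survival N X φ ∩ {ω | M ≤ |normSum N X φ f n ω|}) +
        ∫ ω in survival N X φ, B ω ∂P := by
  have hA : MeasurableSet {ω | M ≤ |normSum N X φ f n ω|} :=
    measurableSet_le measurable_const (continuous_abs.measurable.comp (h.measurable_normSum f n))
  have hi : Integrable ({ω | M ≤ |normSum N X φ f n ω|}.indicator fun _ => (2 : ℝ))
    (P.restrict (survival N X φ)) := (integrable_const _).indicator hA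
  calc _ ≤ ∫ ω in survival N X φ, ‖H ω‖ ∂P := norm_integral_le_integral_norm _
    _ ≤ ∫ ω in survival N X φ, ({ω | M ≤ |normSum N X φ f n ω|}.indicator (fun _ => (2 : ℝ)) ω +
        B ω) ∂P := by
        refine integral_mono_of_nonneg (Eventually.of_forall fun ω => norm_nonneg _)
          (hi.add hB.integrableOn) (Eventually.of_forall fun ω => ?_)
        by_cases hω : M ≤ |normSum N X φ f n ω|
        · simp only [indicator_of_mem (show ω ∈ {ω | M ≤ |normSum N X φ f n ω|} from hω)]
          linarith [h2 ω, hB0 ω]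
        · simp only [indicator_of_notMem (show ω ∉ {ω | M ≤ |normSum N X φ f n ω|} from hω)]
          linarith [hHB ω (not_le.1 hω)]
    _ = _ := by
        rw [integral_add hi hB.integrableOn, integral_indicator hA, setIntegral_const,
          smul_eq_mul, measureReal_restrict_apply hA, inter_comm, mul_comm]

lemma IsCBP.integrable_expI (h : IsCBP P q X φ) (f : ℕ → ℝ) (t : ℝ) (n : ℕ) :
    Integrable (fun ω => expI (t * normSum N X φ f n ω)) P :=
  (integrable_const (1 : ℝ)).mono'
    (measurable_expI.comp ((h.measurable_normSum f n).const_mul t)).aestronglyMeasurable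
    (Eventually.of_forall fun _ => (norm_expI _).le)

/-- For small `t` both quantities are close to `P(survival)`; tightness makes this uniform in large
`n`. -/
lemma IsCBP.exists_forall_norm_setIntegral_le (h : IsCBP P q X φ) (hf : Centered q f 1) (hs : 1 < s)
    (hg : ∀ᵐ ω ∂P, ω ∈ survival N X φ → GeometricGrowth N X φ (s ^ 2) ω) {ε : ℝ} (hε : 0 < ε) :
    ∃ δ > 0, ∀ᶠ n in atTop, ∀ t, |t| ≤ δ →
      ‖∫ ω in survival N X φ, expI (t * normSum N X φ f n ω) ∂P -
        P.real (survival N X φ) * Complex.exp (-(t ^ 2 / 2 : ℝ))‖ ≤ ε := by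
  obtain ⟨M, hM, htight⟩ := h.tight_normSum hf hs hg (ε := ENNReal.ofReal (ε / 4))
    (by simpa using hε)
  -- The budget is `2 · ε / 4` for the tail event, `ε / 4` for `|t| M`, and `ε / 4` for the Gaussian
  -- factor, where `t² / 2 ≤ |t| / 2 ≤ ε / 4`.
  refine ⟨min (min 1 (ε / (4 * M))) (ε / 2), by positivity, ?_⟩
  filter_upwards [htight] with n hn t ht
  have ht1 : |t| ≤ 1 := ht.trans ((min_le_left _ _).trans (min_le_left _ _))
  have ht2 : |t| * M ≤ ε / 4 := by
    have := ht.trans ((min_le_left _ _).trans (min_le_right _ _))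
    rw [le_div_iff₀ (by positivity)] at this
    linarith
  have ht3 : |t| ≤ ε / 2 := ht.trans (min_le_right _ _)
  have hP : P.real (survival N X φ) ≤ 1 := measureReal_le_one
  have h1 : ∫ ω in survival N X φ, expI (t * normSum N X φ f n ω) ∂P -
        P.real (survival N X φ) * Complex.exp (-(t ^ 2 / 2 : ℝ)) =
      ∫ ω in survival N X φ, (expI (t * normSum N X φ f n ω) - 1) ∂P +
        P.real (survival N X φ) * (1 - Complex.exp (-(t ^ 2 / 2 : ℝ))) := by
    rw [integral_sub (h.integrable_expI f t n).integrableOn (integrable_const _), setIntegral_const,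
      Complex.real_smul]
    ring
  have h2 := h.norm_setIntegral_survival_le (N := N) (f := f) (n := n) (M := M)
    (H := fun ω => expI (t * normSum N X φ f n ω) - 1) (B := fun _ => |t| * M)
    (fun ω => (norm_sub_le _ _).trans (by rw [norm_expI, norm_one]; norm_num))
    (integrable_const _) (fun _ => by positivity) (fun ω hω => by
      have := norm_expI_sub_le (t * normSum N X φ f n ω) 0
      rw [expI_zero, sub_zero, abs_mul] at this
      exact this.trans (by gcongr))
  have h3 : P.real (survival N X φ ∩ {ω | M ≤ |normSum N X φ f n ω|}) ≤ ε / 4 :=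
    ENNReal.toReal_le_of_le_ofReal (by positivity) hn
  have h4 : ∫ _ in survival N X φ, |t| * M ∂P ≤ ε / 4 := by
    rw [setIntegral_const, smul_eq_mul]
    nlinarith [measureReal_nonneg (μ := P) (s := survival N X φ), abs_nonneg t]
  have h5 : ‖(P.real (survival N X φ) : ℂ) * (1 - Complex.exp (-(t ^ 2 / 2 : ℝ)))‖ ≤ ε / 4 := by
    have h6 : (1 - Complex.exp (-(t ^ 2 / 2 : ℝ))) = ((1 - Real.exp (-(t ^ 2 / 2)) : ℝ) : ℂ) := by
      push_cast; rfl
    rw [h6, norm_mul, Complex.norm_real, Complex.norm_real, Real.norm_of_nonneg measureReal_nonneg,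
      Real.norm_of_nonneg (sub_nonneg.2 (Real.exp_le_one_iff.2 (by nlinarith [sq_nonneg t])))]
    have h7 := Real.add_one_le_exp (-(t ^ 2 / 2))
    have h8 : t ^ 2 ≤ |t| := by
      rw [← sq_abs]; nlinarith [abs_nonneg t]
    have h9 : 0 ≤ 1 - Real.exp (-(t ^ 2 / 2)) :=
      sub_nonneg.2 (Real.exp_le_one_iff.2 (by nlinarith [sq_nonneg t]))
    nlinarith [measureReal_nonneg (μ := P) (s := survival N X φ)]
  rw [h1]
  refine (norm_add_le _ _).trans ?_
  linarith

/-- The indicator of survival is exchanged for its conditional probability, the last generation is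
averaged, and the indicator is put back. Each exchange costs the same `L¹` distance, hence the
factor `2`. -/
lemma IsCBP.tendsto_setIntegral_sub_condCharFun (h : IsCBP P q X φ) (f : ℕ → ℝ) (t : ℝ) :
    Tendsto (fun n => ∫ ω in survival N X φ, expI (t * normSum N X φ f (n + 1) ω) ∂P -
      ∫ ω in survival N X φ, condCharFun P N X φ f t n ω ∂P) atTop (𝓝 0) := by
  have hS : MeasurableSet (survival N X φ) := measurableSet_survival h.measurable_Z
  set I : Ω → ℝ := (survival N X φ).indicator (fun _ => (1 : ℝ)) with hI
  set ξ : ℕ → Ω → ℝ := fun n => P[I | history X φ n] with hξ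
  have hIi : Integrable I P := (integrable_const 1).indicator hS
  have hξi : ∀ n, Integrable (ξ n) P := fun n => integrable_condExp
  have key : ∀ n (K : Ω → ℂ), Measurable K → (∀ ω, ‖K ω‖ ≤ 1) →
      ‖∫ ω, (ξ n ω : ℂ) * K ω ∂P - ∫ ω in survival N X φ, K ω ∂P‖ ≤ ∫ ω, ‖ξ n ω - I ω‖ ∂P := by
    intro n K hK hK1
    have e1 : ∫ ω in survival N X φ, K ω ∂P = ∫ ω, (I ω : ℂ) * K ω ∂P := by
      rw [← integral_indicator hS]
      refine integral_congr_ae (Eventually.of_forall fun ω => ?_)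
      by_cases hω : ω ∈ survival N X φ <;> simp [hI, hω]
    have i1 : Integrable (fun ω => (ξ n ω : ℂ) * K ω) P :=
      (hξi n).ofReal.mul_bdd hK.aestronglyMeasurable (Eventually.of_forall hK1)
    have i2 : Integrable (fun ω => (I ω : ℂ) * K ω) P :=
      hIi.ofReal.mul_bdd hK.aestronglyMeasurable (Eventually.of_forall hK1)
    rw [e1, ← integral_sub i1 i2]
    refine (norm_integral_le_integral_norm _).trans (integral_mono_of_nonneg
      (Eventually.of_forall fun _ => norm_nonneg _) ((hξi n).sub hIi).norm
      (Eventually.of_forall fun ω => ?_))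
    dsimp only
    rw [← sub_mul, norm_mul, ← Complex.ofReal_sub, Complex.norm_real]
    exact mul_le_of_le_one_right (norm_nonneg _) (hK1 ω)
  have hlim := (h.tendsto_eLpNorm_condExp_survival (N := N)).const_mul 2
  rw [mul_zero] at hlim
  refine squeeze_zero_norm (fun n => ?_) hlim
  have k1 := key n (fun ω => expI (t * normSum N X φ f (n + 1) ω))
    (measurable_expI.comp ((h.measurable_normSum f (n + 1)).const_mul t))
    fun ω => (norm_expI _).le
  have k2 := key n (condCharFun P N X φ f t n) (h.measurable_condCharFun f t n)
    (h.norm_condCharFun_le_one f t n)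
  rw [h.integral_mul_expI_normSum f t n stronglyMeasurable_condExp.measurable (hξi n)] at k1
  rw [norm_sub_rev] at k1
  have := norm_sub_le_norm_sub_add_norm_sub
    (∫ ω in survival N X φ, expI (t * normSum N X φ f (n + 1) ω) ∂P)
    (∫ ω, (ξ n ω : ℂ) * condCharFun P N X φ f t n ω ∂P)
    (∫ ω in survival N X φ, condCharFun P N X φ f t n ω ∂P)
  change _ ≤ 2 * ∫ ω, ‖ξ n ω - I ω‖ ∂P
  linarith

/-- The random ratio `√(Δ_{n-1} / Δ_n)` is replaced by its limit `1 / s`. The error is at most `|t|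
M |ratio - 1 / s|` where `|normSum| < M`, and the rest is controlled by tightness. -/
lemma IsCBP.tendsto_setIntegral_expI_ratio_sub (h : IsCBP P q X φ) (hf : Centered q f 1) (hs : 1 < s)
    (hg : ∀ᵐ ω ∂P, ω ∈ survival N X φ → GeometricGrowth N X φ (s ^ 2) ω) (t : ℝ) :
    Tendsto (fun n => ∫ ω in survival N X φ, (expI (t / √(totalProgenitors N X φ (n + 1) ω : ℝ) *
      ∑ l ∈ Finset.range n, genSum N X φ f l ω) - expI (t / s * normSum N X φ f n ω)) ∂P)
      atTop (𝓝 0) := by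
  have hS : MeasurableSet (survival N X φ) := measurableSet_survival h.measurable_Z
  have hs0 : 0 < s := by linarith
  set r : ℕ → Ω → ℝ := fun n ω =>
    √(totalProgenitors N X φ n ω : ℝ) / √(totalProgenitors N X φ (n + 1) ω : ℝ) with hr
  have hrm : ∀ n, Measurable (r n) := fun n =>
    (measurable_from_top.comp (h.measurable_totalProgenitors n)).sqrt.div
      (measurable_from_top.comp (h.measurable_totalProgenitors (n + 1))).sqrt
  have hrb : ∀ n ω, ‖|r n ω - 1 / s|‖ ≤ 1 := fun n ω => by
    have h1 := sqrt_ratio_mem (N := N) (X := X) (φ := φ) n ω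
    have h2 : 1 / s ≤ 1 := (div_le_one hs0).2 hs.le
    have h3 : 0 < 1 / s := by positivity
    rw [Real.norm_eq_abs, abs_abs]
    exact abs_le.2 ⟨by linarith [h1.1], by linarith [h1.2]⟩
  have hra : ∀ n, Measurable fun ω => |r n ω - 1 / s| := fun n =>
    continuous_abs.measurable.comp ((hrm n).sub_const _)
  have hri : ∀ n, Integrable (fun ω => |r n ω - 1 / s|) P := fun n =>
    (integrable_const (1 : ℝ)).mono' (hra n).aestronglyMeasurable (Eventually.of_forall (hrb n))
  have hlim : Tendsto (fun n => ∫ ω in survival N X φ, |r n ω - 1 / s| ∂P) atTop (𝓝 0) := by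
    have := tendsto_integral_of_dominated_convergence (μ := P.restrict (survival N X φ))
      (F := fun n ω => |r n ω - 1 / s|) (f := fun _ => (0 : ℝ)) (fun _ => 1)
      (fun n => (hra n).aestronglyMeasurable) (integrable_const _)
      (fun n => Eventually.of_forall (hrb n)) ?_
    · simpa using this
    · filter_upwards [ae_restrict_of_ae hg, ae_restrict_mem hS] with ω h1 h2
      have h3 := ((h1 h2).tendsto_sqrt_ratio hs).sub_const (1 / s)
      rw [sub_self] at h3
      simpa using h3.abs
  rw [Metric.tendsto_nhds]
  intro ε hε
  obtain ⟨M, hM, htight⟩ := h.tight_normSum hf hs hg (ε := ENNReal.ofReal (ε / 8))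
    (by simpa using hε)
  have hlim2 := hlim.const_mul (|t| * M)
  rw [mul_zero] at hlim2
  filter_upwards [htight, hlim2.eventually_lt_const (half_pos hε)] with n hn hn2
  have h1 := h.norm_setIntegral_survival_le (N := N) (f := f) (n := n) (M := M)
    (H := fun ω => expI (t / √(totalProgenitors N X φ (n + 1) ω : ℝ) *
      ∑ l ∈ Finset.range n, genSum N X φ f l ω) - expI (t / s * normSum N X φ f n ω))
    (B := fun ω => |t| * M * |r n ω - 1 / s|)
    (fun ω => (norm_sub_le _ _).trans (by rw [norm_expI, norm_expI]; norm_num))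
    ((hri n).const_mul _) (fun ω => by positivity) (fun ω hω => by
      refine (norm_expI_sub_le _ _).trans ?_
      rw [← normSum_mul_sqrt]
      have : t / √(totalProgenitors N X φ (n + 1) ω : ℝ) *
          (normSum N X φ f n ω * √(totalProgenitors N X φ n ω : ℝ)) -
          t / s * normSum N X φ f n ω = t * normSum N X φ f n ω * (r n ω - 1 / s) := by
        rw [hr]; ring
      rw [this, abs_mul, abs_mul]
      gcongr)
  have h3 : P.real (survival N X φ ∩ {ω | M ≤ |normSum N X φ f n ω|}) ≤ ε / 8 :=
    ENNReal.toReal_le_of_le_ofReal (by positivity) hn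
  rw [integral_const_mul] at h1
  rw [dist_zero_right]
  linarith

/-- The last generation holds the asymptotic share `1 - 1 / s²` of all progenitors, so its factor
converges to a Gaussian characteristic function with that variance. -/
lemma IsCBP.tendsto_setIntegral_condCharFun_sub (h : IsCBP P q X φ) (hf : Centered q f 1)
    (hs : 1 < s) (hg : ∀ᵐ ω ∂P, ω ∈ survival N X φ → GeometricGrowth N X φ (s ^ 2) ω) (t : ℝ) :
    Tendsto (fun n => ∫ ω in survival N X φ, condCharFun P N X φ f t n ω ∂P -
      Complex.exp (-(t ^ 2 * (1 - 1 / s ^ 2) / 2 : ℝ)) *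
        ∫ ω in survival N X φ, expI (t / s * normSum N X φ f n ω) ∂P) atTop (𝓝 0) := by
  have hS : MeasurableSet (survival N X φ) := measurableSet_survival h.measurable_Z
  set γ : ℂ := Complex.exp (-(t ^ 2 * (1 - 1 / s ^ 2) / 2 : ℝ)) with hγ
  set A : ℕ → Ω → ℂ := fun n ω => expI (t / √(totalProgenitors N X φ (n + 1) ω : ℝ) *
      ∑ l ∈ Finset.range n, genSum N X φ f l ω) with hA
  have hAm : ∀ n, Measurable (A n) := fun n =>
    measurable_expI.comp ((Measurable.const_div (measurable_from_top.comp
      (h.measurable_totalProgenitors (n + 1))).sqrt t).mul (Finset.measurable_sum _ fun l _ =>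
      h.measurable_genSum f l))
  have hAi : ∀ n, Integrable (A n) P := fun n => (integrable_const (1 : ℝ)).mono'
    (hAm n).aestronglyMeasurable (Eventually.of_forall fun _ => (norm_expI _).le)
  have hKi : ∀ n, Integrable (condCharFun P N X φ f t n) P := fun n =>
    (integrable_const (1 : ℝ)).mono' (h.measurable_condCharFun f t n).aestronglyMeasurable
      (Eventually.of_forall (h.norm_condCharFun_le_one f t n))
  have h1 : Tendsto (fun n => ∫ ω in survival N X φ,
      (condCharFun P N X φ f t n ω - γ * A n ω) ∂P) atTop (𝓝 0) := by
    have := tendsto_integral_of_dominated_convergence (μ := P.restrict (survival N X φ))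
      (F := fun n ω => condCharFun P N X φ f t n ω - γ * A n ω) (f := fun _ => (0 : ℂ))
      (fun _ => 1 + ‖γ‖)
      (fun n => ((h.measurable_condCharFun f t n).sub ((hAm n).const_mul γ)).aestronglyMeasurable)
      (integrable_const _)
      (fun n => Eventually.of_forall fun ω => (norm_sub_le _ _).trans (add_le_add
        (h.norm_condCharFun_le_one f t n ω) (by rw [norm_mul, hA]; simp [norm_expI]))) ?_
    · simpa using this
    · filter_upwards [ae_restrict_of_ae hg, ae_restrict_mem hS] with ω h2 h3
      have h4 := h2 h3
      have hθ : Tendsto (fun n => t / √(totalProgenitors N X φ (n + 1) ω : ℝ)) atTop (𝓝 0) :=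
        tendsto_const_nhds.div_atTop (Real.tendsto_sqrt_atTop.comp
          ((h4.tendsto_totalProgenitors hs).comp (tendsto_add_atTop_nat 1)))
      have h5 := tendsto_pow_of_isLittleO (h.norm_offspringCharFun_le_one f)
        (h.isLittleO_offspringCharFun hf) hθ (h4.tendsto_progenitors_mul_sq hs t)
      have h6 := (h5.sub_const γ).norm
      rw [hγ, sub_self, norm_zero] at h6
      refine squeeze_zero_norm (fun n => le_of_eq ?_) h6
      have h7 : condCharFun P N X φ f t n ω - γ * A n ω = A n ω *
          (offspringCharFun P X f (t / √(totalProgenitors N X φ (n + 1) ω : ℝ)) ^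
            progenitors N X φ n ω - γ) := by
        rw [condCharFun, hA]; ring
      rw [h7, norm_mul, hA, norm_expI, one_mul]
  have h2 := h1.add ((h.tendsto_setIntegral_expI_ratio_sub hf hs hg t).const_mul γ)
  rw [mul_zero, add_zero] at h2
  refine h2.congr fun n => ?_
  have hi := (h.integrable_expI (N := N) f (t / s) n).integrableOn (s := survival N X φ)
  rw [integral_sub (hKi n).integrableOn ((hAi n).const_mul γ).integrableOn,
    integral_sub (hAi n).integrableOn hi, integral_const_mul]
  ring

/-- The central limit theorem: on the survival event, the normalised sums are asymptotically standard
normal and independent of that event. -/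
lemma IsCBP.tendsto_setIntegral_expI (h : IsCBP P q X φ) (hf : Centered q f 1)
    (hs : 1 < s) (hg : ∀ᵐ ω ∂P, ω ∈ survival N X φ → GeometricGrowth N X φ (s ^ 2) ω) (t : ℝ) :
    Tendsto (fun n => ∫ ω in survival N X φ, expI (t * normSum N X φ f n ω) ∂P) atTop
      (𝓝 (P.real (survival N X φ) * Complex.exp (-(t ^ 2 / 2 : ℝ)))) := by
  rw [tendsto_iff_norm_sub_tendsto_zero]
  refine tendsto_zero_of_contraction hs (g := fun n t =>
    ‖∫ ω in survival N X φ, expI (t * normSum N X φ f n ω) ∂P -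
      P.real (survival N X φ) * Complex.exp (-(t ^ 2 / 2 : ℝ))‖)
    (e := fun n t => ‖∫ ω in survival N X φ, expI (t * normSum N X φ f (n + 1) ω) ∂P -
      Complex.exp (-(t ^ 2 * (1 - 1 / s ^ 2) / 2 : ℝ)) *
        ∫ ω in survival N X φ, expI (t / s * normSum N X φ f n ω) ∂P‖)
    (fun _ _ => norm_nonneg _) (fun t => ?_) (fun n t => ?_)
    (fun ε hε => h.exists_forall_norm_setIntegral_le hf hs hg hε) t
  · have := ((h.tendsto_setIntegral_sub_condCharFun (N := N) f t).add
      (h.tendsto_setIntegral_condCharFun_sub hf hs hg t)).norm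
    rw [add_zero, norm_zero] at this
    refine this.congr fun n => ?_
    rw [sub_add_sub_cancel]
  -- The Gaussian satisfies the limiting recursion exactly, as `t² = t² (1 - 1 / s²) + (t / s)²`.
  · have h1 : Complex.exp (-(t ^ 2 / 2 : ℝ)) =
        Complex.exp (-(t ^ 2 * (1 - 1 / s ^ 2) / 2 : ℝ)) *
          Complex.exp (-((t / s) ^ 2 / 2 : ℝ)) := by
      rw [← Complex.exp_add]
      congr 1
      push_cast
      ring
    have h2 : ‖Complex.exp (-(t ^ 2 * (1 - 1 / s ^ 2) / 2 : ℝ))‖ ≤ 1 := by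
      rw [← Complex.ofReal_neg, Complex.norm_exp_ofReal]
      have h3 : 1 / s ^ 2 ≤ 1 := (div_le_one (by positivity)).2 (by nlinarith)
      have h4 : 0 ≤ 1 - 1 / s ^ 2 := by linarith
      exact Real.exp_le_one_iff.2 (neg_nonpos.2 (by positivity))
    rw [h1]
    have h3 := norm_mul_le (Complex.exp (-(t ^ 2 * (1 - 1 / s ^ 2) / 2 : ℝ)))
      (∫ ω in survival N X φ, expI (t / s * normSum N X φ f n ω) ∂P -
        P.real (survival N X φ) * Complex.exp (-((t / s) ^ 2 / 2 : ℝ)))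
    have h4 := mul_le_mul_of_nonneg_right h2 (norm_nonneg
      (∫ ω in survival N X φ, expI (t / s * normSum N X φ f n ω) ∂P -
        P.real (survival N X φ) * Complex.exp (-((t / s) ^ 2 / 2 : ℝ))))
    rw [one_mul] at h4
    refine le_trans (le_of_eq ?_) ((norm_add_le _ _).trans (add_le_add le_rfl (h3.trans h4)))
    congr 1
    ring

end CLT

/-! ### The limit law of approximately linear functionals -/

section Limit
variable {Ω : Type*} {N : ℕ} {X φ : ℕ → ℕ → Ω → ℕ} {s : ℝ}

/-- The multiset of the offspring numbers of all progenitors before generation `n`. -/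
def offspringMultiset (N : ℕ) (X φ : ℕ → ℕ → Ω → ℕ) (n : ℕ) (ω : Ω) : Multiset ℕ :=
  ∑ l ∈ Finset.range n,
    Multiset.map (fun j => X l j ω) (Multiset.range (progenitors N X φ l ω))

lemma count_offspringMultiset (n k : ℕ) (ω : Ω) : (offspringMultiset N X φ n ω).count k =
    ∑ l ∈ Finset.range n, offspringCount N X φ l k ω := by
  rw [offspringMultiset, Multiset.count_sum']
  refine Finset.sum_congr rfl fun l _ => ?_
  rw [Multiset.count_map, offspringCount, Finset.card_def, Finset.filter_val, Finset.range_val]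
  simp only [eq_comm (a := k)]
  rfl

lemma card_offspringMultiset (n : ℕ) (ω : Ω) :
    (offspringMultiset N X φ n ω).card = totalProgenitors N X φ n ω := by
  simp [offspringMultiset, totalProgenitors, progenitors]

lemma sqrt_mul_tsum_mle (u : ℕ → ℝ) (n : ℕ) (ω : Ω) :
    √(totalProgenitors N X φ n ω : ℝ) * ∑' k, mle N X φ n ω k * u k = normSum N X φ u n ω := by
  rw [(mle_mul u n ω).tsum_eq, ← normSum_mul_sqrt]
  rcases (Nat.cast_nonneg (α := ℝ) (totalProgenitors N X φ n ω)).eq_or_lt with h0 | h0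
  · rw [normSum, ← h0]; simp
  · have := Real.sqrt_pos.2 h0
    have h1 := Real.mul_self_sqrt h0.le
    field_simp
    rw [pow_two, h1, mul_comm]

lemma normSum_div (u : ℕ → ℝ) (c : ℝ) (n : ℕ) (ω : Ω) :
    normSum N X φ (fun k => u k / c) n ω = normSum N X φ u n ω / c := by
  simp only [normSum, genSum, ← Finset.sum_div]
  ring

variable [MeasurableSpace Ω] {P : Measure Ω} {q : ℕ → ℝ}

lemma IsCBP.measurable_offspringCount (h : IsCBP P q X φ) (l k : ℕ) :
    Measurable (offspringCount N X φ l k) := by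
  refine measurable_apply_nat
    (f := fun r ω => ((Finset.range r).filter fun j => X l j ω = k).card) (fun r => ?_)
    (h.measurable_progenitors (N := N) l)
  simp only [Finset.card_filter]
  exact Finset.measurable_sum _ fun j _ => Measurable.ite
    (h.measurable_offspring l j (measurableSet_singleton k)) measurable_const measurable_const

/-- Since the empirical law takes countably many values, every function of it is measurable. -/
lemma IsCBP.measurable_comp_mle (h : IsCBP P q X φ) (F : (ℕ → ℝ) → ℝ) (n : ℕ) :
    Measurable fun ω => F (mle N X φ n ω) := by
  let _ : MeasurableSpace (Multiset ℕ) := ⊤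
  have h1 : Measurable (offspringMultiset N X φ n) := by
    refine measurable_to_countable' fun d => ?_
    have h2 : offspringMultiset N X φ n ⁻¹' {d} =
        ⋂ k, {ω | ∑ l ∈ Finset.range n, offspringCount N X φ l k ω = d.count k} := by
      ext ω
      simp only [mem_preimage, mem_singleton_iff, mem_iInter, Multiset.ext,
        count_offspringMultiset]
      rfl
    rw [h2]
    refine MeasurableSet.iInter fun k => ?_
    exact measurableSet_eq_fun (Finset.measurable_sum _ fun l _ => h.measurable_offspringCount l k)
      measurable_const
  have h2 : (fun ω => F (mle N X φ n ω)) =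
      (fun d : Multiset ℕ => F fun k => (d.count k : ℝ) / d.card) ∘ offspringMultiset N X φ n := by
    funext ω
    rw [Function.comp_apply]
    congr 1
    funext k
    rw [count_offspringMultiset, card_offspringMultiset, mle]
  rw [h2]
  exact measurable_from_top.comp h1

lemma Centered.div_sqrt {u : ℕ → ℝ} {v : ℝ} (hu : Centered q u v) (hv : 0 < v) :
    Centered q (fun k => u k / √v) 1 :=
  ⟨hu.isProb, hasSum_of_eq (hu.hasSum.div_const √v) (fun k => by ring) (by simp),
    hasSum_of_eq (hu.hasSum_sq.div_const v) (fun k => by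
      rw [div_pow, Real.sq_sqrt hv.le]; ring) (div_self hv.ne')⟩

variable [IsProbabilityMeasure P] {u : ℕ → ℝ} {v : ℝ}

lemma IsCBP.tendstoInDistribution_normSum (h : IsCBP P q X φ) (hu : Centered q u v) (hv : 0 < v)
    (hs : 1 < s) (hg : ∀ᵐ ω ∂P, ω ∈ survival N X φ → GeometricGrowth N X φ (s ^ 2) ω)
    (hP : P (survival N X φ) ≠ 0) [IsProbabilityMeasure (P[|survival N X φ])] :
    TendstoInDistribution (fun n ω => normSum N X φ u n ω / v) atTop (id : ℝ → ℝ)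
      (fun _ => P[|survival N X φ]) (gaussianReal 0 v⁻¹.toNNReal) := by
  have hm : ∀ n, Measurable fun ω => normSum N X φ u n ω / v := fun n =>
    (h.measurable_normSum u n).div_const v
  refine ⟨fun n => (hm n).aemeasurable, aemeasurable_id,
    ProbabilityMeasure.tendsto_iff_tendsto_charFun.2 fun t => ?_⟩
  have hlim := (h.tendsto_setIntegral_expI (hu.div_sqrt hv) hs hg (t / √v)).const_mul
    (((P (survival N X φ))⁻¹.toReal : ℝ) : ℂ)
  have hR : (((P (survival N X φ))⁻¹.toReal : ℝ) : ℂ) * (P.real (survival N X φ) : ℂ) = 1 := by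
    rw [← Complex.ofReal_mul, measureReal_def, ← ENNReal.toReal_mul,
      ENNReal.inv_mul_cancel hP (measure_ne_top _ _)]
    simp
  rw [← mul_assoc, hR, one_mul] at hlim
  have hvt : (t / √v) ^ 2 = v⁻¹ * t ^ 2 := by
    rw [div_pow, Real.sq_sqrt hv.le]; ring
  have hlimit : charFun ((gaussianReal 0 v⁻¹.toNNReal).map id) t =
      Complex.exp (-((t / √v) ^ 2 / 2 : ℝ)) := by
    rw [Measure.map_id, charFun_gaussianReal, hvt, Real.coe_toNNReal _ (inv_nonneg.2 hv.le)]
    congr 1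
    push_cast
    ring
  change Tendsto _ atTop (𝓝 (charFun ((gaussianReal 0 v⁻¹.toNNReal).map id) t))
  rw [hlimit]
  refine hlim.congr fun n => ?_
  change _ = charFun ((P[|survival N X φ]).map fun ω => normSum N X φ u n ω / v) t
  rw [charFun_apply_real, integral_map (hm n).aemeasurable (by fun_prop), ProbabilityTheory.cond,
    integral_smul_measure, Complex.real_smul]
  congr 1
  refine integral_congr_ae (Eventually.of_forall fun ω => ?_)
  simp only [normSum_div, expI]
  congr 2
  have hv2 : √v * √v = v := Real.mul_self_sqrt hv.le
  rw [div_mul_div_comm, hv2]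
  push_cast
  ring

/-- Almost sure convergence of the empirical law on survival turns any property valid near `q` into
one of asymptotically full probability. -/
lemma IsCBP.tendsto_measure_not_approx (h : IsCBP P q X φ) (hs : 1 < s)
    (hg : ∀ᵐ ω ∂P, ω ∈ survival N X φ → GeometricGrowth N X φ (s ^ 2) ω)
    {A : (ℕ → ℝ) → Prop} (hA : ∀ᶠ r in 𝓝[finiteLaws q] q, A r) :
    Tendsto (fun n => P (survival N X φ ∩ {ω | ¬ A (mle N X φ n ω)})) atTop (𝓝 0) := by
  classical
  have hS : MeasurableSet (survival N X φ) := measurableSet_survival h.measurable_Z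
  have hρ : 1 < s ^ 2 := by nlinarith
  have hm : ∀ n, MeasurableSet {ω | ¬ A (mle N X φ n ω)} := fun n => by
    have := h.measurable_comp_mle (N := N) (fun r => if A r then 1 else 0) n
      (measurableSet_singleton (0 : ℝ))
    convert this using 1
    ext ω
    by_cases hω : A (mle N X φ n ω) <;> simp [hω]
  have := tendsto_measure_of_ae_tendsto_indicator_of_isFiniteMeasure (μ := P) atTop
    (A := ∅) (As := fun n => survival N X φ ∩ {ω | ¬ A (mle N X φ n ω)}) MeasurableSet.empty
    (fun n => hS.inter (hm n)) ?_
  · rwa [measure_empty] at this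
  · filter_upwards [hg, h.ae_tendsto_mle (N := N) hρ] with ω h1 h2
    by_cases hω : ω ∈ survival N X φ
    · filter_upwards [(h2 (h1 hω)).eventually hA] with n hn
      exact iff_of_false (fun hcon => hcon.2 hn) (notMem_empty ω)
    · exact Eventually.of_forall fun n => iff_of_false (fun hcon => hω hcon.1) (notMem_empty ω)

lemma IsCBP.tendstoInMeasure_sub_normSum (h : IsCBP P q X φ) (hu : Centered q u v)
    (hs : 1 < s) (hg : ∀ᵐ ω ∂P, ω ∈ survival N X φ → GeometricGrowth N X φ (s ^ 2) ω)
    (hP : P (survival N X φ) ≠ 0) (hR : NegligibleRemainder q u) {T : (ℕ → ℝ) → ℝ} {θ₀ : ℝ}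
    (hT : ApproxLinear T q u v θ₀) :
    TendstoInMeasure (P[|survival N X φ])
      ((fun n ω => √(totalProgenitors N X φ n ω : ℝ) * (T (mle N X φ n ω) - θ₀)) -
        fun n ω => normSum N X φ u n ω / v) atTop 0 := by
  have hS : MeasurableSet (survival N X φ) := measurableSet_survival h.measurable_Z
  obtain ⟨c, hc, hT⟩ := hT
  rw [tendstoInMeasure_iff_norm]
  intro ε hε
  simp_rw [cond_apply hS]
  suffices hmain : Tendsto (fun n => P (survival N X φ ∩ {ω | ε ≤ ‖((fun n ω =>
      √(totalProgenitors N X φ n ω : ℝ) * (T (mle N X φ n ω) - θ₀)) -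
        fun n ω => normSum N X φ u n ω / v) n ω - (0 : Ω → ℝ) ω‖})) atTop (𝓝 0) by
    have := ENNReal.Tendsto.const_mul (a := (P (survival N X φ))⁻¹) hmain
      (Or.inr (ENNReal.inv_ne_top.2 hP))
    rwa [mul_zero] at this
  rw [ENNReal.tendsto_nhds_zero]
  intro κ hκ
  obtain ⟨M, hM, htight⟩ := h.tight_normSum hu hs hg (ENNReal.half_pos hκ.ne')
  have hκ4 : 0 < κ / 2 / 2 := ENNReal.half_pos (ENNReal.half_pos hκ.ne').ne'
  -- The relative error `ε / (4 M)` is chosen after the tightness level `M`, so the linear term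
  -- costs at most `ε / 4`; the remainder costs at most `ε / 2`, and the total stays below `ε`.
  have h1 := h.tendsto_measure_not_approx hs hg (hT (ε / (4 * M)) (by positivity))
  have h2 := h.tendsto_measure_remainder hs hg hu.summable_abs hR
    (ε := ε / (2 * (c + 1))) (by positivity)
  filter_upwards [htight, h1.eventually_lt_const hκ4, h2.eventually_lt_const hκ4]
    with n h3 h4 h5
  refine (measure_mono fun ω hω => ?_).trans ((measure_union_le _ _).trans ((add_le_add h3
    ((measure_union_le _ _).trans (add_le_add h4.le h5.le))).trans_eq (by
      rw [ENNReal.add_halves, ENNReal.add_halves])))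
  obtain ⟨hω1, hω2⟩ := hω
  by_contra hcon
  simp only [mem_union, not_or] at hcon
  obtain ⟨k1, k2, k3⟩ := hcon
  have k1' : |normSum N X φ u n ω| < M := not_le.1 fun hh => k1 ⟨hω1, hh⟩
  have k2' := not_not.1 fun hh => k2 ⟨hω1, hh⟩
  have k3' : √(totalProgenitors N X φ n ω : ℝ) * remainder q u (mle N X φ n ω) <
      ε / (2 * (c + 1)) := not_le.1 fun hh => k3 ⟨hω1, hh⟩
  have hω3 : ε ≤ |√(totalProgenitors N X φ n ω : ℝ) * (T (mle N X φ n ω) - θ₀) -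
      normSum N X φ u n ω / v| := by
    simpa using hω2
  have k4 := mul_le_mul_of_nonneg_left k2' (Real.sqrt_nonneg (totalProgenitors N X φ n ω : ℝ))
  have k5 := sqrt_mul_tsum_mle (N := N) (X := X) (φ := φ) u n ω
  have e1 : √(totalProgenitors N X φ n ω : ℝ) * |T (mle N X φ n ω) - θ₀ -
      (∑' k, mle N X φ n ω k * u k) / v| = |√(totalProgenitors N X φ n ω : ℝ) *
        (T (mle N X φ n ω) - θ₀) - normSum N X φ u n ω / v| := by
    rw [← k5]
    nth_rewrite 1 [← abs_of_nonneg (Real.sqrt_nonneg (totalProgenitors N X φ n ω : ℝ))]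
    rw [← abs_mul]
    congr 1
    ring
  have e2 : √(totalProgenitors N X φ n ω : ℝ) * |∑' k, mle N X φ n ω k * u k| =
      |normSum N X φ u n ω| := by
    rw [← k5, abs_mul, abs_of_nonneg (Real.sqrt_nonneg _)]
  rw [e1, mul_add, mul_left_comm, e2, mul_left_comm] at k4
  have k6 : ε / (4 * M) * |normSum N X φ u n ω| ≤ ε / 4 := by
    calc _ ≤ ε / (4 * M) * M := by gcongr
      _ = ε / 4 := by field_simp
  have k7 : c * (√(totalProgenitors N X φ n ω : ℝ) * remainder q u (mle N X φ n ω)) ≤ ε / 2 := by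
    calc _ ≤ c * (ε / (2 * (c + 1))) := by gcongr
      _ ≤ (c + 1) * (ε / (2 * (c + 1))) := by gcongr; linarith
      _ = ε / 2 := by field_simp
  linarith

/-- Approximately linear functionals of the empirical offspring law are asymptotically normal. -/
theorem efficientLimit_of_approxLinear {p : ℝ → ℕ → ℝ} {θ₀ : ℝ} {T : (ℕ → ℝ) → ℝ}
    (h : IsCBP P (p θ₀) X φ) (hsup : Supercritical P (p θ₀) N X φ)
    (hu : Centered (p θ₀) (score p θ₀) (fisherInfo p θ₀)) (hI : 0 < fisherInfo p θ₀)
    (hR : NegligibleRemainder (p θ₀) (score p θ₀))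
    (hT : ApproxLinear T (p θ₀) (score p θ₀) (fisherInfo p θ₀) θ₀) :
    EfficientLimit P N X φ p θ₀ T := by
  obtain ⟨ρ, hρ, hg⟩ := h.ae_geometricGrowth hsup
  -- Writing the growth rate as a square makes the normalisation grow like `s ^ n`.
  have hs : 1 < √ρ := Real.lt_sqrt_of_sq_lt (by simpa using hρ)
  rw [← Real.sq_sqrt (by linarith : 0 ≤ ρ)] at hg
  have hP : P (survival N X φ) ≠ 0 := by
    obtain ⟨-, -, -, -, -, -, -, hP, -⟩ := hsup
    exact hP.ne'
  have := cond_isProbabilityMeasure hP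
  refine ⟨this, tendstoInDistribution_of_tendstoInMeasure_sub _ _
    (h.tendstoInDistribution_normSum hu hI hs hg hP)
    (h.tendstoInMeasure_sub_normSum hu hs hg hP hR hT) fun n => ?_⟩
  exact ((measurable_from_top.comp (h.measurable_totalProgenitors n)).sqrt.mul
    (h.measurable_comp_mle (fun r => T r - θ₀) n)).aemeasurable

end Limit

lemma IsFamily.centered_score {p : ℝ → ℕ → ℝ} {Θ : Set ℝ} (hp : IsFamily p Θ)
    (hd : LocallyDominated p Θ) {θ : ℝ} (hθ : θ ∈ interior Θ) :
    Centered (p θ) (score p θ) (fisherInfo p θ) := by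
  refine ⟨hp.isProb θ (interior_subset hθ),
    hasSum_of_eq (hp.tsum_dθ_eq_zero hd hθ).1 (fun k => (hp.score_mul hθ k).symm) rfl, ?_⟩
  obtain ⟨ε, hε, -, J, L, M, -, -, hM, hdom⟩ := hd θ hθ
  exact (Summable.of_norm_bounded hM fun k => (hdom θ ⟨by linarith, by linarith⟩ k).2.2.le).hasSum

end CBP

/-! ### Assembly of the two cases -/

theorem mainTheorem1 {Ω : Type*} [MeasurableSpace Ω] (P : Measure Ω) [IsProbabilityMeasure P]
    (p : ℝ → ℕ → ℝ) (Θ : Set ℝ) (hp : CBP.IsFamily p Θ)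
    (θ₀ : ℝ) (hθ₀ : θ₀ ∈ interior Θ)
    (N : ℕ) (X φ : ℕ → ℕ → Ω → ℕ) (hCBP : CBP.IsCBP P (p θ₀) X φ)
    (hsup : CBP.Supercritical P (p θ₀) N X φ)
    (C : Set ℝ) (hC : IsCompact C) (hCΘ : C ⊆ Θ)
    (hcont : ∀ k, ContinuousOn (fun θ => p θ k) C) :
    (∀ (G : ℝ → ℝ) (T : (ℕ → ℝ) → ℝ),
      CBP.IsDisparity G →
      CBP.IsDisparityFunctional G p Θ T →
      p θ₀ ∈ CBP.GammaHat G p Θ C →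
      CBP.BoundedGenerator G →
      CBP.LocallyDominated p Θ →
      CBP.BoundedRAF G →
      (Summable fun k => |CBP.dθ (CBP.sqrtFamily p) θ₀ k|) →
      0 < CBP.fisherInfo p θ₀ →
      CBP.EstimatorContinuity P N X φ p Θ θ₀ →
      CBP.EfficientLimit P N X φ p θ₀ T) ∧
    (∀ (T : (ℕ → ℝ) → ℝ) (s' s'' : ℝ → ℕ → ℝ),
      CBP.IsDisparityFunctional CBP.hellinger p Θ T →
      p θ₀ ∈ CBP.GammaHat CBP.hellinger p Θ C →
      CBP.TwiceL2Diff p Θ s' s'' →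
      ∑' k, s'' θ₀ k * √(p θ₀ k) < 0 →
      CBP.EfficientLimit P N X φ p θ₀ T) := by
  refine ⟨fun G T hG hT hΓ hb hd hA hs hI _ => ?_, fun T s' s'' hT hΓ h hneg => ?_⟩
  · have hu := hp.centered_score hd hθ₀
    exact CBP.efficientLimit_of_approxLinear hCBP hsup hu hI
      (CBP.negligibleRemainder_of_summable hp hθ₀ hs)
      (CBP.approxLinear_disparityFunctional hG hb hp hC hCΘ hcont hθ₀ hΓ hT hd hA hI
        hu.summable_abs)
  · have hI := h.fisherInfo_pos hp hθ₀ hneg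
    exact CBP.efficientLimit_of_approxLinear hCBP hsup
      ⟨hp.isProb θ₀ (interior_subset hθ₀), h.hasSum_score hp hθ₀,
        (h.hasSum_fisherInfo hp hθ₀).summable.hasSum⟩ hI
      (h.negligibleRemainder hp hθ₀ hCBP.offspring_variance)
      (CBP.approxLinear_hellinger hp hC hCΘ hcont hθ₀ hΓ hT h hI)
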